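/- Proposition. Let $\mathcal D=(D_1,D_2,D_3)$ be three pairwise disjoint nonempty connected open subsets of the unit sphere $\mathbb S^2$, and let $N=\overline{\partial D_1\cup\partial D_2\cup\partial D_3}$ be their boundary set. An arc is the image of an injective $C^\infty$ map $\gamma:[a,b]\to\mathbb S^2$ ($a<b$, smooth up to the ends) with nowhere vanishing velocity. A point $x\in N$ has valence $\nu$ if, in some neighborhood of $x$, $N$ coincides with the union of $\nu$ arcs that have one end at $x$, are pairwise disjoint away from $x$, and pairwise form positive angles at $x$. The points of $N$ of some valence $\nu\ge 3$ are called critical, and $X(N)$ denotes the set of critical points. Assume that 1. (regular) $X(N)$ is finite, and near each point $x\in N\setminus X(N)$ the set $N$ coincides with an arc having $x$ in its interior; 2. (strong) $\operatorname{Int}\big(\overline{D_1\cup D_2\cup D_3}\big)=\mathbb S^2$; 3. (non-admissible) the graph with vertices $1,2,3$, in which distinct $i,j$ are adjacent when $\operatorname{Int}\big(\overline{D_i\cup D_j}\big)$ is connected, is not bipartite. Then $X(N)=\{x_1,x_2\}$ for two distinct points $x_1,x_2$, each of valence $3$, and $N$ is the union of three arcs joining $x_1$ to $x_2$, any two of which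 meet exactly in their common ends $x_1$ and $x_2$. -/

import Mathlib

open Set Topology
open scoped ContDiff

namespace SpherePartition

/-- Euclidean three-space. -/
abbrev E3 : Type := EuclideanSpace ℝ (Fin 3)

/-- The unit sphere `S²`, with its subspace topology. -/
abbrev S2 : Type := Metric.sphere (0 : E3) 1

/-- `γ` restricted to `[a, b]` is a simple smooth regular arc on the sphere: it is `C^∞` up to the
ends (as a map into the ambient space, the sphere being an embedded submanifold), its velocity
never vanishes, and it has no self-crossing. The values of `γ` outside `[a, b]` are irrelevant. -/
structure IsSmoothArc (γ : ℝ → S2) (a b : ℝ) : Prop where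
  contDiffOn : ContDiffOn ℝ ∞ (fun t => (γ t : E3)) (Icc a b)
  velocity_ne_zero : ∀ t ∈ Icc a b, derivWithin (fun s => (γ s : E3)) (Icc a b) t ≠ 0
  injOn : InjOn γ (Icc a b)

/-- The velocity at the starting point of an arc parametrized by `[0, 1]`. -/
noncomputable def initialVelocity (γ : ℝ → S2) : E3 :=
  derivWithin (fun s => (γ s : E3)) (Icc 0 1) 0

/-- Near `x`, the set `N` is a smooth arc through `x`, and `x` is an interior point of the arc. -/
def IsArcNear (N : Set S2) (x : S2) : Prop :=
  ∃ γ : ℝ → S2, IsSmoothArc γ (-1) 1 ∧ γ 0 = x ∧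
    ∃ U ∈ 𝓝 x, N ∩ U = γ '' Icc (-1) 1 ∩ U

/-- Near `x`, the set `N` is the union of `ν` smooth arcs that start at `x`, are disjoint away
from `x`, and have pairwise distinct directions at `x` (any two of them form a positive angle). -/
def HasValence (N : Set S2) (x : S2) (ν : ℕ) : Prop :=
  ∃ γ : Fin ν → ℝ → S2,
    (∀ j, IsSmoothArc (γ j) 0 1 ∧ γ j 0 = x) ∧
    (∀ i j, i ≠ j → γ i '' Icc 0 1 ∩ γ j '' Icc 0 1 = {x}) ∧
    (∀ i j, i ≠ j →
      0 < InnerProductGeometry.angle (initialVelocity (γ i)) (initialVelocity (γ j))) ∧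
    ∃ U ∈ 𝓝 x, N ∩ U = (⋃ j, γ j '' Icc 0 1) ∩ U

/-- The critical points of `N`: the points at which at least three arcs of `N` meet. -/
def criticalPoints (N : Set S2) : Set S2 :=
  {x | ∃ ν : ℕ, 3 ≤ ν ∧ HasValence N x ν}

/-- Regular closed subsets of the sphere: there are finitely many critical points, and `N` is
a smooth arc near each of its other points. -/
structure IsRegularClosed (N : Set S2) : Prop where
  isClosed : IsClosed N
  finite_criticalPoints : (criticalPoints N).Finite
  isArcNear : ∀ x ∈ N \ criticalPoints N, IsArcNear N x

/-- A `k`-partition of the sphere: `k` pairwise disjoint domains (nonempty connected open sets).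
They are not required to fill the sphere. -/
structure IsPartition {k : ℕ} (D : Fin k → Set S2) : Prop where
  isOpen : ∀ i, IsOpen (D i)
  isConnected : ∀ i, IsConnected (D i)
  disjoint : Pairwise fun i j => Disjoint (D i) (D j)

/-- A partition of the sphere is strong if `Int (closure (⋃ D i))` is the whole sphere. -/
def IsStrong {k : ℕ} (D : Fin k → Set S2) : Prop :=
  interior (closure (⋃ i, D i)) = univ

/-- The boundary set `N(D)` of a partition. -/
def boundarySet {k : ℕ} (D : Fin k → Set S2) : Set S2 :=
  closure (⋃ i, frontier (D i))

/-- A partition is regular if its boundary set is a regular closed set. (The boundary of each `D i`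
then consists of finitely many smooth arcs meeting at positive angles, so that no
further boundary regularity of the single domains has to be imposed.) -/
def IsRegularPartition {k : ℕ} (D : Fin k → Set S2) : Prop :=
  IsRegularClosed (boundarySet D)

/-- The graph of a partition: distinct `D i`, `D j` are neighbors if
`Int (closure (D i ∪ D j))` is connected. -/
def neighborGraph {k : ℕ} (D : Fin k → Set S2) : SimpleGraph (Fin k) where
  Adj i j := i ≠ j ∧ IsConnected (interior (closure (D i ∪ D j)))
  symm := ⟨fun i j h => ⟨h.1.symm, by rw [union_comm]; exact h.2⟩⟩
  loopless := ⟨fun _ h => h.1 rfl⟩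

/-- A partition is admissible if its neighbor graph is bipartite. -/
def IsAdmissible {k : ℕ} (D : Fin k → Set S2) : Prop :=
  (neighborGraph D).IsBipartite

end SpherePartition

open SpherePartition

/-! On three vertices a non-bipartite graph is the triangle, so the three domains are pairwise
neighbours. Stereographic projection from a point of `D 0` turns the boundary set into a compact
plane set `S ∪ X`, where `X` is the finite set of vertices and `S` is a smooth arc near each of its
points (`IsPartition.planarPartition`). Following `S` at unit speed from a vertex cannot go on
forever, by compactness, so every branch at a vertex continues to an edge that ends at a vertex
(`exists_edge`).

Cauchy integrals play the part of the Jordan curve theorem and of Euler's formula. If complex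
weights `w e` on the edges have zero boundary at every vertex, then the function W(z) = ∑ w e ∫_e
dζ/(ζ - z) is constant on each domain and jumps by 2πi · `w e` across the edge `e`.

There are no loops (`no_loop`): at most two domains touch a loop along its interior, and a domain `D
c` that does not touch it meets each other domain at points off the loop, where W is locally
constant. So W has the same value on all three domains, against the jump. The same argument, applied
with an artificial vertex at a regular point, excludes closed curves of `S` without vertices, so the
edges cover `S` (`exists_mem_edge`).

Counting (`card_edges_le`, `exists_theta`): a weight with zero boundary and equal values of W on the
three domains vanishes, so there are at most (|X| - 1) + 2 edges. All valences are at least 3, so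
3|X| is at most twice the number of edges, whence |X| ≤ 2. Without loops |X| ≥ 2. Hence there are
two vertices of valence 3 and three edges, each joining one vertex to the other. -/

namespace SpherePartition

open Filter MeasureTheory

/-! ### Cauchy integrals of plane curves: local variation and jump. -/

/-- A curve `c` on `[0, L]` with continuous velocity `d`. -/
structure IsC1Curve (L : ℝ) (c d : ℝ → ℂ) : Prop where
  pos : 0 < L
  continuousOn : ContinuousOn c (Icc 0 L)
  continuousOn_deriv : ContinuousOn d (Icc 0 L)
  hasDerivAt : ∀ t ∈ Ioo 0 L, HasDerivAt c (d t) t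

/-- The Cauchy integral of a curve. -/
noncomputable def cauchyInt (L : ℝ) (c d : ℝ → ℂ) (z : ℂ) : ℂ :=
  ∫ t in (0 : ℝ)..L, d t / (c t - z)

namespace IsC1Curve

variable {L : ℝ} {c d : ℝ → ℂ}

theorem intervalIntegrable (h : IsC1Curve L c d) {a b : ℝ} (ha : 0 ≤ a) (hab : a ≤ b) (hb : b ≤ L)
    {z : ℂ} (hz : ∀ t ∈ Icc a b, c t ≠ z) :
    IntervalIntegrable (fun t => d t / (c t - z)) volume a b := by
  have hs : Icc a b ⊆ Icc 0 L := Icc_subset_Icc ha hb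
  apply ContinuousOn.intervalIntegrable
  rw [uIcc_of_le hab]
  exact (h.continuousOn_deriv.mono hs).div ((h.continuousOn.mono hs).sub continuousOn_const)
    fun t ht => sub_ne_zero.2 (hz t ht)

/-- The difference of the integrands is the derivative of log(κ(c - z)/(c - w)). The factor `κ`
turns the branch cut: it is 1 away from the curve and -1 when `z` and `w` lie on opposite sides of
it. -/
theorem integral_sub_eq_log (h : IsC1Curve L c d) {a b : ℝ} (ha : 0 ≤ a) (hab : a ≤ b)
    (hb : b ≤ L) {z w κ : ℂ}
    (hr : ∀ t ∈ Icc a b, κ * ((c t - z) / (c t - w)) ∈ Complex.slitPlane) :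
    (∫ t in a..b, d t / (c t - z)) - ∫ t in a..b, d t / (c t - w) =
      Complex.log (κ * ((c b - z) / (c b - w))) - Complex.log (κ * ((c a - z) / (c a - w))) := by
  have hs : Icc a b ⊆ Icc 0 L := Icc_subset_Icc ha hb
  have hne : ∀ t ∈ Icc a b, c t - z ≠ 0 ∧ c t - w ≠ 0 ∧ κ ≠ 0 := by
    intro t ht
    have := Complex.slitPlane_ne_zero (hr t ht)
    refine ⟨?_, ?_, ?_⟩ <;> intro h0 <;> simp [h0] at this
  have hi1 := h.intervalIntegrable ha hab hb (z := z) fun t ht => sub_ne_zero.1 (hne t ht).1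
  have hi2 := h.intervalIntegrable ha hab hb (z := w) fun t ht => sub_ne_zero.1 (hne t ht).2.1
  rw [← intervalIntegral.integral_sub hi1 hi2]
  refine intervalIntegral.integral_eq_sub_of_hasDerivAt_of_le
    (f := fun t => Complex.log (κ * ((c t - z) / (c t - w)))) hab ?_ ?_ (hi1.sub hi2)
  · refine ContinuousOn.clog ?_ hr
    exact continuousOn_const.mul (((h.continuousOn.mono hs).sub continuousOn_const).div
      ((h.continuousOn.mono hs).sub continuousOn_const) fun t ht => (hne t ht).2.1)
  · intro t ht
    have ht' := Ioo_subset_Icc_self ht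
    obtain ⟨h1, h2, h3⟩ := hne t ht'
    have hc := h.hasDerivAt t ⟨ha.trans_lt ht.1, ht.2.trans_le hb⟩
    have := (((hc.sub_const z).div (hc.sub_const w) h2).const_mul κ).clog_real (hr t ht')
    refine this.congr_deriv ?_
    simp only [Pi.div_apply]
    field_simp

/-- Near `p` the ratio (c - z)/(c - w) stays within distance 1 of 1, hence off the branch cut. -/
theorem eventually_integral_sub_eq_log (h : IsC1Curve L c d) {a b : ℝ} (ha : 0 ≤ a) (hab : a ≤ b)
    (hb : b ≤ L) {p : ℂ} (hp : p ∉ c '' Icc a b) :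
    ∀ᶠ q : ℂ × ℂ in 𝓝 (p, p),
      (∫ t in a..b, d t / (c t - q.1)) - ∫ t in a..b, d t / (c t - q.2) =
      Complex.log ((c b - q.1) / (c b - q.2)) - Complex.log ((c a - q.1) / (c a - q.2)) := by
  have hcl : IsClosed (c '' Icc a b) :=
    (isCompact_Icc.image_of_continuousOn
      (h.continuousOn.mono (Icc_subset_Icc ha hb))).isClosed
  obtain ⟨m, hm, hball⟩ := Metric.isOpen_iff.1 hcl.isOpen_compl p hp
  have h1 : ∀ᶠ q : ℂ × ℂ in 𝓝 (p, p), q.1 ∈ Metric.ball p (m / 4) :=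
    continuous_fst.continuousAt.eventually_mem (Metric.ball_mem_nhds _ (by positivity))
  have h2 : ∀ᶠ q : ℂ × ℂ in 𝓝 (p, p), q.2 ∈ Metric.ball p (m / 4) :=
    continuous_snd.continuousAt.eventually_mem (Metric.ball_mem_nhds _ (by positivity))
  filter_upwards [h1, h2] with q hq1 hq2
  have key := h.integral_sub_eq_log ha hab hb (z := q.1) (w := q.2) (κ := 1) ?_
  · simpa using key
  intro t ht
  have hct : m ≤ dist (c t) p := by
    by_contra hlt
    exact hball (Metric.mem_ball.2 (not_le.1 hlt)) ⟨t, ht, rfl⟩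
  rw [Metric.mem_ball] at hq1 hq2
  have h3 : 3 * m / 4 < ‖c t - q.2‖ := by
    have := dist_triangle (c t) q.2 p
    rw [dist_eq_norm (c t) q.2] at this
    linarith
  have h4 : ‖q.2 - q.1‖ < m / 2 := by
    have := dist_triangle_right q.2 q.1 p
    rw [dist_eq_norm q.2 q.1] at this
    linarith
  have h5 : c t - q.2 ≠ 0 := by
    rw [← norm_pos_iff]; linarith
  have h6 : 1 * ((c t - q.1) / (c t - q.2)) = 1 + (q.2 - q.1) / (c t - q.2) := by
    field_simp; ring
  rw [h6]
  apply Complex.mem_slitPlane_of_norm_lt_one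
  rw [norm_div, div_lt_one (by linarith)]
  linarith

theorem tendsto_integral_sub (h : IsC1Curve L c d) {a b : ℝ} (ha : 0 ≤ a) (hab : a ≤ b)
    (hb : b ≤ L) {p : ℂ} (hp : p ∉ c '' Icc a b) :
    Tendsto (fun q : ℂ × ℂ =>
      (∫ t in a..b, d t / (c t - q.1)) - ∫ t in a..b, d t / (c t - q.2)) (𝓝 (p, p)) (𝓝 0) := by
  have hlim : ∀ t ∈ Icc a b, Tendsto (fun q : ℂ × ℂ =>
      Complex.log ((c t - q.1) / (c t - q.2))) (𝓝 (p, p)) (𝓝 0) := by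
    intro t ht
    have hne : c t - p ≠ 0 := fun h0 => hp ⟨t, ht, sub_eq_zero.1 h0⟩
    have : ContinuousAt (fun q : ℂ × ℂ => Complex.log ((c t - q.1) / (c t - q.2))) (p, p) := by
      refine ContinuousAt.clog ?_ (by simp [hne])
      exact (continuousAt_const.sub continuousAt_fst).div
        (continuousAt_const.sub continuousAt_snd) hne
    simpa [ContinuousAt, hne] using this
  have := (hlim b (right_mem_Icc.2 hab)).sub (hlim a (left_mem_Icc.2 hab))
  rw [sub_zero] at this
  refine this.congr' ?_
  filter_upwards [h.eventually_integral_sub_eq_log ha hab hb hp] with q hq using hq.symm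

/-- The variation depends on the ends of the curve only; this is what cancels in a cycle. -/
theorem cauchyInt_sub_eventually (h : IsC1Curve L c d) {p : ℂ} (hp : p ∉ c '' Icc 0 L) :
    ∀ᶠ z in 𝓝 p, cauchyInt L c d z - cauchyInt L c d p =
      Complex.log ((c L - z) / (c L - p)) - Complex.log ((c 0 - z) / (c 0 - p)) := by
  have := h.eventually_integral_sub_eq_log le_rfl h.pos.le le_rfl hp
  have ht : Tendsto (fun z : ℂ => (z, p)) (𝓝 p) (𝓝 (p, p)) :=
    (continuous_id.prodMk continuous_const).tendsto p
  exact ht.eventually this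

/-- The pieces of the curve away from `t₀` contribute 0 in the limit. On the piece near `t₀` the
logarithm of minus the ratio tends to πi at the right end and to -πi at the left end. -/
theorem tendsto_cauchyInt_jump (h : IsC1Curve L c d) {t₀ : ℝ} (ht₀ : t₀ ∈ Ioo 0 L)
    (hv : d t₀ ≠ 0) (hinj : ∀ t ∈ Icc 0 L, c t = c t₀ → t = t₀) :
    Tendsto (fun ε : ℝ => cauchyInt L c d (c t₀ + ε * (Complex.I * d t₀)) -
      cauchyInt L c d (c t₀ - ε * (Complex.I * d t₀))) (𝓝[>] 0) (𝓝 (2 * Real.pi * Complex.I)) := by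
  set p := c t₀ with hp
  set v := d t₀ with hvdef
  have hder : HasDerivAt (fun t => ((c t - p) / v).re) 1 t₀ := by
    have h1 := ((h.hasDerivAt t₀ ht₀).sub_const p).div_const v
    rw [← hvdef, div_self hv] at h1
    simpa [Function.comp_def] using (Complex.reCLM.hasFDerivAt.comp_hasDerivAt t₀ h1)
  -- In the frame of the tangent `v`, the real part of the curve has the sign of t - t₀. By `him`
  -- below, this keeps the ratio off the branch cut and decides from which side it approaches it.
  have hslope : ∀ᶠ t in 𝓝 t₀, t ≠ t₀ → 0 < ((c t - p) / v).re * (t - t₀) := by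
    have h1 := hder.tendsto_slope.eventually (lt_mem_nhds (zero_lt_one (α := ℝ)))
    rw [eventually_nhdsWithin_iff] at h1
    filter_upwards [h1] with t ht hne
    have h2 := ht hne
    have h3 : t - t₀ ≠ 0 := sub_ne_zero.2 hne
    rw [slope_def_field] at h2
    simp only [← hp, sub_self, zero_div, Complex.zero_re, sub_zero] at h2
    have h4 : ((c t - p) / v).re * (t - t₀) = ((c t - p) / v).re / (t - t₀) * (t - t₀) ^ 2 := by
      field_simp
    rw [h4]
    positivity
  obtain ⟨η, hη, hηs⟩ : ∃ η > 0, ∀ t ∈ Icc (t₀ - η) (t₀ + η),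
      t ∈ Ioo 0 L ∧ (t ≠ t₀ → 0 < ((c t - p) / v).re * (t - t₀)) := by
    have hI : ∀ᶠ t in 𝓝 t₀, t ∈ Ioo 0 L := Ioo_mem_nhds ht₀.1 ht₀.2
    have := hI.and hslope
    obtain ⟨η, hη, hb⟩ := Metric.nhds_basis_closedBall.eventually_iff.1 this
    refine ⟨η, hη, fun t ht => hb ?_⟩
    rwa [Real.closedBall_eq_Icc]
  have hL := (hηs (t₀ - η) ⟨le_rfl, by linarith⟩).1
  have hR := (hηs (t₀ + η) ⟨by linarith, le_rfl⟩).1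
  -- the moving points
  have hq : Tendsto (fun ε : ℝ => (p + ε * (Complex.I * v), p - ε * (Complex.I * v)))
      (𝓝[>] 0) (𝓝 (p, p)) := by
    have : ContinuousAt
        (fun ε : ℝ => (p + ε * (Complex.I * v), p - ε * (Complex.I * v))) 0 := by fun_prop
    have h2 := this.tendsto
    simp only [Complex.ofReal_zero, zero_mul, add_zero, sub_zero] at h2
    exact h2.mono_left nhdsWithin_le_nhds
  have hpL : p ∉ c '' Icc 0 (t₀ - η) := by
    rintro ⟨t, ht, htp⟩
    have := hinj t ⟨ht.1, ht.2.trans hL.2.le⟩ htp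
    linarith [ht.2]
  have hpR : p ∉ c '' Icc (t₀ + η) L := by
    rintro ⟨t, ht, htp⟩
    have := hinj t ⟨hR.1.le.trans ht.1, ht.2⟩ htp
    linarith [ht.1]
  have h1 := (h.tendsto_integral_sub le_rfl hL.1.le hL.2.le hpL).comp hq
  have h3 := (h.tendsto_integral_sub hR.1.le hR.2.le le_rfl hpR).comp hq
  have hratio : ∀ t ε : ℝ, (c t - (p + ε * (Complex.I * v))) / (c t - (p - ε * (Complex.I * v))) =
      ((c t - p) / v - ε * Complex.I) / ((c t - p) / v + ε * Complex.I) := by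
    intro t ε
    rw [← div_div_div_cancel_right₀ hv]
    congr 1 <;> field_simp <;> ring
  have him : ∀ (δ : ℂ) (ε : ℝ), (-1 * ((δ - ε * Complex.I) / (δ + ε * Complex.I))).im =
      2 * ε * δ.re / Complex.normSq (δ + ε * Complex.I) := by
    intro δ ε
    simp only [neg_mul, one_mul, Complex.neg_im, Complex.div_im]
    simp
    ring
  have hnorm : ∀ (δ : ℂ) (ε : ℝ), δ.re ≠ 0 → 0 < Complex.normSq (δ + ε * Complex.I) := by
    intro δ ε hδ
    rw [Complex.normSq_pos]
    intro h0
    apply hδ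
    simpa using congrArg Complex.re h0
  -- At `t₀` itself the ratio is -1, which is why `κ = -1` is taken.
  have h2eq : ∀ᶠ ε : ℝ in 𝓝[>] 0,
      (∫ t in (t₀ - η)..(t₀ + η), d t / (c t - (p + ε * (Complex.I * v)))) -
        ∫ t in (t₀ - η)..(t₀ + η), d t / (c t - (p - ε * (Complex.I * v))) =
      Complex.log (-1 * ((c (t₀ + η) - (p + ε * (Complex.I * v))) /
          (c (t₀ + η) - (p - ε * (Complex.I * v))))) -
      Complex.log (-1 * ((c (t₀ - η) - (p + ε * (Complex.I * v))) /
          (c (t₀ - η) - (p - ε * (Complex.I * v))))) := by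
    filter_upwards [self_mem_nhdsWithin] with ε hε
    have hε : 0 < ε := hε
    refine h.integral_sub_eq_log hL.1.le (by linarith) hR.2.le ?_
    intro t ht
    rw [hratio]
    by_cases htt : t = t₀
    · subst htt
      have : (ε : ℂ) ≠ 0 := by exact_mod_cast hε.ne'
      have h5 : (-1 : ℂ) * (((c t - p) / v - ε * Complex.I) / ((c t - p) / v + ε * Complex.I)) = 1 := by
        rw [← hp]; simp only [sub_self, zero_div, zero_sub, zero_add]
        field_simp
      rw [h5]
      exact Complex.one_mem_slitPlane
    · refine Complex.mem_slitPlane_iff.2 (Or.inr ?_)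
      have h6 : ((c t - p) / v).re ≠ 0 := fun h0 => by
        have := (hηs t ht).2 htt
        rw [h0, zero_mul] at this
        exact lt_irrefl _ this
      rw [him]
      exact div_ne_zero (mul_ne_zero (by positivity) h6) (hnorm _ _ h6).ne'
  have hlim1 : ∀ t : ℝ, ((c t - p) / v).re ≠ 0 → Tendsto (fun ε : ℝ =>
      -1 * ((c t - (p + ε * (Complex.I * v))) / (c t - (p - ε * (Complex.I * v)))))
      (𝓝[>] 0) (𝓝 (-1)) := by
    intro t ht
    simp_rw [hratio]
    have hne : (c t - p) / v ≠ 0 := fun h0 => ht (by rw [h0]; simp)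
    have : ContinuousAt (fun ε : ℝ =>
        -1 * (((c t - p) / v - ε * Complex.I) / ((c t - p) / v + ε * Complex.I))) 0 := by
      refine continuousAt_const.mul (ContinuousAt.div (by fun_prop) (by fun_prop) ?_)
      simpa using hne
    have h2 := this.tendsto
    simp only [Complex.ofReal_zero, zero_mul, add_zero, sub_zero, div_self hne, mul_one] at h2
    exact h2.mono_left nhdsWithin_le_nhds
  have hposR : 0 < ((c (t₀ + η) - p) / v).re := by
    have := (hηs (t₀ + η) ⟨by linarith, le_rfl⟩).2 (by linarith)
    nlinarith
  have hnegL : ((c (t₀ - η) - p) / v).re < 0 := by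
    have := (hηs (t₀ - η) ⟨le_rfl, by linarith⟩).2 (by linarith)
    nlinarith
  have hlogR := (Complex.tendsto_log_nhdsWithin_im_nonneg_of_re_neg_of_im_zero
    (z := -1) (by simp) (by simp)).comp (tendsto_nhdsWithin_iff.2 ⟨hlim1 _ hposR.ne', by
      filter_upwards [self_mem_nhdsWithin] with ε hε
      have hε : 0 < ε := hε
      change _ ≤ _
      rw [hratio, him]
      exact div_nonneg (by positivity) (Complex.normSq_nonneg _)⟩)
  have hlogL := (Complex.tendsto_log_nhdsWithin_im_neg_of_re_neg_of_im_zero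
    (z := -1) (by simp) (by simp)).comp (tendsto_nhdsWithin_iff.2 ⟨hlim1 _ hnegL.ne, by
      filter_upwards [self_mem_nhdsWithin] with ε hε
      have hε : 0 < ε := hε
      change _ < _
      rw [hratio, him]
      exact div_neg_of_neg_of_pos (by nlinarith) (hnorm _ _ hnegL.ne)⟩)
  have h2 := (hlogR.sub hlogL).congr' (by
    filter_upwards [h2eq] with ε hε using hε.symm)
  have hsum := (h1.add h2).add h3
  refine (hsum.congr' ?_).trans (by
    apply le_of_eq; congr 1; simp; ring)
  have hmid : ∀ s : ℝ, s ≠ 0 → ∀ t ∈ Icc (t₀ - η) (t₀ + η), c t ≠ p + s * (Complex.I * v) := by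
    intro s hs t ht heq
    have h7 : (c t - p) / v = s * Complex.I := by
      rw [heq]; field_simp; ring
    by_cases htt : t = t₀
    · rw [htt, ← hp] at h7
      simp [eq_comm, hs] at h7
    · have := (hηs t ht).2 htt
      rw [h7] at this
      simp at this
  have hout : ∀ a b : ℝ, 0 ≤ a → b ≤ L → p ∉ c '' Icc a b →
      ∀ᶠ q : ℂ × ℂ in 𝓝 (p, p), q.1 ∉ c '' Icc a b ∧ q.2 ∉ c '' Icc a b := by
    intro a b ha hb hpab
    have hcl : IsClosed (c '' Icc a b) :=
      (isCompact_Icc.image_of_continuousOn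
        (h.continuousOn.mono (Icc_subset_Icc ha hb))).isClosed
    have := hcl.isOpen_compl.mem_nhds hpab
    exact ((continuousAt_fst (p := (p, p))).eventually_mem this).and
      ((continuousAt_snd (p := (p, p))).eventually_mem this)
  filter_upwards [self_mem_nhdsWithin, hq.eventually (hout 0 (t₀ - η) le_rfl hL.2.le hpL),
    hq.eventually (hout (t₀ + η) L hR.1.le le_rfl hpR)] with ε hε ho1 ho2
  have hε : 0 < ε := hε
  have i1 := h.intervalIntegrable le_rfl hL.1.le hL.2.le fun t ht h0 => ho1.1 ⟨t, ht, h0⟩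
  have i2 := h.intervalIntegrable le_rfl hL.1.le hL.2.le fun t ht h0 => ho1.2 ⟨t, ht, h0⟩
  have i3 := h.intervalIntegrable hL.1.le (by linarith) hR.2.le (hmid ε hε.ne')
  have i4 := h.intervalIntegrable hL.1.le (by linarith) hR.2.le (hmid (-ε) (neg_ne_zero.2 hε.ne'))
  have i5 := h.intervalIntegrable hR.1.le hR.2.le le_rfl fun t ht h0 => ho2.1 ⟨t, ht, h0⟩
  have i6 := h.intervalIntegrable hR.1.le hR.2.le le_rfl fun t ht h0 => ho2.2 ⟨t, ht, h0⟩
  rw [Complex.ofReal_neg, neg_mul, ← sub_eq_add_neg] at i4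
  simp only [cauchyInt, Function.comp_apply]
  rw [← intervalIntegral.integral_add_adjacent_intervals (i1.trans i3) i5,
    ← intervalIntegral.integral_add_adjacent_intervals (i2.trans i4) i6,
    ← intervalIntegral.integral_add_adjacent_intervals i1 i3,
    ← intervalIntegral.integral_add_adjacent_intervals i2 i4]
  ring

end IsC1Curve

/-- A weighted family of curves is a cycle if the weighted boundary vanishes. The sum of Cauchy
integrals of a cycle is locally constant off the curves. -/
theorem cauchyInt_cycle_eventually_eq {ι : Type*} [Fintype ι] {L : ι → ℝ} {c d : ι → ℝ → ℂ}
    (h : ∀ e, IsC1Curve (L e) (c e) (d e)) {w : ι → ℂ}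
    (hw : ∀ f : ℂ → ℂ, ∑ e, w e * (f (c e (L e)) - f (c e 0)) = 0) {p : ℂ}
    (hp : ∀ e, p ∉ c e '' Icc 0 (L e)) :
    ∀ᶠ z in 𝓝 p, ∑ e, w e * cauchyInt (L e) (c e) (d e) z =
      ∑ e, w e * cauchyInt (L e) (c e) (d e) p := by
  have := eventually_all.2 fun e => (h e).cauchyInt_sub_eventually (hp e)
  filter_upwards [this] with z hz
  -- The cycle condition is applied to the test function y ↦ log((y - z)/(y - p)).
  rw [← sub_eq_zero, ← Finset.sum_sub_distrib, ← hw fun y => Complex.log ((y - z) / (y - p))]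
  refine Finset.sum_congr rfl fun e _ => ?_
  rw [← mul_sub, hz e]

/-- The jump of a sum of Cauchy integrals across an interior point of one of the curves. -/
theorem tendsto_sum_cauchyInt_jump {ι : Type*} [Fintype ι] {L : ι → ℝ} {c d : ι → ℝ → ℂ}
    (h : ∀ e, IsC1Curve (L e) (c e) (d e)) (w : ι → ℂ) {e₀ : ι} {t₀ : ℝ}
    (ht₀ : t₀ ∈ Ioo 0 (L e₀)) (hv : d e₀ t₀ ≠ 0)
    (hinj : ∀ t ∈ Icc 0 (L e₀), c e₀ t = c e₀ t₀ → t = t₀)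
    (hoff : ∀ e ≠ e₀, c e₀ t₀ ∉ c e '' Icc 0 (L e)) :
    Tendsto (fun ε : ℝ =>
      ∑ e, w e * cauchyInt (L e) (c e) (d e) (c e₀ t₀ + ε * (Complex.I * d e₀ t₀)) -
      ∑ e, w e * cauchyInt (L e) (c e) (d e) (c e₀ t₀ - ε * (Complex.I * d e₀ t₀)))
      (𝓝[>] 0) (𝓝 (w e₀ * (2 * Real.pi * Complex.I))) := by
  classical
  have hlim : w e₀ * (2 * Real.pi * Complex.I) =
      ∑ e, w e * (if e = e₀ then 2 * Real.pi * Complex.I else 0) := by simp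
  simp_rw [← Finset.sum_sub_distrib, ← mul_sub]
  rw [hlim]
  refine tendsto_finsetSum _ fun e _ => Tendsto.const_mul _ ?_
  by_cases he : e = e₀
  · subst he
    rw [if_pos rfl]
    exact (h e).tendsto_cauchyInt_jump ht₀ hv hinj
  · rw [if_neg he]
    have hq : Tendsto (fun ε : ℝ => (c e₀ t₀ + ε * (Complex.I * d e₀ t₀),
        c e₀ t₀ - ε * (Complex.I * d e₀ t₀))) (𝓝[>] 0) (𝓝 (c e₀ t₀, c e₀ t₀)) := by
      have : ContinuousAt (fun ε : ℝ => (c e₀ t₀ + ε * (Complex.I * d e₀ t₀),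
        c e₀ t₀ - ε * (Complex.I * d e₀ t₀))) 0 := by fun_prop
      have h2 := this.tendsto
      simp only [Complex.ofReal_zero, zero_mul, add_zero, sub_zero] at h2
      exact h2.mono_left nhdsWithin_le_nhds
    have h3 := ((h e).tendsto_integral_sub le_rfl (h e).pos.le le_rfl (hoff e he)).comp hq
    exact h3

/-! ### Unit speed curves in a locally arc-like set: uniqueness and injectivity. -/

/-- A smooth unit speed curve in `S`, parametrized by the open interval `(a, b)`. -/
structure UnitCurve (S : Set ℂ) (a b : ℝ) (k : ℝ → ℂ) : Prop where
  contDiffOn : ContDiffOn ℝ ∞ k (Ioo a b)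
  norm_deriv : ∀ t ∈ Ioo a b, ‖deriv k t‖ = 1
  mapsTo : MapsTo k (Ioo a b) S

/-- Near `p`, the set `S` is a unit speed arc through `p`. -/
def HasArcAt (S : Set ℂ) (p : ℂ) : Prop :=
  ∃ (δ : ℝ) (g : ℝ → ℂ), 0 < δ ∧ UnitCurve S (-δ) δ g ∧ g 0 = p ∧
    ∀ η, 0 < η → η ≤ δ → ∃ U ∈ 𝓝 p, S ∩ U ⊆ g '' Ioo (-η) η

theorem exists_contDiffAt_left_inverse {f : ℝ → ℝ} {x : ℝ} (hf : ContDiffAt ℝ 1 f x)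
    (hd : deriv f x ≠ 0) :
    ∃ F : ℝ → ℝ, ContDiffAt ℝ 1 F (f x) ∧ ∀ᶠ u in 𝓝 x, F (f u) = u := by
  have h1 : HasDerivAt f (deriv f x) x := (hf.differentiableAt (by simp)).hasDerivAt
  have h2 : HasFDerivAt f (ContinuousLinearEquiv.unitsEquivAut ℝ (Units.mk0 _ hd) : ℝ →L[ℝ] ℝ) x := by
    refine h1.hasFDerivAt.congr_fderiv ?_
    ext; simp
  refine ⟨hf.localInverse h2 (by simp), hf.to_localInverse h2 (by simp), ?_⟩
  exact (hf.hasStrictFDerivAt' h2 (by simp)).eventually_left_inverse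

namespace UnitCurve

variable {S : Set ℂ} {a b : ℝ} {k : ℝ → ℂ}

theorem contDiffAt (hk : UnitCurve S a b k) {t : ℝ} (ht : t ∈ Ioo a b) : ContDiffAt ℝ ∞ k t :=
  hk.contDiffOn.contDiffAt (Ioo_mem_nhds ht.1 ht.2)

theorem hasDerivAt (hk : UnitCurve S a b k) {t : ℝ} (ht : t ∈ Ioo a b) :
    HasDerivAt k (deriv k t) t :=
  ((hk.contDiffAt ht).differentiableAt (by simp)).hasDerivAt

theorem continuousAt (hk : UnitCurve S a b k) {t : ℝ} (ht : t ∈ Ioo a b) : ContinuousAt k t :=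
  (hk.contDiffAt ht).continuousAt

theorem continuousAt_deriv (hk : UnitCurve S a b k) {t : ℝ} (ht : t ∈ Ioo a b) :
    ContinuousAt (deriv k) t := by
  have h : ContDiffOn ℝ 0 (deriv k) (Ioo a b) :=
    ((contDiffOn_succ_iff_deriv_of_isOpen (n := 0) isOpen_Ioo).1
      (hk.contDiffOn.of_le (by simp))).2.2
  exact h.continuousOn.continuousAt (Ioo_mem_nhds ht.1 ht.2)

theorem mono (hk : UnitCurve S a b k) {a' b' : ℝ} (ha : a ≤ a') (hb : b' ≤ b) :
    UnitCurve S a' b' k :=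
  have hs : Ioo a' b' ⊆ Ioo a b := Ioo_subset_Ioo ha hb
  ⟨hk.contDiffOn.mono hs, fun t ht => hk.norm_deriv t (hs ht), hk.mapsTo.mono_left hs⟩

theorem mono_set (hk : UnitCurve S a b k) {S' : Set ℂ} (h : MapsTo k (Ioo a b) S') :
    UnitCurve S' a b k :=
  ⟨hk.contDiffOn, hk.norm_deriv, h⟩

theorem of_locally (h : ∀ t ∈ Ioo a b, ∃ (a' b' : ℝ) (k' : ℝ → ℂ), t ∈ Ioo a' b' ∧
    UnitCurve S a' b' k' ∧ k =ᶠ[𝓝 t] k') : UnitCurve S a b k := by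
  refine ⟨fun t ht => ?_, fun t ht => ?_, fun t ht => ?_⟩ <;>
    obtain ⟨a', b', k', ht', hk', he⟩ := h t ht
  · exact ((hk'.contDiffAt ht').congr_of_eventuallyEq he).contDiffWithinAt
  · rw [he.deriv_eq, hk'.norm_deriv t ht']
  · rw [he.eq_of_nhds]; exact hk'.mapsTo ht'

theorem comp_affine (hk : UnitCurve S a b k) {σ : ℝ} (hσ : σ = 1 ∨ σ = -1) (m : ℝ) {a' b' : ℝ}
    (h : ∀ t ∈ Ioo a' b', m + σ * t ∈ Ioo a b) : UnitCurve S a' b' (fun t => k (m + σ * t)) := by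
  have hd : ∀ t, HasDerivAt (fun t => m + σ * t) σ t := fun t => by
    simpa using ((hasDerivAt_id t).const_mul σ).const_add m
  refine ⟨hk.contDiffOn.comp (by fun_prop) h, fun t ht => ?_, fun t ht => hk.mapsTo (h t ht)⟩
  have := (hk.hasDerivAt (h t ht)).scomp t (hd t)
  rw [Function.comp_def] at this
  rw [this.deriv, norm_smul, hk.norm_deriv _ (h t ht)]
  rcases hσ with rfl | rfl <;> simp

/-- A unit speed curve in `S` through `p` is, up to its direction, the arc of `S` at `p`. -/
theorem eventually_eq_arc (hk : UnitCurve S a b k) {t₀ : ℝ} (ht₀ : t₀ ∈ Ioo a b) {δ : ℝ}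
    {g : ℝ → ℂ} (hδ : 0 < δ) (hg : UnitCurve S (-δ) δ g) (hg0 : g 0 = k t₀)
    (hU : ∀ η, 0 < η → η ≤ δ → ∃ U ∈ 𝓝 (k t₀), S ∩ U ⊆ g '' Ioo (-η) η) :
    ∃ σ : ℝ, (σ = 1 ∨ σ = -1) ∧ ∀ᶠ s in 𝓝 t₀, k s = g (σ * (s - t₀)) := by
  have h0 : (0 : ℝ) ∈ Ioo (-δ) δ := ⟨by linarith, hδ⟩
  set v := deriv g 0
  have hv : ‖v‖ = 1 := hg.norm_deriv 0 h0
  -- Projection to the tangent line recovers the parameter of `g` near 0, through the local inverse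
  -- `F`.
  set ℓ : ℂ →L[ℝ] ℝ := innerSL ℝ v
  have hf : ContDiffAt ℝ 1 (fun u => ℓ (g u)) 0 :=
    ℓ.contDiff.contDiffAt.comp 0 ((hg.contDiffAt h0).of_le (by simp))
  have hfd : HasDerivAt (fun u => ℓ (g u)) 1 0 := by
    have := ℓ.hasFDerivAt.comp_hasDerivAt 0 (hg.hasDerivAt h0)
    refine this.congr_deriv ?_
    change inner ℝ v v = 1
    rw [real_inner_self_eq_norm_sq, hv, one_pow]
  obtain ⟨F, hF, hFl⟩ := exists_contDiffAt_left_inverse hf (by rw [hfd.deriv]; exact one_ne_zero)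
  set φ : ℝ → ℝ := fun s => F (ℓ (k s)) with hφdef
  have hkc := (hk.contDiffAt ht₀).of_le (show (1 : ℕ∞ω) ≤ ∞ by simp)
  have hφ : ContDiffAt ℝ 1 φ t₀ := by
    rw [hg0] at hF
    exact ContDiffAt.comp t₀ hF (ℓ.contDiff.contDiffAt.comp t₀ hkc)
  have hφ0 : φ t₀ = 0 := by
    have := hFl.self_of_nhds
    rwa [hg0] at this
  have hkφ : ∀ᶠ s in 𝓝 t₀, k s = g (φ s) := by
    obtain ⟨η, hη, hball⟩ := Metric.eventually_nhds_iff_ball.1 hFl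
    obtain ⟨U, hUn, hUs⟩ := hU (min η δ) (lt_min hη hδ) (min_le_right _ _)
    filter_upwards [hk.continuousAt ht₀ hUn, Ioo_mem_nhds ht₀.1 ht₀.2] with s hs hsab
    obtain ⟨u, hu, hgu⟩ := hUs ⟨hk.mapsTo hsab, hs⟩
    have hu' : F (ℓ (g u)) = u := hball u (by
      rw [Real.ball_eq_Ioo, zero_sub, zero_add]
      exact ⟨by linarith [hu.1, min_le_left η δ], hu.2.trans_le (min_le_left _ _)⟩)
    rw [hφdef]
    simp only
    rw [← hgu, hu']
  have hφ1 : ∀ᶠ s in 𝓝 t₀, DifferentiableAt ℝ φ s := by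
    filter_upwards [hφ.eventually (by simp)] with s hs using hs.differentiableAt (by simp)
  have hφδ : ∀ᶠ s in 𝓝 t₀, φ s ∈ Ioo (-δ) δ :=
    hφ.continuousAt.eventually_mem (by rw [hφ0]; exact Ioo_mem_nhds h0.1 h0.2)
  -- Since k = g ∘ φ and both curves have unit speed, φ' is ±1; it is continuous, so its sign is
  -- constant and φ is affine.
  have habs : ∀ᶠ s in 𝓝 t₀, |deriv φ s| = 1 := by
    filter_upwards [hφ1, hφδ, hkφ.eventually_nhds, Ioo_mem_nhds ht₀.1 ht₀.2] with s h1 h2 h3 h4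
    have h5 : HasDerivAt k (deriv φ s • deriv g (φ s)) s :=
      ((hg.hasDerivAt h2).scomp s h1.hasDerivAt).congr_of_eventuallyEq h3
    have h6 := congrArg norm h5.deriv
    rw [hk.norm_deriv s h4, norm_smul, hg.norm_deriv _ h2, mul_one] at h6
    exact h6.symm
  have hcont : ContinuousAt (deriv φ) t₀ := by
    have h1 : ContDiffAt ℝ 0 (deriv φ) t₀ := hφ.derivWithin (by simp)
    exact h1.continuousAt
  have hnear : ∀ᶠ s in 𝓝 t₀, |deriv φ s - deriv φ t₀| < 1 := by
    have := hcont.eventually (Metric.ball_mem_nhds _ one_pos)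
    filter_upwards [this] with s hs
    simpa [Real.dist_eq] using hs
  have hσ : deriv φ t₀ = 1 ∨ deriv φ t₀ = -1 := (abs_eq zero_le_one).1 habs.self_of_nhds
  refine ⟨deriv φ t₀, hσ, ?_⟩
  have hall := (habs.and hnear).and hφ1
  obtain ⟨r, hr, hball⟩ := Metric.eventually_nhds_iff_ball.1 hall
  filter_upwards [hkφ, Metric.ball_mem_nhds t₀ hr] with s hs hsb
  rw [hs]
  congr 1
  have hdiff : ∀ u ∈ Metric.ball t₀ r, HasDerivAt (fun u => φ u - deriv φ t₀ * (u - t₀)) 0 u := by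
    intro u hu
    obtain ⟨⟨h1, h2⟩, h3⟩ := hball u hu
    have h4 : deriv φ u = deriv φ t₀ := by
      rcases (abs_eq zero_le_one).1 h1 with h5 | h5 <;> rcases hσ with h6 | h6 <;>
        rw [h5, h6] at h2 ⊢ <;> norm_num at h2
    have h5 := h3.hasDerivAt.sub (((hasDerivAt_id u).sub_const t₀).const_mul (deriv φ t₀))
    refine h5.congr_deriv ?_
    rw [h4]; ring
  have := Metric.isOpen_ball.is_const_of_deriv_eq_zero (convex_ball t₀ r).isPreconnected
    (fun u hu => (hdiff u hu).differentiableAt.differentiableWithinAt)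
    (fun u hu => (hdiff u hu).deriv) hsb (Metric.mem_ball_self hr)
  simp only [hφ0, sub_self, mul_zero] at this
  linarith

/-- The parameters where the two germs agree form an open set. At a limit of such parameters both
values and velocities agree; both curves are the local arc up to direction, and the common velocity
makes the directions equal. -/
theorem eqOn_of_eventuallyEq (hS : ∀ p ∈ S, HasArcAt S p) (hk : UnitCurve S a b k) {c : ℝ → ℂ}
    (hc : UnitCurve S a b c) {t₀ : ℝ} (ht₀ : t₀ ∈ Ioo a b) (h : k =ᶠ[𝓝 t₀] c) :
    EqOn k c (Ioo a b) := by
  set u : Set ℝ := {t | k =ᶠ[𝓝 t] c}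
  have hu : IsOpen u := isOpen_setOfPred_eventually_nhds
  have hsub : Ioo a b ⊆ u := by
    refine isPreconnected_Ioo.subset_of_closure_inter_subset hu ⟨t₀, ht₀, h⟩ ?_
    rintro t ⟨htu, ht⟩
    have hfr : ∃ᶠ s in 𝓝 t, s ∈ u := mem_closure_iff_frequently.1 htu
    have h1 : k t = c t := by
      by_contra hne
      have h2 : ∀ᶠ s in 𝓝 t, k s ≠ c s := by
        have h3 := ((hk.continuousAt ht).sub (hc.continuousAt ht)).eventually_ne
          (y := (0 : ℂ)) (by simpa [sub_eq_zero] using hne)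
        filter_upwards [h3] with s hs
        exact sub_ne_zero.1 hs
      obtain ⟨s, hs, hs'⟩ := (hfr.and_eventually h2).exists
      exact hs' hs.eq_of_nhds
    have h1' : deriv k t = deriv c t := by
      by_contra hne
      have h2 : ∀ᶠ s in 𝓝 t, deriv k s ≠ deriv c s := by
        have h3 := ((hk.continuousAt_deriv ht).sub (hc.continuousAt_deriv ht)).eventually_ne
          (y := (0 : ℂ)) (by simpa [sub_eq_zero] using hne)
        filter_upwards [h3] with s hs
        exact sub_ne_zero.1 hs
      obtain ⟨s, hs, hs'⟩ := (hfr.and_eventually h2).exists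
      exact hs' hs.deriv_eq
    obtain ⟨δ, g, hδ, hg, hg0, hU⟩ := hS (k t) (hk.mapsTo ht)
    obtain ⟨σ, hσ, hkσ⟩ := hk.eventually_eq_arc ht hδ hg hg0 hU
    obtain ⟨τ, hτ, hcτ⟩ := hc.eventually_eq_arc ht hδ hg (hg0.trans h1) (h1 ▸ hU)
    have h0 : (0 : ℝ) ∈ Ioo (-δ) δ := ⟨by linarith, hδ⟩
    have hd : ∀ ρ : ℝ, HasDerivAt (fun s => g (ρ * (s - t))) (ρ • deriv g 0) t := by
      intro ρ
      have h2 : HasDerivAt (fun s => ρ * (s - t)) ρ t := by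
        simpa using ((hasDerivAt_id t).sub_const t).const_mul ρ
      have h3 : HasDerivAt g (deriv g 0) (ρ * (t - t)) := by simpa using hg.hasDerivAt h0
      exact h3.scomp t h2
    have h2 : σ • deriv g 0 = τ • deriv g 0 := by
      have e1 := ((hd σ).congr_of_eventuallyEq hkσ).deriv
      have e2 := ((hd τ).congr_of_eventuallyEq hcτ).deriv
      rw [← e1, ← e2, h1']
    have hne : deriv g 0 ≠ 0 := by
      rw [← norm_ne_zero_iff, hg.norm_deriv 0 h0]; exact one_ne_zero
    have h3 : σ = τ := smul_left_injective ℝ hne h2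
    subst h3
    filter_upwards [hkσ, hcτ] with s e1 e2
    rw [e1, e2]
  exact fun t ht => (hsub ht).eq_of_nhds

/-- Two unit speed curves in `S` with a common point agree, up to direction, as long as both of
them are defined. -/
theorem exists_align (hS : ∀ p ∈ S, HasArcAt S p) (hk : UnitCurve S a b k) {a' b' : ℝ} {c : ℝ → ℂ}
    (hc : UnitCurve S a' b' c) {t u : ℝ} (ht : t ∈ Ioo a b) (hu : u ∈ Ioo a' b')
    (h : k t = c u) :
    ∃ σ : ℝ, (σ = 1 ∨ σ = -1) ∧ ∀ r, t + r ∈ Ioo a b → u + σ * r ∈ Ioo a' b' →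
      k (t + r) = c (u + σ * r) := by
  obtain ⟨δ, g, hδ, hg, hg0, hU⟩ := hS (k t) (hk.mapsTo ht)
  obtain ⟨σ, hσ, hkσ⟩ := hk.eventually_eq_arc ht hδ hg hg0 hU
  obtain ⟨τ, hτ, hcτ⟩ := hc.eventually_eq_arc hu hδ hg (hg0.trans h) (h ▸ hU)
  have hρ : τ * σ = 1 ∨ τ * σ = -1 := by rcases hσ with rfl | rfl <;> rcases hτ with rfl | rfl <;> simp
  have hττ : τ * τ = 1 := by rcases hτ with rfl | rfl <;> simp
  refine ⟨τ * σ, hρ, ?_⟩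
  set ρ := τ * σ
  have hev : k =ᶠ[𝓝 t] fun s => c ((u - ρ * t) + ρ * s) := by
    have h1 : Tendsto (fun s => (u - ρ * t) + ρ * s) (𝓝 t) (𝓝 u) := by
      have : ContinuousAt (fun s => (u - ρ * t) + ρ * s) t := by fun_prop
      simpa [ContinuousAt] using this
    filter_upwards [hkσ, h1.eventually hcτ] with s e1 e2
    rw [e1, e2]
    congr 1
    linear_combination (-σ * (s - t)) * hττ
  rcases hρ with hρ1 | hρ1
  · have hk1 := hk.mono (le_max_left a (a' - u + t)) (min_le_left b (b' - u + t))
    have hc1 : UnitCurve S (max a (a' - u + t)) (min b (b' - u + t))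
        (fun s => c ((u - ρ * t) + ρ * s)) := by
      refine hc.comp_affine (Or.inl hρ1) _ fun s hs => ?_
      have h1 := (le_max_right _ _).trans_lt hs.1
      have h2 := hs.2.trans_le (min_le_right _ _)
      rw [hρ1]
      constructor <;> linarith
    have heq := hk1.eqOn_of_eventuallyEq hS hc1 (t₀ := t)
      ⟨max_lt ht.1 (by linarith [hu.1]), lt_min ht.2 (by linarith [hu.2])⟩ hev
    intro r hr1 hr2
    rw [hρ1] at hr2
    rw [heq ⟨max_lt hr1.1 (by linarith [hr2.1]), lt_min hr1.2 (by linarith [hr2.2])⟩]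
    change c _ = c _
    congr 1
    ring
  · have hk1 := hk.mono (le_max_left a (t + u - b')) (min_le_left b (t + u - a'))
    have hc1 : UnitCurve S (max a (t + u - b')) (min b (t + u - a'))
        (fun s => c ((u - ρ * t) + ρ * s)) := by
      refine hc.comp_affine (Or.inr hρ1) _ fun s hs => ?_
      have h1 := (le_max_right _ _).trans_lt hs.1
      have h2 := hs.2.trans_le (min_le_right _ _)
      rw [hρ1]
      constructor <;> linarith
    have heq := hk1.eqOn_of_eventuallyEq hS hc1 (t₀ := t)
      ⟨max_lt ht.1 (by linarith [hu.2]), lt_min ht.2 (by linarith [hu.1])⟩ hev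
    intro r hr1 hr2
    rw [hρ1] at hr2
    rw [heq ⟨max_lt hr1.1 (by linarith [hr2.2]), lt_min hr1.2 (by linarith [hr2.1])⟩]
    change c _ = c _
    congr 1
    ring

end UnitCurve

/-- It serves contradictions: a curve in `S` cannot run back along another one to a starting point
outside of `S`. -/
theorem eq_of_tendsto_of_eventually_eq {k c : ℝ → ℂ} {τ : ℝ} {x : ℂ} (hk : ContinuousAt k τ)
    (hc : Tendsto c (𝓝[>] 0) (𝓝 x)) (σ : ℝ) (h : ∀ᶠ r in 𝓝[>] 0, k (τ + σ * r) = c r) :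
    k τ = x := by
  have h1 : Tendsto (fun r : ℝ => τ + σ * r) (𝓝[>] 0) (𝓝 τ) := by
    have : ContinuousAt (fun r : ℝ => τ + σ * r) 0 := by fun_prop
    have h2 := this.tendsto
    simp only [mul_zero, add_zero] at h2
    exact h2.mono_left nhdsWithin_le_nhds
  exact tendsto_nhds_unique (hk.tendsto.comp h1) (hc.congr' (h.mono fun r hr => hr.symm))

/-- A unit speed curve in `S` that starts at a point outside of `S` is injective. -/
theorem UnitCurve.injOn {S : Set ℂ} {L : ℝ} {k : ℝ → ℂ} (hS : ∀ p ∈ S, HasArcAt S p)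
    (hk : UnitCurve S 0 L k) {x : ℂ} (hx : x ∉ S) (hkx : Tendsto k (𝓝[>] 0) (𝓝 x)) :
    InjOn k (Ioo 0 L) := by
  have main : ∀ s t, s ∈ Ioo 0 L → t ∈ Ioo 0 L → s < t → k s ≠ k t := by
    intro s t hs ht hst heq
    obtain ⟨σ, hσ, hal⟩ := hk.exists_align hS hk hs ht heq
    rcases hσ with rfl | rfl
    -- Same direction: `k` has period t - s near its start, so k(t - s) would be the starting point
    -- `x`, which is not in `S`.
    · have hts : t - s ∈ Ioo 0 L := ⟨by linarith, by linarith [ht.2, hs.1]⟩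
      have := eq_of_tendsto_of_eventually_eq (hk.continuousAt hts) hkx 1 (by
        filter_upwards [Ioo_mem_nhdsGT hs.1] with r hr
        have := hal (r - s) ⟨by linarith [hr.1], by linarith [hr.2, hs.2]⟩
          ⟨by linarith [hr.1], by linarith [hr.2, ht.2]⟩
        rw [show s + (r - s) = r by ring] at this
        rw [this]; congr 1; ring)
      exact hx (this ▸ hk.mapsTo hts)
    -- Opposite directions: `k` is symmetric about the midpoint, where its velocity would vanish.
    · set m := (s + t) / 2
      have hm : m ∈ Ioo 0 L := ⟨by simp only [m]; linarith [hs.1, ht.1], by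
        simp only [m]; linarith [hs.2, ht.2]⟩
      have hsym : k =ᶠ[𝓝 m] fun u => k (2 * m - u) := by
        filter_upwards [Ioo_mem_nhds (show s < m by simp only [m]; linarith)
          (show m < t by simp only [m]; linarith)] with u hu
        have := hal (u - s) ⟨by linarith [hu.1, hs.1], by linarith [hu.2, ht.2]⟩
          ⟨by linarith [hu.2, hs.1], by linarith [hu.1, ht.2]⟩
        rw [show s + (u - s) = u by ring] at this
        rw [this]; congr 1; simp only [m]; ring
      have hd1 := hk.hasDerivAt hm
      have hd2 : HasDerivAt (fun u => k (2 * m - u)) ((-1 : ℝ) • deriv k m) m := by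
        have h1 : HasDerivAt (fun u : ℝ => 2 * m - u) (-1) m := by
          simpa using (hasDerivAt_id m).const_sub (2 * m)
        have h2 : HasDerivAt k (deriv k m) (2 * m - m) := by
          rw [show 2 * m - m = m by ring]; exact hd1
        exact h2.scomp m h1
      have h3 := hd1.unique (hd2.congr_of_eventuallyEq hsym)
      have h4 : deriv k m = 0 := by
        rw [neg_smul, one_smul] at h3
        exact self_eq_neg.1 h3
      have h5 := hk.norm_deriv m hm
      rw [h4, norm_zero] at h5
      exact zero_ne_one h5
  intro s hs t ht heq
  rcases lt_trichotomy s t with h | h | h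
  · exact (main s t hs ht h heq).elim
  · exact h
  · exact (main t s ht hs h heq.symm).elim

/-! ### Stars, traces, and continuation of a branch to an edge. -/

/-- Near `x`, the set `S ∪ {x}` is the union of `ν` unit speed arcs that start at `x`. -/
structure Star (S : Set ℂ) (x : ℂ) where
  ν : ℕ
  δ : ℝ
  g : Fin ν → ℝ → ℂ
  pos : 0 < δ
  curve : ∀ j, UnitCurve S 0 δ (g j)
  contDiffOn : ∀ j, ContDiffOn ℝ ∞ (g j) (Ico 0 δ)
  start : ∀ j, g j 0 = x
  disjoint : ∀ i j, i ≠ j → Disjoint (g i '' Ioo 0 δ) (g j '' Ioo 0 δ)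
  nhds : ∀ η, 0 < η → η ≤ δ → ∃ U ∈ 𝓝 x, S ∩ U ⊆ ⋃ j, g j '' Ioo 0 η

theorem Star.tendsto {S : Set ℂ} {x : ℂ} (st : Star S x) (j : Fin st.ν) :
    Tendsto (st.g j) (𝓝[>] 0) (𝓝 x) := by
  have h := ((st.contDiffOn j).continuousOn 0 ⟨le_rfl, st.pos⟩).tendsto
  rw [st.start j] at h
  refine h.mono_left ?_
  rw [← nhdsWithin_Ioo_eq_nhdsGT st.pos]
  exact nhdsWithin_mono _ Ioo_subset_Ico_self

/-- A smooth arc whose interior is a unit speed curve in `S`. -/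
structure IsEdge (S : Set ℂ) (L : ℝ) (k : ℝ → ℂ) : Prop where
  pos : 0 < L
  curve : UnitCurve S 0 L k
  contDiffOn : ContDiffOn ℝ ∞ k (Icc 0 L)

/-- A unit speed curve in `S` that continues the germ `g`. -/
def IsTrace (S : Set ℂ) (g : ℝ → ℂ) (L : ℝ) (k : ℝ → ℂ) : Prop :=
  UnitCurve S 0 L k ∧ ∀ᶠ t in 𝓝[>] 0, k t = g t

namespace IsTrace

variable {S : Set ℂ} {g k : ℝ → ℂ} {L : ℝ}

theorem eqOn (hS : ∀ p ∈ S, HasArcAt S p) (hk : IsTrace S g L k) {k' : ℝ → ℂ}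
    (hk' : IsTrace S g L k') : EqOn k k' (Ioo 0 L) := by
  rcases le_or_gt L 0 with hL | hL
  · simp [Ioo_eq_empty_of_le hL]
  have h : ∀ᶠ t in 𝓝[>] 0, k t = k' t := by
    filter_upwards [hk.2, hk'.2] with t h1 h2
    rw [h1, h2]
  obtain ⟨ε, hε, hεs⟩ := (nhdsGT_basis (0 : ℝ)).eventually_iff.1 h
  have hm : 0 < min ε L := lt_min hε hL
  refine hk.1.eqOn_of_eventuallyEq hS hk'.1 (t₀ := min ε L / 2)
    ⟨by linarith, by linarith [min_le_right ε L]⟩ ?_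
  filter_upwards [Ioo_mem_nhds (show 0 < min ε L / 2 by linarith)
    (show min ε L / 2 < ε by linarith [min_le_left ε L])] with t ht using hεs ht

theorem congr (hk : IsTrace S g L k) {k' : ℝ → ℂ} (hL : 0 < L) (h : EqOn k' k (Ioo 0 L)) :
    IsTrace S g L k' := by
  refine ⟨UnitCurve.of_locally fun t ht => ⟨0, L, k, ht, hk.1, ?_⟩, ?_⟩
  · filter_upwards [Ioo_mem_nhds ht.1 ht.2] with s hs using h hs
  · filter_upwards [hk.2, Ioo_mem_nhdsGT hL] with t h1 h2
    rw [h h2, h1]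

/-- Continuing a trace along a curve that it meets. -/
theorem extend (hS : ∀ p ∈ S, HasArcAt S p) (hk : IsTrace S g L k) {c : ℝ → ℂ} {a b t u : ℝ}
    (hc : UnitCurve S a b c) (ht : t ∈ Ioo 0 L) (hu : u ∈ Ioo a b) (h : k t = c u) :
    ∃ σ : ℝ, (σ = 1 ∧ (∃ k', IsTrace S g (t + (b - u)) k') ∨
        σ = -1 ∧ ∃ k', IsTrace S g (t + (u - a)) k') ∧
      ∀ r, t + r ∈ Ioo 0 L → u + σ * r ∈ Ioo a b → k (t + r) = c (u + σ * r) := by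
  obtain ⟨σ, hσ, hal⟩ := hk.1.exists_align hS hc ht hu h
  refine ⟨σ, ?_, hal⟩
  have key : ∀ m, 0 < m → (∀ r ∈ Ioo 0 m, u + σ * r ∈ Ioo a b) →
      ∃ k', IsTrace S g (t + m) k' := by
    intro m hm hr
    refine ⟨fun s => if s ≤ t then k s else c ((u - σ * t) + σ * s),
      UnitCurve.of_locally fun s hs => ?_, ?_⟩
    · rcases lt_trichotomy s t with hst | rfl | hst
      · refine ⟨0, L, k, ⟨hs.1, hst.trans ht.2⟩, hk.1, ?_⟩
        filter_upwards [Iio_mem_nhds hst] with r hr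
        rw [if_pos (le_of_lt hr)]
      · refine ⟨0, L, k, ht, hk.1, ?_⟩
        have h1 : ∀ᶠ r in 𝓝 s, u + σ * (r - s) ∈ Ioo a b := by
          have : ContinuousAt (fun r => u + σ * (r - s)) s := by fun_prop
          exact this.eventually_mem (by simpa using Ioo_mem_nhds hu.1 hu.2)
        filter_upwards [Ioo_mem_nhds ht.1 ht.2, h1] with r h2 h3
        split_ifs with h4
        · rfl
        · have := hal (r - s) (by simpa using h2) h3
          rw [add_sub_cancel] at this
          rw [this]; congr 1; ring
      · refine ⟨t, t + m, fun s => c ((u - σ * t) + σ * s), ⟨hst, hs.2⟩,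
          hc.comp_affine hσ _ fun r hr' => ?_, ?_⟩
        · have := hr (r - t) ⟨by linarith [hr'.1], by linarith [hr'.2]⟩
          rwa [show u - σ * t + σ * r = u + σ * (r - t) by ring]
        · filter_upwards [Ioi_mem_nhds hst] with r hr
          rw [if_neg (not_le.2 hr)]
    · filter_upwards [hk.2, Ioo_mem_nhdsGT ht.1] with r h1 h2
      rw [if_pos h2.2.le, h1]
  rcases hσ with rfl | rfl
  · exact Or.inl ⟨rfl, key _ (by linarith [hu.2]) fun r hr =>
      ⟨by linarith [hu.1, hr.1], by linarith [hr.2]⟩⟩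
  · exact Or.inr ⟨rfl, key _ (by linarith [hu.1]) fun r hr =>
      ⟨by linarith [hr.2], by linarith [hu.2, hr.1]⟩⟩

end IsTrace

/-- All traces of a germ are restrictions of one curve. -/
theorem exists_common_trace {S : Set ℂ} (hS : ∀ p ∈ S, HasArcAt S p) (g : ℝ → ℂ) :
    ∃ k : ℝ → ℂ, ∀ L, 0 < L → (∃ k', IsTrace S g L k') → IsTrace S g L k := by
  classical
  set P : ℝ → Prop := fun L => 0 < L ∧ ∃ k', IsTrace S g L k'
  have hP : ∀ L, ∃ k', P L → IsTrace S g L k' := by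
    intro L
    by_cases h : P L
    · exact ⟨h.2.choose, fun _ => h.2.choose_spec⟩
    · exact ⟨0, fun h' => (h h').elim⟩
  choose K hK using hP
  refine ⟨fun t => if h : ∃ L, P L ∧ t < L then K h.choose t else 0, fun L hL hex => ?_⟩
  have hPL : P L := ⟨hL, hex⟩
  refine (hK L hPL).congr hL fun t ht => ?_
  -- The length chosen at `t` does not matter, since traces of one germ agree where both are
  -- defined.
  have h : ∃ L, P L ∧ t < L := ⟨L, hPL, ht.2⟩
  simp only [dif_pos h]
  obtain ⟨h1, h2⟩ := h.choose_spec
  have e1 := hK _ h1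
  have e2 := hK _ hPL
  exact IsTrace.eqOn hS (L := min h.choose L) ⟨e1.1.mono le_rfl (min_le_left _ _), e1.2⟩
    ⟨e2.1.mono le_rfl (min_le_right _ _), e2.2⟩ ⟨ht.1, lt_min h2 ht.2⟩

/-- A curve in `S` that meets a branch of a star cannot run along this branch through the
centre. -/
theorem Star.centre_notMem {S : Set ℂ} {x : ℂ} (st : Star S x) (hx : x ∉ S) {L : ℝ} {k : ℝ → ℂ}
    (hk : UnitCurve S 0 L k) {j : Fin st.ν} {τ u σ : ℝ} (hσ : σ = 1 ∨ σ = -1)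
    (hal : ∀ r, τ + r ∈ Ioo 0 L → u + σ * r ∈ Ioo 0 st.δ → k (τ + r) = st.g j (u + σ * r)) :
    τ - σ * u ∉ Ioo 0 L := by
  intro hmem
  have hσσ : σ * σ = 1 := by rcases hσ with rfl | rfl <;> simp
  have := eq_of_tendsto_of_eventually_eq (hk.continuousAt hmem) (st.tendsto j) σ (by
    have h1 : ∀ᶠ r in 𝓝[>] (0 : ℝ), τ - σ * u + σ * r ∈ Ioo 0 L := by
      have : ContinuousAt (fun r => τ - σ * u + σ * r) 0 := by fun_prop
      exact (this.eventually_mem (by simpa using Ioo_mem_nhds hmem.1 hmem.2)).filter_mono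
        nhdsWithin_le_nhds
    filter_upwards [h1, Ioo_mem_nhdsGT st.pos] with r h2 h3
    have e1 : τ + σ * (r - u) = τ - σ * u + σ * r := by ring
    have e2 : u + σ * (σ * (r - u)) = r := by linear_combination (r - u) * hσσ
    have := hal (σ * (r - u)) (by rwa [e1]) (by rwa [e2])
    rwa [e1, e2] at this)
  exact hx (this ▸ hk.mapsTo hmem)

/-- By compactness the curve accumulates at some `p`. If `p` is in `S`, the curve passes through `p`
at arbitrarily late times, against injectivity. If `p` is in `X`, the curve enters a branch of the
star at `p` and, within the length of the branch, passes through the centre, either earlier or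
later. -/
theorem not_infinite_unitCurve {S X : Set ℂ} (hN : IsCompact (S ∪ X)) (hSX : Disjoint S X)
    (hS : ∀ p ∈ S, HasArcAt S p) (st : ∀ x : X, Star S x) {k : ℝ → ℂ}
    (hk : ∀ L, 0 < L → UnitCurve S 0 L k) {x : ℂ} (hx : x ∉ S) (hkx : Tendsto k (𝓝[>] 0) (𝓝 x)) :
    False := by
  have hmem : ∀ t, 0 < t → k t ∈ S := fun t ht => (hk (t + 1) (by linarith)).mapsTo ⟨ht, by linarith⟩
  obtain ⟨p, hp, φ, hφ, hlim⟩ := hN.tendsto_subseq (x := fun n : ℕ => k (n + 1))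
    fun n => Or.inl (hmem _ (by positivity))
  have htop : Tendsto (fun n => (φ n : ℝ) + 1) atTop atTop :=
    tendsto_atTop_add_const_right _ _ (tendsto_natCast_atTop_atTop.comp hφ.tendsto_atTop)
  rcases hp with hp | hp
  · obtain ⟨δ, g, hδ, hg, hg0, hU⟩ := hS p hp
    obtain ⟨U, hUp, hUs⟩ := hU δ hδ le_rfl
    have hvisit : ∀ M, ∃ t, M < t ∧ 0 < t ∧ k t = p := by
      intro M
      obtain ⟨n, hn1, hn2, hn3⟩ := ((hlim.eventually_mem hUp).and
        ((htop.eventually_gt_atTop (M + δ)).and (htop.eventually_gt_atTop δ))).exists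
      set τ := (φ n : ℝ) + 1
      obtain ⟨u, hu, hgu⟩ := hUs ⟨hmem τ (by positivity), hn1⟩
      have hu' := abs_lt.2 hu
      have hτ : τ ∈ Ioo 0 (τ + δ) := ⟨by positivity, by linarith⟩
      have hk' := hk (τ + δ) (by linarith [hτ.1])
      obtain ⟨σ, hσ, hal⟩ := hk'.exists_align hS hg hτ hu hgu.symm
      have hσσ : σ * σ = 1 := by rcases hσ with rfl | rfl <;> simp
      have hb : -δ < -(σ * u) ∧ -(σ * u) < δ := by
        rcases hσ with rfl | rfl <;> constructor <;> linarith [hu.1, hu.2]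
      refine ⟨τ + -(σ * u), by linarith, by linarith, ?_⟩
      have e : u + σ * -(σ * u) = 0 := by linear_combination -u * hσσ
      rw [hal _ ⟨by linarith, by linarith⟩ (by rw [e]; exact ⟨by linarith, hδ⟩), e, hg0]
    obtain ⟨t, -, ht0, ht⟩ := hvisit 0
    obtain ⟨s, hst, hs0, hs⟩ := hvisit t
    have := (hk (s + 1) (by linarith)).injOn hS hx hkx ⟨ht0, by linarith⟩ ⟨hs0, by linarith⟩
      (ht.trans hs.symm)
    linarith
  · set y : X := ⟨p, hp⟩
    obtain ⟨U, hUp, hUs⟩ := (st y).nhds _ (st y).pos le_rfl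
    obtain ⟨n, hn1, hn2⟩ := ((hlim.eventually_mem hUp).and
      (htop.eventually_gt_atTop (st y).δ)).exists
    set τ := (φ n : ℝ) + 1
    obtain ⟨j, u, hu, hgu⟩ := mem_iUnion.1 (hUs ⟨hmem τ (by positivity), hn1⟩)
    have hτ : τ ∈ Ioo 0 (τ + (st y).δ) := ⟨by positivity, by linarith [(st y).pos]⟩
    have hk' := hk (τ + (st y).δ) (by linarith [hτ.1, (st y).pos])
    obtain ⟨σ, hσ, hal⟩ := hk'.exists_align hS ((st y).curve j) hτ hu hgu.symm
    refine (st y).centre_notMem (disjoint_right.1 hSX y.2) hk' hσ hal ?_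
    rcases hσ with rfl | rfl <;> constructor <;> linarith [hu.1, hu.2]

/-- Every branch of a star continues to an edge that ends along a branch of a star. -/
theorem exists_edge {S X : Set ℂ} (hN : IsCompact (S ∪ X)) (hSX : Disjoint S X)
    (hS : ∀ p ∈ S, HasArcAt S p) (st : ∀ x : X, Star S x) (x : X) (j : Fin (st x).ν) :
    ∃ (L : ℝ) (k : ℝ → ℂ), IsEdge S L k ∧ k 0 = x ∧ (∀ᶠ t in 𝓝[>] 0, k t = (st x).g j t) ∧
      ∃ (y : X) (j' : Fin (st y).ν), k L = y ∧ ∀ᶠ t in 𝓝[>] 0, k (L - t) = (st y).g j' t := by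
  set g := (st x).g j
  have hxS : (x : ℂ) ∉ S := disjoint_right.1 hSX x.2
  obtain ⟨k, hk⟩ := exists_common_trace hS g
  -- The lengths to which the germ continues; their supremum `Λ` will be the length of the edge.
  set T : Set ℝ := {L | 0 < L ∧ ∃ k', IsTrace S g L k'}
  have hδT : (st x).δ ∈ T := ⟨(st x).pos, g, (st x).curve j, Eventually.of_forall fun _ => rfl⟩
  have hkT : ∀ L ∈ T, IsTrace S g L k := fun L hL => hk L hL.1 hL.2
  have hkg : ∀ᶠ t in 𝓝[>] 0, k t = g t := (hkT _ hδT).2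
  have hkx : Tendsto k (𝓝[>] 0) (𝓝 x) :=
    ((st x).tendsto j).congr' (hkg.mono fun _ h => h.symm)
  have hbdd : BddAbove T := by
    by_contra hnb
    refine not_infinite_unitCurve hN hSX hS st (k := k) (fun L hL => ?_) hxS hkx
    obtain ⟨M, hM, hLM⟩ := not_bddAbove_iff.1 hnb L
    exact (hkT M hM).1.mono le_rfl hLM.le
  set Λ := sSup T
  have hle : ∀ L ∈ T, L ≤ Λ := fun L hL => le_csSup hbdd hL
  have hΛ : 0 < Λ := (st x).pos.trans_le (hle _ hδT)
  have hkΛ : UnitCurve S 0 Λ k := by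
    refine UnitCurve.of_locally fun t ht => ?_
    obtain ⟨L, hL, htL⟩ := exists_lt_of_lt_csSup ⟨_, hδT⟩ ht.2
    exact ⟨0, L, k, ⟨ht.1, htL⟩, (hkT L hL).1, EventuallyEq.rfl⟩
  have hmax : ∀ L, (∃ k', IsTrace S g L k') → L ≤ Λ := by
    intro L hL
    rcases le_or_gt L 0 with h | h
    · exact h.trans hΛ.le
    · exact hle L ⟨h, hL⟩
  obtain ⟨p, hp, φ, hφ, hlim⟩ := hN.tendsto_subseq (x := fun n : ℕ => k (Λ - Λ / (n + 2)))
    fun n => Or.inl (hkΛ.mapsTo (by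
      have h1 : Λ / ((n : ℝ) + 2) < Λ := div_lt_self hΛ (by linarith [(Nat.cast_nonneg n : (0 : ℝ) ≤ n)])
      have h2 : 0 < Λ / ((n : ℝ) + 2) := by positivity
      exact ⟨by linarith, by linarith⟩))
  have hconv : Tendsto (fun n => Λ / ((φ n : ℝ) + 2)) atTop (𝓝 0) :=
    (tendsto_const_nhds.div_atTop (tendsto_atTop_add_const_right _ _
      (tendsto_natCast_atTop_atTop.comp hφ.tendsto_atTop)))
  have hnear : ∀ U ∈ 𝓝 p, ∀ ε > 0, ∃ τ ∈ Ioo 0 Λ, Λ - ε < τ ∧ k τ ∈ U := by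
    intro U hU ε hε
    obtain ⟨n, hn1, hn2⟩ := ((hlim.eventually_mem hU).and
      (hconv.eventually_lt_const hε)).exists
    have h1 : Λ / ((φ n : ℝ) + 2) < Λ :=
      div_lt_self hΛ (by linarith [(Nat.cast_nonneg (φ n) : (0 : ℝ) ≤ φ n)])
    have h2 : 0 < Λ / ((φ n : ℝ) + 2) := by positivity
    exact ⟨Λ - Λ / ((φ n : ℝ) + 2), ⟨by linarith, by linarith⟩, by linarith, hn1⟩
  -- If the end were regular, the local arc would continue the trace by more than δ/2 from a
  -- parameter within δ/2 of `Λ`.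
  have hpX : p ∈ X := by
    refine hp.resolve_left fun hpS => ?_
    obtain ⟨δ, g', hδ, hg, hg0, hU⟩ := hS p hpS
    obtain ⟨U, hUp, hUs⟩ := hU (δ / 2) (by linarith) (by linarith)
    obtain ⟨τ, hτ, hτΛ, hτU⟩ := hnear U hUp (δ / 2) (by linarith)
    obtain ⟨u, hu, hgu⟩ := hUs ⟨hkΛ.mapsTo hτ, hτU⟩
    obtain ⟨σ, h1, -⟩ := IsTrace.extend hS ⟨hkΛ, hkg⟩ hg hτ
      (u := u) ⟨by linarith [hu.1], by linarith [hu.2]⟩ hgu.symm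
    rcases h1 with ⟨-, h1⟩ | ⟨-, h1⟩
    · linarith [hmax _ h1, hu.2]
    · linarith [hmax _ h1, hu.1]
  set y : X := ⟨p, hpX⟩
  have hyδ := (st y).pos
  obtain ⟨η, hη, hη1, hη2⟩ : ∃ η, 0 < η ∧ η ≤ (st y).δ ∧ η ≤ Λ / 2 :=
    ⟨min (st y).δ (Λ / 2), lt_min hyδ (by linarith), min_le_left _ _, min_le_right _ _⟩
  obtain ⟨U, hUp, hUs⟩ := (st y).nhds η hη hη1
  obtain ⟨τ, hτ, hτΛ, hτU⟩ := hnear U hUp (Λ / 2) (by linarith)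
  obtain ⟨j', u, hu, hgu⟩ := mem_iUnion.1 (hUs ⟨hkΛ.mapsTo hτ, hτU⟩)
  have hu' : u ∈ Ioo 0 (st y).δ := ⟨hu.1, hu.2.trans_le hη1⟩
  obtain ⟨σ, h1, hal⟩ := IsTrace.extend hS ⟨hkΛ, hkg⟩ ((st y).curve j') hτ hu' hgu.symm
  have hcen := (st y).centre_notMem (disjoint_right.1 hSX y.2) hkΛ
    (h1.imp (fun h => h.1) fun h => h.1) hal
  have hend : ∀ᶠ t in 𝓝[>] 0, k (Λ - t) = (st y).g j' t := by
    -- With σ = 1 the curve would have come out of the centre at parameter τ - u > 0. With σ = -1 it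
    -- reaches the centre at τ + u, which is at most `Λ` by maximality and not less since the centre
    -- is not in `S`.
    rcases h1 with ⟨rfl, -⟩ | ⟨rfl, h1⟩
    · exact (hcen ⟨by linarith [hu.2], by linarith [hu.1, hτ.2]⟩).elim
    · have h2 : τ + u = Λ := by
        have h3 := hmax _ h1
        by_contra hne
        exact hcen ⟨by linarith [hτ.1, hu.1], lt_of_le_of_ne (by linarith) (by
          intro h; apply hne; linarith)⟩
      filter_upwards [Ioo_mem_nhdsGT (show 0 < min u Λ from lt_min hu.1 hΛ)] with t ht
      have ht1 : t < u := ht.2.trans_le (min_le_left _ _)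
      have ht2 : t < Λ := ht.2.trans_le (min_le_right _ _)
      have := hal (u - t) ⟨by linarith [hτ.1], by linarith [ht.1]⟩
        ⟨by linarith [ht.1], by linarith [hu'.2]⟩
      rw [show τ + (u - t) = Λ - t by linarith] at this
      rw [this]; congr 1; ring
  -- `k` carries no information at 0 and `Λ`; the ends are put in by hand, and smoothness there
  -- comes from the two branches.
  set k' : ℝ → ℂ := fun t => if t ≤ 0 then x else if Λ ≤ t then y else k t
  have hk' : EqOn k' k (Ioo 0 Λ) := fun t ht => by
    simp only [k', if_neg (not_le.2 ht.1), if_neg (not_le.2 ht.2)]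
  have hkk : IsTrace S g Λ k' := IsTrace.congr ⟨hkΛ, hkg⟩ hΛ hk'
  have hk'0 : k' 0 = x := by simp [k']
  have hk'Λ : k' Λ = y := by simp [k', not_le.2 hΛ]
  have hend' : ∀ᶠ t in 𝓝[>] 0, k' (Λ - t) = (st y).g j' t := by
    filter_upwards [hend, Ioo_mem_nhdsGT hΛ] with t e1 e2
    rw [hk' ⟨by linarith [e2.2], by linarith [e2.1]⟩, e1]
  refine ⟨Λ, k', ⟨hΛ, hkk.1, fun t ht => ?_⟩, hk'0, hkk.2, y, j', hk'Λ, hend'⟩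
  rcases eq_or_lt_of_le ht.1 with rfl | h0
  · obtain ⟨ε, hε, hεs⟩ := (nhdsGT_basis (0 : ℝ)).eventually_iff.1 hkk.2
    have hc : ContDiffWithinAt ℝ ∞ g (Ico 0 (st x).δ) 0 :=
      (st x).contDiffOn j 0 ⟨le_rfl, (st x).pos⟩
    have hmem : Ico 0 (st x).δ ∈ 𝓝[Icc 0 Λ] 0 := by
      filter_upwards [self_mem_nhdsWithin, mem_nhdsWithin_of_mem_nhds (Iio_mem_nhds (st x).pos)]
        with t h1 h2 using ⟨h1.1, h2⟩
    refine (hc.mono_of_mem_nhdsWithin hmem).congr_of_eventuallyEq ?_ (hk'0.trans ((st x).start j).symm)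
    filter_upwards [self_mem_nhdsWithin, mem_nhdsWithin_of_mem_nhds (Iio_mem_nhds hε)]
      with t h1 h2
    rcases eq_or_lt_of_le h1.1 with rfl | h3
    · exact hk'0.trans ((st x).start j).symm
    · exact hεs ⟨h3, h2⟩
  rcases eq_or_lt_of_le ht.2 with rfl | h1
  · obtain ⟨ε, hε, hεs⟩ := (nhdsGT_basis (0 : ℝ)).eventually_iff.1 hend'
    have hc : ContDiffWithinAt ℝ ∞ ((st y).g j') (Ico 0 (st y).δ) (Λ - Λ) := by
      rw [sub_self]
      exact (st y).contDiffOn j' 0 ⟨le_rfl, hyδ⟩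
    have hc2 : ContDiffWithinAt ℝ ∞ (fun s => (st y).g j' (Λ - s)) (Ioc (Λ - (st y).δ) Λ) Λ := by
      refine ContDiffWithinAt.comp Λ hc (by fun_prop) fun s hs => ?_
      exact ⟨by linarith [hs.2], by linarith [hs.1]⟩
    have hmem : Ioc (Λ - (st y).δ) Λ ∈ 𝓝[Icc 0 Λ] Λ := by
      filter_upwards [self_mem_nhdsWithin, mem_nhdsWithin_of_mem_nhds
        (Ioi_mem_nhds (show Λ - (st y).δ < Λ by linarith))] with s h1 h2 using ⟨h2, h1.2⟩
    have hend0 : k' Λ = (st y).g j' (Λ - Λ) := by rw [sub_self, (st y).start, hk'Λ]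
    refine (hc2.mono_of_mem_nhdsWithin hmem).congr_of_eventuallyEq ?_ hend0
    filter_upwards [self_mem_nhdsWithin, mem_nhdsWithin_of_mem_nhds
        (Ioi_mem_nhds (show Λ - ε < Λ by linarith))] with s h1 h2
    rcases eq_or_lt_of_le h1.2 with rfl | h3
    · exact hend0
    · have := hεs (show Λ - s ∈ Ioo 0 ε from ⟨by linarith, by linarith [show Λ - ε < s from h2]⟩)
      rwa [sub_sub_cancel] at this
  · exact (hkk.1.contDiffAt ⟨h0, h1⟩).contDiffWithinAt

/-! ### Local pictures: sides of an arc, arc length, arcs and stars from parametrizations. -/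

/-- An arc has two sides. -/
theorem HasArcAt.exists_sides {S N : Set ℂ} {p : ℂ} (hp : HasArcAt S p) (hSN : S ⊆ N)
    {V : Set ℂ} (hV : V ∈ 𝓝 p) (hNV : N ∩ V ⊆ S) :
    ∃ U A B : Set ℂ, U ∈ 𝓝 p ∧ IsPreconnected A ∧ IsPreconnected B ∧ U \ N ⊆ A ∪ B ∧
      A ∪ B ⊆ Nᶜ ∧ ∀ q ∈ N ∩ U, q ∈ closure A ∧ q ∈ closure B := by
  obtain ⟨δ, g, hδ, hg, hg0, hU⟩ := hp
  have h0 : (0 : ℝ) ∈ Ioo (-δ) δ := ⟨by linarith, hδ⟩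
  set v := deriv g 0
  have hv : v ≠ 0 := by
    rw [← norm_ne_zero_iff, hg.norm_deriv 0 h0]; exact one_ne_zero
  -- Coordinates along the arc and in the fixed normal direction at `p`. By the inverse function
  -- theorem they are local coordinates, in which `N` is the first axis.
  set Φ : ℝ × ℝ → ℂ := fun x => g x.1 + x.2 * (Complex.I * v)
  set e : (ℝ × ℝ) ≃L[ℝ] ℂ := Complex.equivRealProdCLM.symm.trans
    ((ContinuousLinearEquiv.unitsEquivAut ℂ (Units.mk0 v hv)).restrictScalars ℝ)
  have hΦ : HasStrictFDerivAt Φ (e : (ℝ × ℝ) →L[ℝ] ℂ) (0, 0) := by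
    have h1 : HasStrictDerivAt g v 0 := (hg.contDiffAt h0).hasStrictDerivAt (by simp)
    have h2 : HasStrictFDerivAt (fun x : ℝ × ℝ => g x.1) _ (0, 0) :=
      h1.hasStrictFDerivAt.comp (0, 0) hasStrictFDerivAt_fst
    have h3 : HasStrictFDerivAt (fun x : ℝ × ℝ => (x.2 : ℂ) * (Complex.I * v)) _ (0, 0) :=
      (Complex.ofRealCLM.hasStrictFDerivAt.comp (0, 0) hasStrictFDerivAt_snd).mul_const
        (Complex.I * v)
    refine (h2.add h3).congr_fderiv ?_
    have he : ∀ x : ℝ × ℝ, e x = ((x.1 : ℂ) + x.2 * Complex.I) * v := fun x => by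
      simp only [e, ContinuousLinearEquiv.trans_apply]
      rw [Complex.equivRealProdCLM_symm_apply]
      rfl
    ext <;> simp [he]
  set E := hΦ.toOpenPartialHomeomorph Φ
  have hE0 : ((0, 0) : ℝ × ℝ) ∈ E.source := hΦ.mem_toOpenPartialHomeomorph_source
  have hEΦ : ∀ x, E x = Φ x := fun x => rfl
  have hΦ0 : Φ (0, 0) = p := by simp [Φ, hg0]
  have hcont : ContinuousAt Φ (0, 0) := hΦ.continuousAt
  set box : ℝ → Set (ℝ × ℝ) := fun η => Ioo (-η) η ×ˢ Ioo (-η) η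
  have hbox : ∀ W ∈ 𝓝 ((0, 0) : ℝ × ℝ), ∃ η > 0, box η ⊆ W := by
    intro W hW
    obtain ⟨η, hη, hb⟩ := Metric.mem_nhds_iff.1 hW
    refine ⟨η, hη, fun x hx => hb ?_⟩
    rw [← ball_prod_same, Real.ball_eq_Ioo]
    simpa [box] using hx
  have hboxmono : ∀ {η η' : ℝ}, η ≤ η' → box η ⊆ box η' := fun h =>
    prod_mono (Ioo_subset_Ioo (by linarith) h) (Ioo_subset_Ioo (by linarith) h)
  obtain ⟨η₁, hη₁, hb₁⟩ := hbox (E.source ∩ Φ ⁻¹' V)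
    (inter_mem (E.open_source.mem_nhds hE0) (hcont (by rwa [hΦ0])))
  set η₂ := min η₁ δ
  have hη₂ : 0 < η₂ := lt_min hη₁ hδ
  obtain ⟨U₀, hU₀, hSU₀⟩ := hU η₂ hη₂ (min_le_right _ _)
  obtain ⟨η₃, hη₃, hb₃⟩ := hbox (Φ ⁻¹' U₀) (hcont (by rwa [hΦ0]))
  set η := min η₂ η₃
  have hη : 0 < η := lt_min hη₂ hη₃
  have hηη₂ : η ≤ η₂ := min_le_left _ _
  have hbs : box η ⊆ E.source := fun x hx =>
    (hb₁ (hboxmono (hηη₂.trans (min_le_left _ _)) hx)).1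
  have hηδ : η ≤ δ := hηη₂.trans (min_le_right _ _)
  have hN : ∀ x ∈ box η, Φ x ∈ N ↔ x.2 = 0 := by
    intro x hx
    constructor
    · intro hxN
      have hxS : Φ x ∈ S := hNV ⟨hxN, (hb₁ (hboxmono (hηη₂.trans (min_le_left _ _)) hx)).2⟩
      obtain ⟨t, ht, hgt⟩ := hSU₀ ⟨hxS, hb₃ (hboxmono (min_le_right _ _) hx)⟩
      have ht' : ((t, 0) : ℝ × ℝ) ∈ E.source :=
        (hb₁ (hboxmono (min_le_left _ _) (show (t, 0) ∈ box η₂ from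
          ⟨ht, ⟨by linarith, hη₂⟩⟩))).1
      have := E.injOn (hbs hx) ht' (by rw [hEΦ, hEΦ, ← hgt]; simp [Φ])
      rw [this]
    · intro hx2
      have : Φ x = g x.1 := by simp [Φ, hx2]
      rw [this]
      exact hSN (hg.mapsTo ⟨by linarith [hx.1.1], by linarith [hx.1.2]⟩)
  have hcontOn : ContinuousOn Φ (box η) := E.continuousOn.mono hbs
  have hA : Ioo (-η) η ×ˢ Ioo 0 η ⊆ box η := prod_mono le_rfl (Ioo_subset_Ioo (by linarith) le_rfl)
  have hB : Ioo (-η) η ×ˢ Ioo (-η) 0 ⊆ box η := prod_mono le_rfl (Ioo_subset_Ioo le_rfl hη.le)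
  refine ⟨Φ '' box η, Φ '' (Ioo (-η) η ×ˢ Ioo 0 η), Φ '' (Ioo (-η) η ×ˢ Ioo (-η) 0), ?_,
    (isPreconnected_Ioo.prod isPreconnected_Ioo).image _ (hcontOn.mono hA),
    (isPreconnected_Ioo.prod isPreconnected_Ioo).image _ (hcontOn.mono hB), ?_, ?_, ?_⟩
  · have h1 : box η ∈ 𝓝 ((0, 0) : ℝ × ℝ) :=
      prod_mem_nhds (Ioo_mem_nhds (by linarith) hη) (Ioo_mem_nhds (by linarith) hη)
    have h2 := E.image_mem_nhds hE0 h1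
    rwa [hEΦ, hΦ0] at h2
  · rintro _ ⟨⟨x, hx, rfl⟩, hxN⟩
    rw [hN x hx] at hxN
    rcases lt_or_gt_of_ne hxN with h | h
    · exact Or.inr ⟨x, ⟨hx.1, hx.2.1, h⟩, rfl⟩
    · exact Or.inl ⟨x, ⟨hx.1, h, hx.2.2⟩, rfl⟩
  · rintro _ (⟨x, hx, rfl⟩ | ⟨x, hx, rfl⟩)
    · rw [mem_compl_iff, hN x (hA hx)]; exact hx.2.1.ne'
    · rw [mem_compl_iff, hN x (hB hx)]; exact hx.2.2.ne
  · rintro _ ⟨hxN, x, hx, rfl⟩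
    have hx2 := (hN x hx).1 hxN
    have hc : ContinuousAt (fun s : ℝ => Φ (x.1, s)) 0 := by
      simp only [Φ]; fun_prop
    have hc0 : Φ (x.1, 0) = Φ x := by rw [← hx2]
    have hlim := hc.tendsto
    rw [hc0] at hlim
    constructor
    · refine mem_closure_of_tendsto (hlim.mono_left (nhdsWithin_le_nhds (s := Ioi 0))) ?_
      filter_upwards [Ioo_mem_nhdsGT hη] with s hs using ⟨(x.1, s), ⟨hx.1, hs⟩, rfl⟩
    · refine mem_closure_of_tendsto (hlim.mono_left (nhdsWithin_le_nhds (s := Iio 0))) ?_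
      filter_upwards [Ioo_mem_nhdsLT (show -η < 0 by linarith)] with s hs
        using ⟨(x.1, s), ⟨hx.1, hs⟩, rfl⟩

/-- Parametrization by arc length. -/
theorem exists_unit_speed {ζ : ℝ → ℂ} {a b : ℝ} (hab : a < b) (hζ : ContDiffOn ℝ ∞ ζ (Icc a b))
    (hne : ∀ t ∈ Icc a b, derivWithin ζ (Icc a b) t ≠ 0) :
    ∃ (L : ℝ) (τ : ℝ → ℝ), 0 < L ∧ StrictMonoOn τ (Icc 0 L) ∧ τ 0 = a ∧ τ L = b ∧
      τ '' Icc 0 L = Icc a b ∧ ContDiffOn ℝ ∞ (ζ ∘ τ) (Icc 0 L) ∧ UnitCurve univ 0 L (ζ ∘ τ) := by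
  have hu : UniqueDiffOn ℝ (Icc a b) := uniqueDiffOn_Icc hab
  set v : ℝ → ℝ := fun t => ‖derivWithin ζ (Icc a b) t‖
  have hdζ : ContDiffOn ℝ ∞ (derivWithin ζ (Icc a b)) (Icc a b) := hζ.derivWithin hu (by simp)
  have hv : ContDiffOn ℝ ∞ v (Icc a b) := hdζ.norm ℝ hne
  have hvpos : ∀ t ∈ Icc a b, 0 < v t := fun t ht => norm_pos_iff.2 (hne t ht)
  -- Extending the speed by constants makes arc length an increasing bijection of ℝ, with a globally
  -- defined inverse.
  set w : ℝ → ℝ := IccExtend hab.le ((Icc a b).domRestrict v)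
  have hw : Continuous w := (continuousOn_iff_continuous_domRestrict.1 hv.continuousOn).Icc_extend'
  have hwv : ∀ t ∈ Icc a b, w t = v t := fun t ht => by
    simp only [w, IccExtend_of_mem hab.le _ ht, domRestrict_apply]
  obtain ⟨m, hm, hmw⟩ : ∃ m > 0, ∀ t, m ≤ w t := by
    obtain ⟨t₀, ht₀, hmin⟩ := isCompact_Icc.exists_isMinOn (nonempty_Icc.2 hab.le) hv.continuousOn
    exact ⟨v t₀, hvpos t₀ ht₀, fun t => hmin (projIcc a b hab.le t).2⟩
  set s : ℝ → ℝ := fun t => ∫ x in a..t, w x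
  have hs : ∀ t, HasDerivAt s (w t) t := fun t => hw.integral_hasStrictDerivAt a t |>.hasDerivAt
  have hsd : Differentiable ℝ s := fun t => (hs t).differentiableAt
  have hsmono : StrictMono s := strictMono_of_deriv_pos fun t => by
    rw [(hs t).deriv]; exact hm.trans_le (hmw t)
  have hgrow : ∀ x y, x ≤ y → m * (y - x) ≤ s y - s x := fun x y hxy =>
    mul_sub_le_image_sub_of_le_deriv hsd (fun t => by rw [(hs t).deriv]; exact hmw t) hxy
  have hsurj : Function.Surjective s := by
    refine hsd.continuous.surjective ?_ ?_
    · refine tendsto_atTop_mono' _ (f₁ := fun t => m * (t - a) + s a) ?_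
        (tendsto_atTop_add_const_right _ _ ((tendsto_atTop_add_const_right _ _ tendsto_id).const_mul_atTop hm))
      filter_upwards [eventually_ge_atTop a] with t ht
      linarith [hgrow a t ht]
    · refine tendsto_atBot_mono' _ (f₁ := fun t => m * (t - a) + s a) ?_
        (tendsto_atBot_add_const_right _ _ ((tendsto_atBot_add_const_right _ _ tendsto_id).const_mul_atBot hm))
      filter_upwards [eventually_le_atBot a] with t ht
      linarith [hgrow t a ht]
  set O := hsmono.orderIsoOfSurjective s hsurj
  set τ : ℝ → ℝ := fun t => O.symm t
  have hτs : ∀ t, τ (s t) = t := fun t => O.symm_apply_apply t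
  have hsτ : ∀ t, s (τ t) = t := fun t => O.apply_symm_apply t
  have hτmono : StrictMono τ := O.symm.strictMono
  have hτc : Continuous τ := O.symm.continuous
  have hτd : ∀ t, HasDerivAt τ (w (τ t))⁻¹ t := fun t =>
    HasDerivAt.of_local_left_inverse hτc.continuousAt (hs (τ t)) (hm.trans_le (hmw _)).ne'
      (Eventually.of_forall hsτ)
  have hs0 : s a = 0 := by simp [s]
  set L := s b
  have hL : 0 < L := hs0 ▸ hsmono hab
  have hτ0 : τ 0 = a := by rw [← hs0, hτs]
  have hτL : τ L = b := hτs b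
  have hmaps : MapsTo τ (Icc 0 L) (Icc a b) := fun t ht =>
    ⟨hτ0 ▸ hτmono.monotone ht.1, hτL ▸ hτmono.monotone ht.2⟩
  have himg : τ '' Icc 0 L = Icc a b := by
    refine Subset.antisymm hmaps.image_subset fun t ht => ⟨s t, ⟨?_, ?_⟩, hτs t⟩
    · rw [← hs0]; exact hsmono.monotone ht.1
    · exact hsmono.monotone ht.2
  have hu' : UniqueDiffOn ℝ (Icc 0 L) := uniqueDiffOn_Icc hL
  have hdw : ∀ t ∈ Icc 0 L, derivWithin τ (Icc 0 L) t = (v (τ t))⁻¹ := fun t ht => by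
    rw [(hτd t).hasDerivWithinAt.derivWithin (hu' t ht), hwv _ (hmaps ht)]
  -- Bootstrap: τ' = 1/(v ∘ τ) is as smooth as τ is known to be.
  have hτn : ∀ n : ℕ, ContDiffOn ℝ n τ (Icc 0 L) := by
    intro n
    induction n with
    | zero => exact contDiffOn_zero.2 hτc.continuousOn
    | succ n ih =>
      push_cast
      rw [contDiffOn_succ_iff_derivWithin hu']
      refine ⟨fun t _ => (hτd t).differentiableAt.differentiableWithinAt, by simp, ?_⟩
      refine ContDiffOn.congr ?_ hdw
      have h1 : ContDiffOn ℝ n v (Icc a b) := hv.of_le (by exact_mod_cast le_top)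
      exact (h1.comp ih hmaps).inv fun t ht => (hvpos _ (hmaps ht)).ne'
  have hτi : ContDiffOn ℝ ∞ τ (Icc 0 L) := contDiffOn_infty.2 hτn
  refine ⟨L, τ, hL, hτmono.strictMonoOn _, hτ0, hτL, himg, hζ.comp hτi hmaps,
    (hζ.comp hτi hmaps).mono Ioo_subset_Icc_self, fun t ht => ?_, fun _ _ => mem_univ _⟩
  have hτt : τ t ∈ Ioo a b := ⟨hτ0 ▸ hτmono ht.1, hτL ▸ hτmono ht.2⟩
  have hτt' := Ioo_subset_Icc_self hτt
  have h1 : HasDerivAt ζ (derivWithin ζ (Icc a b) (τ t)) (τ t) :=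
    ((hζ.differentiableOn (by simp) _ hτt').hasDerivWithinAt).hasDerivAt
      (Icc_mem_nhds hτt.1 hτt.2)
  rw [(h1.scomp t (hτd t)).deriv, norm_smul, hwv _ hτt', Real.norm_of_nonneg
    (inv_nonneg.2 (hvpos _ hτt').le)]
  exact inv_mul_cancel₀ (hvpos _ hτt').ne'

theorem HasArcAt.inter {S W : Set ℂ} {p : ℂ} (hp : HasArcAt S p) (hW : W ∈ 𝓝 p) :
    HasArcAt (S ∩ W) p := by
  obtain ⟨δ, g, hδ, hg, hg0, hU⟩ := hp
  have hc : ContinuousAt g 0 := hg.continuousAt ⟨by linarith, hδ⟩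
  obtain ⟨r, hr, hrW⟩ := Metric.mem_nhds_iff.1 (hc (by rwa [hg0]))
  rw [Real.ball_eq_Ioo, zero_sub, zero_add] at hrW
  have hm : 0 < min δ r := lt_min hδ hr
  have hm1 := min_le_left δ r
  have hm2 := min_le_right δ r
  refine ⟨min δ r, g, hm, (hg.mono (by linarith) hm1).mono_set fun t ht =>
    ⟨hg.mapsTo ⟨by linarith [ht.1], by linarith [ht.2]⟩,
      hrW ⟨by linarith [ht.1], by linarith [ht.2]⟩⟩, hg0, fun η hη hη' => ?_⟩
  obtain ⟨U, hU1, hU2⟩ := hU η hη (hη'.trans hm1)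
  exact ⟨U, hU1, fun z hz => hU2 ⟨hz.1.1, hz.2⟩⟩

theorem Star.exists_inter {S W : Set ℂ} {x : ℂ} (st : Star S x) (hW : W ∈ 𝓝 x) :
    ∃ st' : Star (S ∩ W) x, ∀ j', ∃ j, st'.g j' = st.g j := by
  have h1 : ∀ᶠ t in 𝓝[>] (0 : ℝ), ∀ j, st.g j t ∈ W :=
    eventually_all.2 fun j => (st.tendsto j).eventually_mem hW
  obtain ⟨r, hr, hrW⟩ := (nhdsGT_basis (0 : ℝ)).eventually_iff.1 h1
  have hm : 0 < min st.δ r := lt_min st.pos hr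
  have hm1 := min_le_left st.δ r
  have hm2 := min_le_right st.δ r
  refine ⟨⟨st.ν, min st.δ r, st.g, hm, fun j => ((st.curve j).mono le_rfl hm1).mono_set
    fun t ht => ⟨(st.curve j).mapsTo ⟨ht.1, ht.2.trans_le hm1⟩, hrW ⟨ht.1, ht.2.trans_le hm2⟩ j⟩,
    fun j => (st.contDiffOn j).mono (Ico_subset_Ico le_rfl hm1), st.start, fun i j hij =>
      (st.disjoint i j hij).mono (image_mono (Ioo_subset_Ioo le_rfl hm1))
        (image_mono (Ioo_subset_Ioo le_rfl hm1)), fun η hη hη' => ?_⟩, fun j => ⟨j, rfl⟩⟩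
  obtain ⟨U, hU1, hU2⟩ := st.nhds η hη (hη'.trans hm1)
  exact ⟨U, hU1, fun z hz => hU2 ⟨hz.1.1, hz.2⟩⟩

theorem UnitCurve.exists_injOn {S : Set ℂ} {a b t : ℝ} {k : ℝ → ℂ} (hk : UnitCurve S a b k)
    (ht : t ∈ Ioo a b) : ∃ ε > 0, InjOn k (Ioo (t - ε) (t + ε)) := by
  set v := deriv k t
  have hv : ‖v‖ = 1 := hk.norm_deriv t ht
  set ℓ : ℂ →L[ℝ] ℝ := innerSL ℝ v
  have hf : ContDiffAt ℝ 1 (fun u => ℓ (k u)) t :=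
    ℓ.contDiff.contDiffAt.comp t ((hk.contDiffAt ht).of_le (by simp))
  have hfd : HasDerivAt (fun u => ℓ (k u)) 1 t := by
    refine (ℓ.hasFDerivAt.comp_hasDerivAt t (hk.hasDerivAt ht)).congr_deriv ?_
    change inner ℝ v v = 1
    rw [real_inner_self_eq_norm_sq, hv, one_pow]
  obtain ⟨F, -, hFl⟩ := exists_contDiffAt_left_inverse hf (by rw [hfd.deriv]; exact one_ne_zero)
  obtain ⟨ε, hε, hb⟩ := Metric.eventually_nhds_iff_ball.1 hFl
  rw [Real.ball_eq_Ioo] at hb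
  refine ⟨ε, hε, fun x hx y hy hxy => ?_⟩
  rw [← hb x hx, ← hb y hy, hxy]

/-- A regular point, regarded as the centre of a star with two branches. -/
theorem HasArcAt.exists_star {S : Set ℂ} {p : ℂ} (hp : HasArcAt S p) :
    ∃ st : Star (S ∩ {p}ᶜ) p, 0 < st.ν := by
  obtain ⟨δ, g, hδ, hg, hg0, hU⟩ := hp
  obtain ⟨ε, hε, hinj⟩ := hg.exists_injOn (t := 0) ⟨by linarith, hδ⟩
  rw [zero_sub, zero_add] at hinj
  have hm : 0 < min δ ε := lt_min hδ hε
  set m := min δ ε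
  have hm1 : m ≤ δ := min_le_left δ ε
  have hm2 : m ≤ ε := min_le_right δ ε
  have hinj' : InjOn g (Ioo (-m) m) := hinj.mono (Ioo_subset_Ioo (by linarith) hm2)
  set s : Fin 2 → ℝ := ![1, -1]
  have hs : ∀ j, s j = 1 ∨ s j = -1 := by intro j; fin_cases j <;> simp [s]
  have hss : ∀ j, s j * s j = 1 := fun j => by rcases hs j with h | h <;> rw [h] <;> norm_num
  have hmem : ∀ j, ∀ t ∈ Ico 0 m, s j * t ∈ Ioo (-m) m := fun j t ht => by
    rcases hs j with h | h <;> rw [h] <;> constructor <;> linarith [ht.1, ht.2]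
  refine ⟨⟨2, m, fun j t => g (s j * t), hm, fun j => ?_, fun j => ?_, fun j => by simp [hg0],
    fun i j hij => ?_, fun η hη hηm => ?_⟩, two_pos⟩
  · have h := hg.comp_affine (hs j) 0 (a' := 0) (b' := m) fun t ht => by
      have := hmem j t (Ioo_subset_Ico_self ht)
      rw [zero_add]; exact ⟨by linarith [this.1], by linarith [this.2]⟩
    simp only [zero_add] at h
    refine h.mono_set fun t ht => ⟨h.mapsTo ht, fun h0 => ?_⟩
    have h1 : s j * t = 0 := hinj' (hmem j t (Ioo_subset_Ico_self ht)) ⟨by linarith, hm⟩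
      (h0.trans hg0.symm)
    have h2 : t = 0 := by linear_combination s j * h1 - t * hss j
    exact ht.1.ne' h2
  · refine hg.contDiffOn.comp (by fun_prop) fun t ht => ?_
    have := hmem j t ht
    exact ⟨by linarith [this.1], by linarith [this.2]⟩
  · rw [Set.disjoint_left]
    rintro _ ⟨t, ht, rfl⟩ ⟨u, hu, h⟩
    have h1 : s j * u = s i * t := hinj' (hmem j u (Ioo_subset_Ico_self hu))
      (hmem i t (Ioo_subset_Ico_self ht)) h
    have h2 : s i = -s j := by
      fin_cases i <;> fin_cases j <;> first | exact absurd rfl hij | simp [s]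
    have h3 : u = -t := by
      linear_combination s j * h1 - u * hss j - t * hss j + s j * t * h2
    linarith [ht.1, hu.1]
  · obtain ⟨U, hU1, hU2⟩ := hU η hη (hηm.trans hm1)
    refine ⟨U, hU1, ?_⟩
    rintro z ⟨⟨hzS, hzp⟩, hzU⟩
    obtain ⟨t, ht, rfl⟩ := hU2 ⟨hzS, hzU⟩
    rw [mem_iUnion]
    rcases lt_trichotomy t 0 with h | rfl | h
    · exact ⟨1, -t, ⟨by linarith, by linarith [ht.1]⟩, by simp [s]⟩
    · exact (hzp hg0).elim
    · exact ⟨0, t, ⟨h, ht.2⟩, by simp [s]⟩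

/-- After recentring at `p`, the part of the arc with parameters away from that of `p` is compact
and misses `p` by injectivity, so a small neighbourhood sees the central part only. -/
theorem hasArcAt_of_arc {N X : Set ℂ} {p : ℂ} (hX : IsClosed X) (hp : p ∉ X) {ζ : ℝ → ℂ}
    (hζ : ContDiffOn ℝ ∞ ζ (Icc (-1) 1)) (hne : ∀ t ∈ Icc (-1) 1, derivWithin ζ (Icc (-1) 1) t ≠ 0)
    (hinj : InjOn ζ (Icc (-1) 1)) (h0 : ζ 0 = p) {U : Set ℂ} (hU : U ∈ 𝓝 p)
    (hN : N ∩ U = ζ '' Icc (-1) 1 ∩ U) : HasArcAt (N \ X) p := by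
  obtain ⟨L, τ, hL, hmono, hτ0, hτL, himg, hcd, hk⟩ := exists_unit_speed (by norm_num) hζ hne
  set k := ζ ∘ τ
  have hkimg : k '' Icc 0 L = ζ '' Icc (-1) 1 := by rw [image_comp, himg]
  have hkinj : InjOn k (Icc 0 L) := hinj.comp hmono.injOn fun t ht => himg ▸ mem_image_of_mem _ ht
  obtain ⟨s, hs, hs0⟩ : (0 : ℝ) ∈ τ '' Icc 0 L := by rw [himg]; constructor <;> norm_num
  have hks : k s = p := by simp [k, hs0, h0]
  have hsI : s ∈ Ioo 0 L := by
    constructor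
    · refine lt_of_le_of_ne hs.1 ?_
      rintro rfl
      rw [hτ0] at hs0; norm_num at hs0
    · refine lt_of_le_of_ne hs.2 ?_
      rintro rfl
      rw [hτL] at hs0; norm_num at hs0
  have hc : ContinuousAt k s := hk.continuousAt hsI
  have hW : U ∩ Xᶜ ∈ 𝓝 (k s) := by rw [hks]; exact inter_mem hU (hX.isOpen_compl.mem_nhds hp)
  obtain ⟨r, hr, hrW⟩ := Metric.mem_nhds_iff.1 (inter_mem (hc hW) (Ioo_mem_nhds hsI.1 hsI.2))
  rw [Real.ball_eq_Ioo] at hrW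
  refine ⟨r, fun t => k (s + t), hr, ?_, by simp [hks], fun η hη hηr => ?_⟩
  · have h := hk.comp_affine (Or.inl rfl) s (a' := -r) (b' := r) fun t ht =>
      (hrW ⟨by linarith [ht.1], by linarith [ht.2]⟩ : s + 1 * t ∈ _).2
    simp only [one_mul] at h
    refine h.mono_set fun t ht => ?_
    have h1 := hrW (show s + t ∈ Ioo (s - r) (s + r) from ⟨by linarith [ht.1], by linarith [ht.2]⟩)
    have h2 : k (s + t) ∈ N ∩ U := by
      rw [hN, ← hkimg]
      exact ⟨mem_image_of_mem _ (Ioo_subset_Icc_self h1.2), h1.1.1⟩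
    exact ⟨h2.1, h1.1.2⟩
  · have hK : IsCompact (Icc 0 L \ Ioo (s - η) (s + η)) := isCompact_Icc.diff isOpen_Ioo
    have hKc := (hK.image_of_continuousOn (hcd.continuousOn.mono sdiff_subset)).isClosed
    have hpK : p ∉ k '' (Icc 0 L \ Ioo (s - η) (s + η)) := by
      rintro ⟨t, ht, htp⟩
      have := hkinj ht.1 hs (htp.trans hks.symm)
      exact ht.2 (by rw [this]; constructor <;> linarith)
    refine ⟨_, inter_mem hU (hKc.isOpen_compl.mem_nhds hpK), ?_⟩
    rintro z ⟨hz1, hz2, hz3⟩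
    have h1 : z ∈ k '' Icc 0 L := by
      have : z ∈ N ∩ U := ⟨hz1.1, hz2⟩
      rw [hN, ← hkimg] at this
      exact this.1
    obtain ⟨t, ht, rfl⟩ := h1
    have h2 : t ∈ Ioo (s - η) (s + η) := by
      by_contra hcon
      exact hz3 ⟨t, ⟨ht, hcon⟩, rfl⟩
    exact ⟨t - s, ⟨by linarith [h2.1], by linarith [h2.2]⟩, by simp⟩

theorem exists_star_of_arcs {N X : Set ℂ} {x : ℂ} (hX : X.Finite) (hxX : x ∈ X) {ν : ℕ}
    {ζ : Fin ν → ℝ → ℂ} (hζ : ∀ j, ContDiffOn ℝ ∞ (ζ j) (Icc 0 1))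
    (hne : ∀ j, ∀ t ∈ Icc 0 1, derivWithin (ζ j) (Icc 0 1) t ≠ 0)
    (hinj : ∀ j, InjOn (ζ j) (Icc 0 1)) (h0 : ∀ j, ζ j 0 = x)
    (hdisj : ∀ i j, i ≠ j → ζ i '' Icc 0 1 ∩ ζ j '' Icc 0 1 ⊆ {x}) {U : Set ℂ} (hU : U ∈ 𝓝 x)
    (hN : N ∩ U = (⋃ j, ζ j '' Icc 0 1) ∩ U) : ∃ st : Star (N \ X) x, st.ν = ν := by
  choose L τ hL hmono hτ0 hτL himg hcd hk using
    fun j => exists_unit_speed zero_lt_one (hζ j) (hne j)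
  set k : Fin ν → ℝ → ℂ := fun j => ζ j ∘ τ j
  have hkimg : ∀ j, k j '' Icc 0 (L j) = ζ j '' Icc 0 1 := fun j => by
    simp only [k]; rw [image_comp, himg]
  have hkinj : ∀ j, InjOn (k j) (Icc 0 (L j)) := fun j =>
    (hinj j).comp (hmono j).injOn fun t ht => himg j ▸ mem_image_of_mem _ ht
  have hk0 : ∀ j, k j 0 = x := fun j => by simp [k, hτ0, h0]
  have hne' : ∀ j, ∀ t ∈ Icc 0 (L j), 0 < t → k j t ≠ x := fun j t ht h0t h => by
    have := hkinj j ht ⟨le_rfl, (hL j).le⟩ (h.trans (hk0 j).symm)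
    exact h0t.ne' this
  have hW : U ∩ (X \ {x})ᶜ ∈ 𝓝 x :=
    inter_mem hU ((hX.subset sdiff_subset).isClosed.isOpen_compl.mem_nhds (by simp))
  have hev : ∀ᶠ t in 𝓝[>] (0 : ℝ), ∀ j, k j t ∈ U ∩ (X \ {x})ᶜ ∧ t < L j := by
    refine eventually_all.2 fun j => ?_
    have h1 : Tendsto (k j) (𝓝[>] 0) (𝓝 x) := by
      have h2 := ((hcd j).continuousOn 0 ⟨le_rfl, (hL j).le⟩).tendsto
      rw [show (ζ j ∘ τ j) 0 = x from hk0 j] at h2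
      refine h2.mono_left ?_
      rw [← nhdsWithin_Ioo_eq_nhdsGT (hL j)]
      exact nhdsWithin_mono _ Ioo_subset_Icc_self
    filter_upwards [h1.eventually_mem hW, Ioo_mem_nhdsGT (hL j)] with t h3 h4 using ⟨h3, h4.2⟩
  obtain ⟨r', hr', hr'W⟩ := (nhdsGT_basis (0 : ℝ)).eventually_iff.1 hev
  set r := r' / 2
  have hr : 0 < r := half_pos hr'
  have hrr' : r < r' := half_lt_self hr'
  have hrW : ∀ t ∈ Ioo 0 r, ∀ j, k j t ∈ U ∩ (X \ {x})ᶜ := fun t ht j =>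
    (hr'W ⟨ht.1, ht.2.trans hrr'⟩ j).1
  have hrL : ∀ j, r < L j := fun j => (hr'W ⟨hr, hrr'⟩ j).2
  have hsub : ∀ j, Ioo 0 r ⊆ Icc 0 (L j) := fun j t ht => ⟨ht.1.le, (ht.2.trans (hrL j)).le⟩
  refine ⟨⟨ν, r, k, hr, fun j => ?_, fun j => ?_, hk0, fun i j hij => ?_, fun η hη hηr => ?_⟩, rfl⟩
  · refine ((hk j).mono le_rfl (hrL j).le).mono_set fun t ht => ?_
    have h1 := hrW t ht j
    have h2 : k j t ∈ N ∩ U := by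
      rw [hN]
      refine ⟨mem_iUnion.2 ⟨j, ?_⟩, h1.1⟩
      rw [← hkimg]
      exact mem_image_of_mem _ (hsub j ht)
    exact ⟨h2.1, fun hX' => h1.2 ⟨hX', hne' j t (hsub j ht) ht.1⟩⟩
  · exact (hcd j).mono fun t ht => ⟨ht.1, (ht.2.trans (hrL j)).le⟩
  · rw [Set.disjoint_left]
    rintro _ ⟨t, ht, rfl⟩ ⟨u, hu, h⟩
    refine hne' i t (hsub i ht) ht.1 (hdisj i j hij ⟨?_, ?_⟩)
    · rw [← hkimg]; exact mem_image_of_mem _ (hsub i ht)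
    · rw [← h, ← hkimg]; exact mem_image_of_mem _ (hsub j hu)
  · have hcl : IsClosed (⋃ j, k j '' Icc η (L j)) :=
      isClosed_iUnion_of_finite fun j => (isCompact_Icc.image_of_continuousOn
        ((hcd j).continuousOn.mono (Icc_subset_Icc hη.le le_rfl))).isClosed
    have hx : x ∉ ⋃ j, k j '' Icc η (L j) := by
      rw [mem_iUnion]
      rintro ⟨j, t, ht, htx⟩
      exact hne' j t ⟨hη.le.trans ht.1, ht.2⟩ (hη.trans_le ht.1) htx
    refine ⟨_, inter_mem hU (hcl.isOpen_compl.mem_nhds hx), ?_⟩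
    rintro z ⟨hz1, hz2, hz3⟩
    have h1 : z ∈ N ∩ U := ⟨hz1.1, hz2⟩
    rw [hN] at h1
    obtain ⟨j, hj⟩ := mem_iUnion.1 h1.1
    rw [← hkimg] at hj
    obtain ⟨t, ht, rfl⟩ := hj
    refine mem_iUnion.2 ⟨j, t, ⟨lt_of_le_of_ne ht.1 ?_, ?_⟩, rfl⟩
    · rintro rfl
      rw [hk0] at hz1
      exact hz1.2 hxX
    · by_contra hcon
      exact hz3 (mem_iUnion.2 ⟨j, t, ⟨not_lt.1 hcon, ht.2⟩, rfl⟩)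

/-! ### Planar partitions, Cauchy integrals of cycles, and absence of loops. -/

/-- Three disjoint connected open sets whose complement is a compact union of a finite set `X` and
a locally arc-like set `S`, such that the boundaries of any two of them meet in `S`. -/
structure PlanarPartition (S X : Set ℂ) (D : Fin 3 → Set ℂ) : Prop where
  isCompact : IsCompact (S ∪ X)
  finite : X.Finite
  disjoint_set : Disjoint S X
  hasArcAt : ∀ p ∈ S, HasArcAt S p
  isOpen : ∀ i, IsOpen (D i)
  isPreconnected : ∀ i, IsPreconnected (D i)
  disjoint : Pairwise fun i j => Disjoint (D i) (D j)
  nonempty : ∀ i, (D i).Nonempty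
  iUnion_eq : ⋃ i, D i = (S ∪ X)ᶜ
  adj : ∀ i j, i ≠ j → ∃ p ∈ S, p ∈ closure (D i) ∧ p ∈ closure (D j)

theorem IsEdge.isC1Curve {S : Set ℂ} {L : ℝ} {k : ℝ → ℂ} (h : IsEdge S L k) :
    IsC1Curve L k (derivWithin k (Icc 0 L)) :=
  ⟨h.pos, h.contDiffOn.continuousOn,
    h.contDiffOn.continuousOn_derivWithin (uniqueDiffOn_Icc h.pos) (by simp), fun t ht => by
      rw [derivWithin_of_mem_nhds (Icc_mem_nhds ht.1 ht.2)]
      exact h.curve.hasDerivAt ht⟩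

theorem IsEdge.mapsTo_Icc {S N : Set ℂ} {L : ℝ} {k : ℝ → ℂ} (h : IsEdge S L k) (hN : IsClosed N)
    (hSN : S ⊆ N) : MapsTo k (Icc 0 L) N := by
  have h1 : MapsTo k (Ioo 0 L) N := h.curve.mapsTo.mono_right hSN
  have h2 := h.contDiffOn.continuousOn
  rw [← closure_Ioo h.pos.ne] at h2 ⊢
  exact hN.closure_eq ▸ h1.closure_of_continuousOn h2

/-- Near a point of a unit speed curve in `S`, the set `S` coincides with the curve. -/
theorem UnitCurve.exists_nhds_subset {S : Set ℂ} {a b : ℝ} {k : ℝ → ℂ} (hk : UnitCurve S a b k)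
    (hS : ∀ p ∈ S, HasArcAt S p) {t : ℝ} (ht : t ∈ Ioo a b) {η : ℝ} (hη : 0 < η) :
    ∃ U ∈ 𝓝 (k t), S ∩ U ⊆ k '' Ioo (t - η) (t + η) := by
  obtain ⟨δ, g, hδ, hg, hg0, hU⟩ := hS (k t) (hk.mapsTo ht)
  obtain ⟨σ, hσ, hkσ⟩ := hk.eventually_eq_arc ht hδ hg hg0 hU
  have hσσ : σ * σ = 1 := by rcases hσ with rfl | rfl <;> simp
  obtain ⟨ε, hε, hb⟩ := Metric.eventually_nhds_iff_ball.1 hkσ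
  rw [Real.ball_eq_Ioo] at hb
  set m := min δ (min ε η)
  have hm : 0 < m := lt_min hδ (lt_min hε hη)
  have hm1 : m ≤ ε := (min_le_right _ _).trans (min_le_left _ _)
  have hm2 : m ≤ η := (min_le_right _ _).trans (min_le_right _ _)
  obtain ⟨U, hU1, hU2⟩ := hU m hm (min_le_left _ _)
  refine ⟨U, hU1, hU2.trans ?_⟩
  rintro _ ⟨u, hu, rfl⟩
  have hb' : -m < σ * u ∧ σ * u < m := by
    rcases hσ with rfl | rfl <;> constructor <;> linarith [hu.1, hu.2]
  refine ⟨t + σ * u, ⟨by linarith, by linarith⟩, ?_⟩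
  rw [hb (t + σ * u) ⟨by linarith, by linarith⟩]
  congr 1
  linear_combination u * hσσ

/-- A curve is left by moving in its normal direction. -/
theorem UnitCurve.eventually_normal_notMem {S N : Set ℂ} {a b : ℝ} {k : ℝ → ℂ}
    (hk : UnitCurve S a b k) (hS : ∀ p ∈ S, HasArcAt S p) {t : ℝ} (ht : t ∈ Ioo a b)
    {V : Set ℂ} (hV : V ∈ 𝓝 (k t)) (hNV : N ∩ V ⊆ S) :
    ∀ᶠ s : ℝ in 𝓝[≠] 0, k t + s * (Complex.I * deriv k t) ∉ N := by
  set v := deriv k t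
  have hv : v ≠ 0 := by
    rw [← norm_ne_zero_iff, hk.norm_deriv t ht]; exact one_ne_zero
  have hder : HasDerivAt (fun u => ((k u - k t) / v).re) 1 t := by
    have h1 := ((hk.hasDerivAt ht).sub_const (k t)).div_const v
    rw [div_self hv] at h1
    simpa [Function.comp_def] using (Complex.reCLM.hasFDerivAt.comp_hasDerivAt t h1)
  -- Other nearby points of the curve have nonzero real part in the frame of `v`, while normal
  -- displacements have real part 0.
  have hne := hder.eventually_ne (c := 0) one_ne_zero
  rw [eventually_nhdsWithin_iff] at hne
  obtain ⟨η, hη, hb⟩ := Metric.eventually_nhds_iff_ball.1 hne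
  rw [Real.ball_eq_Ioo] at hb
  obtain ⟨U, hU1, hU2⟩ := hk.exists_nhds_subset hS ht hη
  have hlim : ∀ᶠ s : ℝ in 𝓝 0, k t + s * (Complex.I * v) ∈ U ∩ V := by
    have : ContinuousAt (fun s : ℝ => k t + s * (Complex.I * v)) 0 := by fun_prop
    exact this.eventually_mem (by simpa using inter_mem hU1 hV)
  filter_upwards [hlim.filter_mono nhdsWithin_le_nhds, self_mem_nhdsWithin] with s hs hs0 hsN
  obtain ⟨u, hu, hku⟩ := hU2 ⟨hNV ⟨hsN, hs.2⟩, hs.1⟩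
  by_cases hut : u = t
  · rw [hut] at hku
    have : (s : ℂ) * (Complex.I * v) = 0 := by linear_combination -hku
    simp [hv] at this
    exact hs0 this
  · refine hb u hu hut ?_
    rw [hku, add_sub_cancel_left]
    have : (s : ℂ) * (Complex.I * v) / v = s * Complex.I := by field_simp
    rw [this]; simp

namespace PlanarPartition

variable {S X : Set ℂ} {D : Fin 3 → Set ℂ}

theorem disjoint_boundary (h : PlanarPartition S X D) (i : Fin 3) : Disjoint (D i) (S ∪ X) := by
  rw [← subset_compl_iff_disjoint_right, ← h.iUnion_eq]
  exact subset_iUnion D i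

theorem compl_mem_nhds (h : PlanarPartition S X D) {p : ℂ} (hp : p ∈ S) : Xᶜ ∈ 𝓝 p :=
  h.finite.isClosed.isOpen_compl.mem_nhds (disjoint_left.1 h.disjoint_set hp)

theorem exists_subset (h : PlanarPartition S X D) {A : Set ℂ} (hA : IsPreconnected A)
    (hne : A.Nonempty) (hAN : A ⊆ (S ∪ X)ᶜ) : ∃ i, A ⊆ D i := by
  obtain ⟨a, ha⟩ := hne
  have haD := hAN ha
  rw [← h.iUnion_eq, mem_iUnion] at haD
  obtain ⟨i, hi⟩ := haD
  refine ⟨i, hA.subset_left_of_subset_union (h.isOpen i)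
    (isOpen_iUnion fun j => isOpen_iUnion fun _ : j ≠ i => h.isOpen j) ?_ ?_ ⟨a, ha, hi⟩⟩
  · simp only [disjoint_iUnion_right]
    exact fun j hj => h.disjoint hj.symm
  · intro z hz
    have := hAN hz
    rw [← h.iUnion_eq, mem_iUnion] at this
    obtain ⟨j, hj⟩ := this
    by_cases hji : j = i
    · exact Or.inl (hji ▸ hj)
    · exact Or.inr (mem_iUnion₂.2 ⟨j, hji, hj⟩)

/-- Each side of the arc at `p` is connected and misses the boundary, so it lies in one domain. Both
sides may lie in the same one: `i = j` is allowed. -/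
theorem exists_sides (h : PlanarPartition S X D) {p : ℂ} (hp : p ∈ S) :
    ∃ U ∈ 𝓝 p, ∃ i j, U \ (S ∪ X) ⊆ D i ∪ D j ∧
      ∀ q ∈ (S ∪ X) ∩ U, q ∈ closure (D i) ∧ q ∈ closure (D j) := by
  obtain ⟨U, A, B, hU, hA, hB, hUAB, hABN, hcl⟩ :=
    (h.hasArcAt p hp).exists_sides (N := S ∪ X) subset_union_left (h.compl_mem_nhds hp)
      (fun z hz => hz.1.resolve_right hz.2)
  have hpcl := hcl p ⟨Or.inl hp, mem_of_mem_nhds hU⟩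
  obtain ⟨i, hi⟩ := h.exists_subset hA (closure_nonempty_iff.1 ⟨p, hpcl.1⟩)
    (subset_union_left.trans hABN)
  obtain ⟨j, hj⟩ := h.exists_subset hB (closure_nonempty_iff.1 ⟨p, hpcl.2⟩)
    (subset_union_right.trans hABN)
  exact ⟨U, hU, i, j, hUAB.trans (union_subset_union hi hj), fun q hq =>
    ⟨closure_mono hi (hcl q hq).1, closure_mono hj (hcl q hq).2⟩⟩

/-- Along `S`, the domains adjacent to a point are locally constant. -/
theorem eventually_mem_closure_iff (h : PlanarPartition S X D) {p : ℂ} (hp : p ∈ S) (c : Fin 3) :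
    ∀ᶠ q in 𝓝 p, q ∈ S → (q ∈ closure (D c) ↔ p ∈ closure (D c)) := by
  obtain ⟨U, hU, i, j, hUD, hcl⟩ := h.exists_sides hp
  have key : ∀ᶠ q in 𝓝 p, q ∈ S → (q ∈ closure (D c) ↔ c = i ∨ c = j) := by
    filter_upwards [eventually_mem_nhds_iff.2 hU] with q hq hqS
    constructor
    · intro hqc
      obtain ⟨z, hzU, hzc⟩ := mem_closure_iff_nhds.1 hqc U hq
      have hzN : z ∉ S ∪ X := disjoint_left.1 (h.disjoint_boundary c) hzc
      rcases hUD ⟨hzU, hzN⟩ with hz | hz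
      · left; by_contra hne
        exact disjoint_left.1 (h.disjoint hne) hzc hz
      · right; by_contra hne
        exact disjoint_left.1 (h.disjoint hne) hzc hz
    · have := hcl q ⟨Or.inl hqS, mem_of_mem_nhds hq⟩
      rintro (rfl | rfl)
      · exact this.1
      · exact this.2
  have hp' := key.self_of_nhds hp
  filter_upwards [key] with q hq hqS
  rw [hq hqS, hp']

/-- Not all three domains are adjacent to a point of `S`. -/
theorem exists_notMem_closure (h : PlanarPartition S X D) {p : ℂ} (hp : p ∈ S) :
    ∃ c, p ∉ closure (D c) := by
  obtain ⟨U, hU, i, j, hUD, hcl⟩ := h.exists_sides hp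
  have h3 : ∀ i j : Fin 3, ∃ c, c ≠ i ∧ c ≠ j := by decide
  obtain ⟨c, hci, hcj⟩ := h3 i j
  refine ⟨c, fun hpc => ?_⟩
  obtain ⟨z, hzU, hzc⟩ := mem_closure_iff_nhds.1 hpc U hU
  have hzN : z ∉ S ∪ X := disjoint_left.1 (h.disjoint_boundary c) hzc
  rcases hUD ⟨hzU, hzN⟩ with hz | hz
  · exact disjoint_left.1 (h.disjoint hci) hzc hz
  · exact disjoint_left.1 (h.disjoint hcj) hzc hz

section Cycle

variable {ι : Type*} [Fintype ι] {L : ι → ℝ} {k : ι → ℝ → ℂ}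

/-- The weighted sum of the Cauchy integrals of a family of arcs. -/
noncomputable def cycleInt (L : ι → ℝ) (k : ι → ℝ → ℂ) (w : ι → ℂ) (z : ℂ) : ℂ :=
  ∑ e, w e * cauchyInt (L e) (k e) (derivWithin (k e) (Icc 0 (L e))) z

theorem cycleInt_eventually_eq (hk : ∀ e, IsEdge S (L e) (k e)) {w : ι → ℂ}
    (hw : ∀ f : ℂ → ℂ, ∑ e, w e * (f (k e (L e)) - f (k e 0)) = 0) {p : ℂ}
    (hp : ∀ e, p ∉ k e '' Icc 0 (L e)) :
    ∀ᶠ z in 𝓝 p, cycleInt L k w z = cycleInt L k w p :=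
  cauchyInt_cycle_eventually_eq (fun e => (hk e).isC1Curve) hw hp

/-- Local constancy gives derivative zero on a connected open set that the edges do not meet. -/
theorem cycleInt_eq (h : PlanarPartition S X D) (hk : ∀ e, IsEdge S (L e) (k e)) {w : ι → ℂ}
    (hw : ∀ f : ℂ → ℂ, ∑ e, w e * (f (k e (L e)) - f (k e 0)) = 0) {i : Fin 3} {z z' : ℂ}
    (hz : z ∈ D i) (hz' : z' ∈ D i) : cycleInt L k w z = cycleInt L k w z' := by
  have hd : ∀ p ∈ D i, HasDerivAt (cycleInt L k w) 0 p := by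
    intro p hp
    have := cycleInt_eventually_eq (S := S) hk hw (p := p) (by
      rintro e ⟨t, ht, rfl⟩
      exact disjoint_left.1 (h.disjoint_boundary i) hp
        ((hk e).mapsTo_Icc h.isCompact.isClosed subset_union_left ht))
    exact (hasDerivAt_const p (cycleInt L k w p)).congr_of_eventuallyEq this
  exact (h.isOpen i).is_const_of_deriv_eq_zero (h.isPreconnected i)
    (fun p hp => (hd p hp).differentiableAt.differentiableWithinAt)
    (fun p hp => (hd p hp).deriv) hz hz'

/-- If the sum of Cauchy integrals of a cycle does not jump at an interior point of an edge, then
the edge has weight zero. -/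
theorem weight_eq_zero (h : PlanarPartition S X D) (hk : ∀ e, IsEdge S (L e) (k e)) {w : ι → ℂ}
    {e : ι} {t : ℝ} (ht : t ∈ Ioo 0 (L e))
    (hinj : ∀ s ∈ Icc 0 (L e), k e s = k e t → s = t)
    (hoff : ∀ e' ≠ e, k e t ∉ k e' '' Icc 0 (L e'))
    (hW : ∀ i j, k e t ∈ closure (D i) → k e t ∈ closure (D j) →
      ∀ z ∈ D i, ∀ z' ∈ D j, cycleInt L k w z = cycleInt L k w z') : w e = 0 := by
  have hp : k e t ∈ S := (hk e).curve.mapsTo ht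
  have hd : derivWithin (k e) (Icc 0 (L e)) t = deriv (k e) t :=
    derivWithin_of_mem_nhds (Icc_mem_nhds ht.1 ht.2)
  have hv : deriv (k e) t ≠ 0 := by
    rw [← norm_ne_zero_iff, (hk e).curve.norm_deriv t ht]; exact one_ne_zero
  have hjump := tendsto_sum_cauchyInt_jump (fun e => (hk e).isC1Curve) w ht (by rwa [hd])
    hinj hoff
  rw [hd] at hjump
  obtain ⟨U, hU, i, j, hUD, hcl⟩ := h.exists_sides hp
  obtain ⟨hpi, hpj⟩ := hcl _ ⟨Or.inl hp, mem_of_mem_nhds hU⟩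
  have hnot := (hk e).curve.eventually_normal_notMem h.hasArcAt ht (N := S ∪ X)
    (h.compl_mem_nhds hp) fun z hz => hz.1.resolve_right hz.2
  have hmem : ∀ᶠ s : ℝ in 𝓝[≠] 0, k e t + s * (Complex.I * deriv (k e) t) ∈ D i ∪ D j := by
    have : ContinuousAt (fun s : ℝ => k e t + s * (Complex.I * deriv (k e) t)) 0 := by fun_prop
    have hU' := this.eventually_mem (s := U) (by simpa using hU)
    filter_upwards [hnot, hU'.filter_mono nhdsWithin_le_nhds] with s h1 h2 using hUD ⟨h2, h1⟩
  have hr : Tendsto (fun s : ℝ => s) (𝓝[>] 0) (𝓝[≠] 0) :=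
    tendsto_id.mono_right (nhdsWithin_mono _ fun s hs => ne_of_gt hs)
  have hl : Tendsto (fun s : ℝ => -s) (𝓝[>] 0) (𝓝[≠] 0) := by
    refine tendsto_nhdsWithin_iff.2 ⟨?_, ?_⟩
    · have : Tendsto (fun s : ℝ => -s) (𝓝 0) (𝓝 (-0)) := tendsto_id.neg
      rw [neg_zero] at this
      exact this.mono_left nhdsWithin_le_nhds
    · filter_upwards [self_mem_nhdsWithin] with s hs
      exact neg_ne_zero.2 (ne_of_gt hs)
  -- Both normal displacements lie in domains adjacent to the point, where the integrals agree by
  -- `hW`; so the jump is 0.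
  have hzero : ∀ᶠ ε : ℝ in 𝓝[>] 0,
      cycleInt L k w (k e t + ε * (Complex.I * deriv (k e) t)) -
        cycleInt L k w (k e t - ε * (Complex.I * deriv (k e) t)) = 0 := by
    filter_upwards [hr.eventually hmem, hl.eventually hmem] with ε h1 h2
    rw [Complex.ofReal_neg, neg_mul, ← sub_eq_add_neg] at h2
    rw [sub_eq_zero]
    rcases h1 with h1 | h1 <;> rcases h2 with h2 | h2
    exacts [hW i i hpi hpi _ h1 _ h2, hW i j hpi hpj _ h1 _ h2, hW j i hpj hpi _ h1 _ h2,
      hW j j hpj hpj _ h1 _ h2]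
  have := tendsto_nhds_unique (hjump.congr' hzero) tendsto_const_nhds
  simpa using this

end Cycle

/-- There are no loops. -/
theorem no_loop (h : PlanarPartition S X D) {L : ℝ} {k : ℝ → ℂ} (hk : IsEdge S L k)
    (hinj : InjOn k (Ioo 0 L)) (h0L : k 0 = k L) (h0 : k 0 ∉ k '' Ioo 0 L) : False := by
  have hL := hk.pos
  have hinj' : ∀ t ∈ Ioo 0 L, ∀ s ∈ Icc 0 L, k s = k t → s = t := by
    intro t ht s hs hst
    rcases eq_or_lt_of_le hs.1 with rfl | h1
    · exact (h0 ⟨t, ht, hst.symm⟩).elim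
    rcases eq_or_lt_of_le hs.2 with rfl | h2
    · exact (h0 ⟨t, ht, hst.symm.trans h0L.symm⟩).elim
    exact hinj ⟨h1, h2⟩ ht hst
  have ht₀ : L / 2 ∈ Ioo 0 L := ⟨by linarith, by linarith⟩
  -- `D c` is not adjacent to the loop at its midpoint, hence at none of its interior parameters, by
  -- local constancy along the curve.
  obtain ⟨c, hc⟩ := h.exists_notMem_closure (hk.curve.mapsTo ht₀)
  have hcI : ∀ t ∈ Ioo 0 L, k t ∉ closure (D c) := by
    have hev : ∀ t ∈ Ioo 0 L, ∀ᶠ s in 𝓝 t, (k s ∈ closure (D c) ↔ k t ∈ closure (D c)) := by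
      intro t ht
      filter_upwards [(hk.curve.continuousAt ht).eventually
        (h.eventually_mem_closure_iff (hk.curve.mapsTo ht) c), Ioo_mem_nhds ht.1 ht.2] with s h1 h2
      exact h1 (hk.curve.mapsTo h2)
    have := isPreconnected_Ioo.subset_of_closure_inter_subset (s := Ioo 0 L)
      (u := {t | t ∈ Ioo 0 L ∧ k t ∉ closure (D c)}) ?_ ⟨_, ht₀, ht₀, hc⟩ ?_
    · exact fun t ht => (this ht).2
    · rw [isOpen_iff_mem_nhds]
      rintro t ⟨ht, htc⟩
      filter_upwards [hev t ht, Ioo_mem_nhds ht.1 ht.2] with s h1 h2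
      exact ⟨h2, fun h3 => htc (h1.1 h3)⟩
    · rintro t ⟨htu, ht⟩
      refine ⟨ht, fun htc => ?_⟩
      obtain ⟨s, hs1, hs2⟩ := (mem_closure_iff_frequently.1 htu).and_eventually (hev t ht) |>.exists
      exact hs1.2 (hs2.2 htc)
  have hcE : ∀ q ∈ S, q ∈ closure (D c) → q ∉ k '' Icc 0 L := by
    -- The base point of the loop may be a regular point, as it is when the loop starts at an
    -- artificial vertex.
    have h00 : k 0 ∈ S → k 0 ∉ closure (D c) := by
      intro hS hcl
      have hlim : Tendsto k (𝓝[>] 0) (𝓝 (k 0)) := by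
        have h2 := (hk.contDiffOn.continuousOn 0 ⟨le_rfl, hL.le⟩).tendsto
        refine h2.mono_left ?_
        rw [← nhdsWithin_Ioo_eq_nhdsGT hL]
        exact nhdsWithin_mono _ Ioo_subset_Icc_self
      obtain ⟨t, h1, h2⟩ := ((hlim.eventually (h.eventually_mem_closure_iff hS c)).and
        (Ioo_mem_nhdsGT hL)).exists
      exact hcI t h2 ((h1 (hk.curve.mapsTo h2)).2 hcl)
    rintro _ hqS hqc ⟨t, ht, rfl⟩
    rcases eq_or_lt_of_le ht.1 with rfl | h1
    · exact h00 hqS hqc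
    rcases eq_or_lt_of_le ht.2 with rfl | h2
    · rw [← h0L] at hqS hqc
      exact h00 hqS hqc
    exact hcI t ⟨h1, h2⟩ hqc
  have hk' : ∀ _ : Unit, IsEdge S L k := fun _ => hk
  have hw : ∀ f : ℂ → ℂ, ∑ _ : Unit, (1 : ℂ) * (f (k L) - f (k 0)) = 0 := fun f => by
    simp [h0L]
  -- `D i` and `D c` meet at a point off the loop, where the integral is locally constant, so it has
  -- the same value on both.
  have hadj : ∀ i, i ≠ c → ∀ z ∈ D i, ∀ z' ∈ D c,
      cycleInt (fun _ : Unit => L) (fun _ => k) (fun _ => 1) z =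
      cycleInt (fun _ : Unit => L) (fun _ => k) (fun _ => 1) z' := by
    intro i hic z hz z' hz'
    obtain ⟨p, hpS, hpi, hpc⟩ := h.adj i c hic
    have hev := cycleInt_eventually_eq (S := S) hk' hw (p := p) fun _ => hcE p hpS hpc
    obtain ⟨y, hy1, hy2⟩ := ((mem_closure_iff_frequently.1 hpi).and_eventually hev).exists
    obtain ⟨y', hy1', hy2'⟩ := ((mem_closure_iff_frequently.1 hpc).and_eventually hev).exists
    rw [h.cycleInt_eq hk' hw hz hy1, hy2, h.cycleInt_eq hk' hw hz' hy1', hy2']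
  have := h.weight_eq_zero hk' (w := fun _ => 1) (e := ()) ht₀ (hinj' _ ht₀)
    (fun e' he' => (he' rfl).elim) (by
      intro i j hi hj z hz z' hz'
      have hic : i ≠ c := fun h' => hc (h' ▸ hi)
      have hjc : j ≠ c := fun h' => hc (h' ▸ hj)
      obtain ⟨y, hy⟩ := h.nonempty c
      rw [hadj i hic z hz y hy, hadj j hjc z' hz' y hy])
  exact one_ne_zero this

end PlanarPartition

/-! ### Edges with a common interior point. -/

namespace IsEdge

variable {S : Set ℂ} {L L' : ℝ} {k k' : ℝ → ℂ}

theorem reverse (h : IsEdge S L k) : IsEdge S L (fun t => k (L - t)) := by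
  refine ⟨h.pos, ?_, ?_⟩
  · have := h.curve.comp_affine (Or.inr rfl) L (a' := 0) (b' := L) fun t ht =>
      ⟨by linarith [ht.2], by linarith [ht.1]⟩
    simpa [← sub_eq_add_neg] using this
  · exact h.contDiffOn.comp (by fun_prop) fun t ht => ⟨by linarith [ht.2], by linarith [ht.1]⟩

theorem mono_set (h : IsEdge S L k) {S' : Set ℂ} (hS : S ⊆ S') : IsEdge S' L k :=
  ⟨h.pos, h.curve.mono_set (h.curve.mapsTo.mono_right hS), h.contDiffOn⟩

theorem tendsto (h : IsEdge S L k) : Tendsto k (𝓝[>] 0) (𝓝 (k 0)) := by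
  refine (h.contDiffOn.continuousOn 0 ⟨le_rfl, h.pos.le⟩).tendsto.mono_left ?_
  rw [← nhdsWithin_Ioo_eq_nhdsGT h.pos]
  exact nhdsWithin_mono _ Ioo_subset_Icc_self

theorem eqOn_Icc (h : IsEdge S L k) (h' : IsEdge S L' k') {m : ℝ} (hm : 0 < m) (hmL : m ≤ L)
    (hmL' : m ≤ L') (he : EqOn k k' (Ioo 0 m)) : EqOn k k' (Icc 0 m) :=
  he.of_subset_closure (h.contDiffOn.continuousOn.mono (Icc_subset_Icc le_rfl hmL))
    (h'.contDiffOn.continuousOn.mono (Icc_subset_Icc le_rfl hmL')) Ioo_subset_Icc_self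
    (closure_Ioo hm.ne).ge

/-- If `k'` had run longer than `k` before the common point, it would pass through the start of `k`,
which is not in `S`. -/
theorem le_of_align (h : IsEdge S L k) (h0 : k 0 ∉ S) (hk' : UnitCurve S 0 L' k') {t u : ℝ}
    (ht : t ∈ Ioo 0 L) (hu : u ∈ Ioo 0 L')
    (hal : ∀ r, t + r ∈ Ioo 0 L → u + r ∈ Ioo 0 L' → k (t + r) = k' (u + r)) : u ≤ t := by
  by_contra! htu
  have hmem : u - t ∈ Ioo 0 L' := ⟨by linarith, by linarith [hu.2, ht.1]⟩
  have := eq_of_tendsto_of_eventually_eq (hk'.continuousAt hmem) h.tendsto 1 (by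
    filter_upwards [Ioo_mem_nhdsGT ht.1] with r hr
    have := hal (r - t) ⟨by linarith [hr.1], by linarith [hr.2, ht.2]⟩
      ⟨by linarith [hr.1], by linarith [hr.2, hu.2]⟩
    rw [show t + (r - t) = r by ring] at this
    rw [this]; congr 1; ring)
  exact h0 (this ▸ hk'.mapsTo hmem)

/-- `le_of_align` in both roles gives equal lengths before the common point; for the reversed edges
it gives equal lengths after it. -/
theorem eqOn_of_align (h : IsEdge S L k) (h0 : k 0 ∉ S) (hL : k L ∉ S) (h' : IsEdge S L' k')
    (h0' : k' 0 ∉ S) (hL' : k' L' ∉ S) {t u : ℝ} (ht : t ∈ Ioo 0 L) (hu : u ∈ Ioo 0 L')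
    (hal : ∀ r, t + r ∈ Ioo 0 L → u + r ∈ Ioo 0 L' → k (t + r) = k' (u + r)) :
    L = L' ∧ EqOn k k' (Icc 0 L) := by
  have e1 := h.le_of_align h0 h'.curve ht hu hal
  have e2 := h'.le_of_align h0' h.curve hu ht fun r h1 h2 => (hal r h2 h1).symm
  have e3 := h.reverse.le_of_align (t := L - t) (u := L' - u) (by simpa using hL)
    h'.reverse.curve ⟨by linarith [ht.2], by linarith [ht.1]⟩
    ⟨by linarith [hu.2], by linarith [hu.1]⟩ fun r h1 h2 => by
      have := hal (-r) ⟨by linarith [h1.2], by linarith [h1.1]⟩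
        ⟨by linarith [h2.2], by linarith [h2.1]⟩
      convert this using 2 <;> ring
  have e4 := h'.reverse.le_of_align (t := L' - u) (u := L - t) (by simpa using hL')
    h.reverse.curve ⟨by linarith [hu.2], by linarith [hu.1]⟩
    ⟨by linarith [ht.2], by linarith [ht.1]⟩ fun r h1 h2 => by
      have := hal (-r) ⟨by linarith [h2.2], by linarith [h2.1]⟩
        ⟨by linarith [h1.2], by linarith [h1.1]⟩
      convert this.symm using 2 <;> ring
  have htu : t = u := le_antisymm e2 e1
  subst htu
  have hLL : L = L' := by linarith
  subst hLL
  refine ⟨rfl, h.eqOn_Icc h' h.pos le_rfl le_rfl fun s hs => ?_⟩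
  have := hal (s - t) (by simpa using hs) (by simpa using hs)
  simpa using this

/-- Two edges with a common interior point coincide up to direction. -/
theorem eqOn_or_eqOn_reverse (hS : ∀ p ∈ S, HasArcAt S p) (h : IsEdge S L k) (h0 : k 0 ∉ S)
    (hL : k L ∉ S) (h' : IsEdge S L' k') (h0' : k' 0 ∉ S) (hL' : k' L' ∉ S) {t u : ℝ}
    (ht : t ∈ Ioo 0 L) (hu : u ∈ Ioo 0 L') (htu : k t = k' u) :
    L = L' ∧ (EqOn k k' (Icc 0 L) ∨ EqOn k (fun s => k' (L - s)) (Icc 0 L)) := by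
  obtain ⟨σ, rfl | rfl, hal⟩ := h.curve.exists_align hS h'.curve ht hu htu
  · simp only [one_mul] at hal
    obtain ⟨e1, e2⟩ := h.eqOn_of_align h0 hL h' h0' hL' ht hu hal
    exact ⟨e1, Or.inl e2⟩
  · obtain ⟨e1, e2⟩ := h.eqOn_of_align h0 hL h'.reverse (by simpa using hL') (by simpa using h0')
      ht (u := L' - u) ⟨by linarith [hu.2], by linarith [hu.1]⟩ fun r h1 h2 => by
        have := hal r h1 ⟨by linarith [h2.2], by linarith [h2.1]⟩
        rw [this]; congr 1; ring
    subst e1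
    exact ⟨rfl, Or.inr e2⟩

end IsEdge

/-! ### Covering by edges and counting of edges and vertices. -/

/-- An edge that starts along the branch `j` of the star at `x` and ends at `y`. -/
structure IsBranchEdge {S X : Set ℂ} (st : ∀ x : X, Star S x) (x y : X) (j : Fin (st x).ν)
    (L : ℝ) (k : ℝ → ℂ) : Prop where
  isEdge : IsEdge S L k
  start : k 0 = x
  finish : k L = y
  germ : ∀ᶠ t in 𝓝[>] 0, k t = (st x).g j t

namespace PlanarPartition

variable {S X : Set ℂ} {D : Fin 3 → Set ℂ}

theorem injOn_of_start (h : PlanarPartition S X D) {L : ℝ} {k : ℝ → ℂ} (hk : IsEdge S L k)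
    (h0 : k 0 ∉ S) : InjOn k (Ioo 0 L) :=
  hk.curve.injOn h.hasArcAt h0 hk.tendsto

theorem ne_of_isEdge (h : PlanarPartition S X D) {L : ℝ} {k : ℝ → ℂ} (hk : IsEdge S L k)
    (h0 : k 0 ∉ S) : k 0 ≠ k L := fun h0L =>
  h.no_loop hk (h.injOn_of_start hk h0) h0L fun ⟨_, ht, h'⟩ => h0 (h' ▸ hk.curve.mapsTo ht)

theorem injOn_Icc (h : PlanarPartition S X D) {L : ℝ} {k : ℝ → ℂ} (hk : IsEdge S L k)
    (h0 : k 0 ∉ S) (hL : k L ∉ S) : InjOn k (Icc 0 L) := by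
  have hne := h.ne_of_isEdge hk h0
  have hinj := h.injOn_of_start hk h0
  intro s hs t ht hst
  rcases eq_endpoints_or_mem_Ioo_of_mem_Icc hs with rfl | rfl | hs' <;>
    rcases eq_endpoints_or_mem_Ioo_of_mem_Icc ht with rfl | rfl | ht'
  · rfl
  · exact (hne hst).elim
  · exact (h0 (hst ▸ hk.curve.mapsTo ht')).elim
  · exact (hne hst.symm).elim
  · rfl
  · exact (hL (hst ▸ hk.curve.mapsTo ht')).elim
  · exact (h0 (hst ▸ hk.curve.mapsTo hs')).elim
  · exact (hL (hst ▸ hk.curve.mapsTo hs')).elim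
  · exact hinj hs' ht' hst

/-- The edges that start from the stars cover the regular points. -/
theorem exists_mem_edge (h : PlanarPartition S X D) (st : ∀ x : X, Star S x)
    {L : (Σ x : X, Fin (st x).ν) → ℝ} {k : (Σ x : X, Fin (st x).ν) → ℝ → ℂ}
    {y : (Σ x : X, Fin (st x).ν) → X} (hk : ∀ b, IsBranchEdge st b.1 (y b) b.2 (L b) (k b))
    {p : ℂ} (hp : p ∈ S) : ∃ b, p ∈ k b '' Ioo 0 (L b) := by
  have hXS : ∀ x : X, (x : ℂ) ∉ S := fun x => disjoint_right.1 h.disjoint_set x.2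
  have hpX : p ∉ X := disjoint_left.1 h.disjoint_set hp
  -- The point `p` is made an artificial vertex with two branches. The edge from `p` cannot return
  -- to `p`, so it ends at a true vertex, along a branch there.
  set S' := S ∩ {p}ᶜ
  set X' := insert p X
  have hN : S' ∪ X' = S ∪ X := by
    ext z
    by_cases hz : z = p
    · simp [S', X', hz, hp]
    · simp [S', X', hz]
  have hSX' : Disjoint S' X' := by
    rw [Set.disjoint_left]
    rintro z ⟨hz, hzp⟩ (rfl | hzX)
    · exact hzp rfl
    · exact disjoint_left.1 h.disjoint_set hz hzX
  have harc : ∀ q ∈ S', HasArcAt S' q := fun q hq =>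
    (h.hasArcAt q hq.1).inter (isOpen_compl_singleton.mem_nhds hq.2)
  have hst : ∀ x : X', ∃ s : Star S' x, ((x : ℂ) = p → 0 < s.ν) ∧
      ∀ hx : (x : ℂ) ∈ X, ∀ j, ∃ j', s.g j = (st ⟨x, hx⟩).g j' := by
    rintro ⟨x, hx⟩
    rcases hx with rfl | hx
    · obtain ⟨s, hs⟩ := (h.hasArcAt x hp).exists_star
      exact ⟨s, fun _ => hs, fun hx => (hpX hx).elim⟩
    · have hxp : x ≠ p := fun h' => hpX (h' ▸ hx)
      obtain ⟨s, hs⟩ := (st ⟨x, hx⟩).exists_inter (isOpen_compl_singleton.mem_nhds hxp)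
      exact ⟨s, fun h' => (hxp h').elim, fun _ => hs⟩
  choose st' hst'0 hst'g using hst
  obtain ⟨Λ, c, hc, hc0, -, y', j', hcΛ, hend⟩ := exists_edge (by rw [hN]; exact h.isCompact) hSX' harc
    st' ⟨p, mem_insert _ _⟩ ⟨0, hst'0 _ rfl⟩
  have hcS : IsEdge S Λ c := hc.mono_set inter_subset_left
  have hpS' : c 0 ∉ S' := by rw [hc0]; exact fun h' => h'.2 rfl
  have hyp : (y' : ℂ) ≠ p := fun hyp => h.no_loop hcS
    (hc.curve.injOn harc hpS' hc.tendsto) (by rw [hc0, hcΛ, hyp])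
    fun ⟨t, ht, h'⟩ => hpS' (h' ▸ hc.curve.mapsTo ht)
  have hyX : (y' : ℂ) ∈ X := y'.2.resolve_left hyp
  obtain ⟨j, hj⟩ := hst'g y' hyX j'
  set b : Σ x : X, Fin (st x).ν := ⟨⟨y', hyX⟩, j⟩
  have hb := hk b
  have hbL := hb.isEdge.pos
  set m := min Λ (L b)
  have hm : 0 < m := lt_min hc.pos hbL
  have hmΛ : m ≤ Λ := min_le_left _ _
  have hmL : m ≤ L b := min_le_right _ _
  have hcr := hcS.reverse
  have heq : EqOn (fun t => c (Λ - t)) (k b) (Icc 0 m) := by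
    refine hcr.eqOn_Icc hb.isEdge hm hmΛ hmL ?_
    exact IsTrace.eqOn h.hasArcAt (g := (st ⟨y', hyX⟩).g j)
      ⟨hcr.curve.mono le_rfl hmΛ, by rw [← hj]; exact hend⟩
      ⟨hb.isEdge.curve.mono le_rfl hmL, hb.germ⟩
  have hem := heq ⟨hm.le, le_rfl⟩
  -- The edge `k b` agrees with the reversal of `c`, so it reaches `p` at parameter `Λ`, unless it
  -- ends before or there; but its end is not in `S`.
  rcases le_or_gt Λ (L b) with hle | hlt
  · have hmeq : m = Λ := min_eq_left hle
    simp only [hmeq, sub_self, hc0] at hem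
    refine ⟨b, Λ, ⟨hc.pos, lt_of_le_of_ne hle fun h' => ?_⟩, hem.symm⟩
    rw [h', hb.finish] at hem
    exact hXS _ (hem ▸ hp)
  · have hmeq : m = L b := min_eq_right hlt.le
    simp only [hmeq, hb.finish] at hem
    exact (hXS (y b) (hem ▸ hcr.curve.mapsTo ⟨hbL, hlt⟩)).elim

/-- The number of edges is at most one more than the number of vertices. -/
theorem card_edges_le (h : PlanarPartition S X D) [Fintype X] {ι : Type*} [Fintype ι]
    {L : ι → ℝ} {k : ι → ℝ → ℂ} {x y : ι → X} (hk : ∀ e, IsEdge S (L e) (k e))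
    (h0 : ∀ e, k e 0 = x e) (hL : ∀ e, k e (L e) = y e)
    (hdisj : ∀ e e', e ≠ e' → Disjoint (k e '' Ioo 0 (L e)) (k e' '' Ioo 0 (L e')))
    (x₀ : X) : Fintype.card ι ≤ Fintype.card X + 1 := by
  classical
  have hXS : ∀ x : X, (x : ℂ) ∉ S := fun x => disjoint_right.1 h.disjoint_set x.2
  choose z hz using h.nonempty
  set bd : (ι → ℂ) →ₗ[ℂ] (X → ℂ) :=
    { toFun := fun w v => ∑ e, w e * ((if y e = v then 1 else 0) - (if x e = v then 1 else 0))
      map_add' := fun w w' => by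
        ext v; simp only [Pi.add_apply, add_mul, Finset.sum_add_distrib]
      map_smul' := fun a w => by
        ext v; simp only [Pi.smul_apply, smul_eq_mul, Finset.mul_sum, mul_assoc, RingHom.id_apply] }
  set cy : (ι → ℂ) →ₗ[ℂ] (Fin 3 → ℂ) :=
    { toFun := fun w i => PlanarPartition.cycleInt L k w (z i)
      map_add' := fun w w' => by
        ext v; simp only [cycleInt, Pi.add_apply, add_mul, Finset.sum_add_distrib]
      map_smul' := fun a w => by
        ext v
        simp only [cycleInt, Pi.smul_apply, smul_eq_mul, Finset.mul_sum, mul_assoc,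
          RingHom.id_apply] }
  -- Boundary coefficients except at `x₀`, and values of the integral on the other two domains
  -- relative to `D 0`. The target has dimension (|X| - 1) + 2.
  set T : (ι → ℂ) →ₗ[ℂ] ({v : X // v ≠ x₀} → ℂ) × (Fin 2 → ℂ) :=
    ((LinearMap.funLeft ℂ ℂ (Subtype.val : {v : X // v ≠ x₀} → X)).comp bd).prod
      ((LinearMap.funLeft ℂ ℂ Fin.succ - LinearMap.funLeft ℂ ℂ fun _ : Fin 2 => (0 : Fin 3)).comp cy)
  have hinj : Function.Injective T := by
    rw [← LinearMap.ker_eq_bot, LinearMap.ker_eq_bot']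
    intro w hw
    have hw1 : ∀ v, v ≠ x₀ → bd w v = 0 := fun v hv =>
      congrFun (congrArg Prod.fst hw) ⟨v, hv⟩
    have hw2 : ∀ b : Fin 2, cy w b.succ - cy w 0 = 0 := fun b => congrFun (congrArg Prod.snd hw) b
    have hsum : ∀ f : X → ℂ, ∑ v, bd w v * f v = ∑ e, w e * (f (y e) - f (x e)) := by
      intro f
      simp only [bd, LinearMap.coe_mk, AddHom.coe_mk, Finset.sum_mul]
      rw [Finset.sum_comm]
      refine Finset.sum_congr rfl fun e _ => ?_
      simp only [mul_assoc, ← Finset.mul_sum, sub_mul, Finset.sum_sub_distrib, ite_mul, one_mul,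
        zero_mul, Finset.sum_ite_eq, Finset.mem_univ, if_true]
    -- The coefficients of a boundary sum to zero, so the omitted one vanishes as well.
    have hbd : ∀ v, bd w v = 0 := by
      have h1 := hsum fun _ => 1
      simp only [mul_one, sub_self, mul_zero, Finset.sum_const_zero] at h1
      rw [Finset.sum_eq_single x₀ (fun v _ hv => hw1 v hv) (by simp)] at h1
      intro v
      by_cases hv : v = x₀
      · rw [hv, h1]
      · exact hw1 v hv
    have hcyc : ∀ f : ℂ → ℂ, ∑ e, w e * (f (k e (L e)) - f (k e 0)) = 0 := by
      intro f
      have := hsum fun v => f v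
      simp only [hbd, zero_mul, Finset.sum_const_zero] at this
      simp only [h0, hL]
      exact this.symm
    have hcy : ∀ i, cy w i = cy w 0 := by
      intro i
      refine Fin.cases rfl (fun b => ?_) i
      exact sub_eq_zero.1 (hw2 b)
    ext e
    have hLe := (hk e).pos
    have ht : L e / 2 ∈ Ioo 0 (L e) := ⟨by linarith, by linarith⟩
    refine h.weight_eq_zero hk ht (fun s hs hse => ?_) (fun e' he' => ?_) ?_
    · exact h.injOn_Icc (hk e) (h0 e ▸ hXS _) (hL e ▸ hXS _) hs (Ioo_subset_Icc_self ht) hse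
    · rintro ⟨s, hs, hse⟩
      have hmem := (hk e).curve.mapsTo ht
      rcases eq_endpoints_or_mem_Ioo_of_mem_Icc hs with rfl | rfl | hs'
      · rw [h0] at hse
        exact hXS (x e') (hse ▸ hmem)
      · rw [hL] at hse
        exact hXS (y e') (hse ▸ hmem)
      · exact disjoint_left.1 (hdisj e' e he') ⟨s, hs', hse⟩ ⟨_, ht, rfl⟩
    · intro i j _ _ a ha a' ha'
      rw [h.cycleInt_eq hk hcyc ha (hz i), h.cycleInt_eq hk hcyc ha' (hz j)]
      exact (hcy i).trans (hcy j).symm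
  have hrank := LinearMap.finrank_le_finrank_of_injective hinj
  simp only [Module.finrank_prod, Module.finrank_fintype_fun_eq_card, Fintype.card_fin,
    Fintype.card_subtype_compl, Fintype.card_subtype_eq] at hrank
  have : 0 < Fintype.card X := Fintype.card_pos_iff.2 ⟨x₀⟩
  omega

end PlanarPartition

namespace PlanarPartition

variable {S X : Set ℂ} {D : Fin 3 → Set ℂ}

/-- Edges that overlap coincide up to direction. With the same direction they have the same germ at
their start, and distinct branches of a star are disjoint. -/
theorem eq_or_eq_reverse (h : PlanarPartition S X D) (st : ∀ x : X, Star S x)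
    {x y x' y' : X} {j : Fin (st x).ν} {j' : Fin (st x').ν} {L L' : ℝ} {k k' : ℝ → ℂ}
    (hk : IsBranchEdge st x y j L k) (hk' : IsBranchEdge st x' y' j' L' k')
    (hmeet : ¬ Disjoint (k '' Ioo 0 L) (k' '' Ioo 0 L')) :
    (⟨x, j⟩ : Σ x : X, Fin (st x).ν) = ⟨x', j'⟩ ∨ x = y' ∧ y = x' := by
  have hXS : ∀ x : X, (x : ℂ) ∉ S := fun x => disjoint_right.1 h.disjoint_set x.2
  obtain ⟨_, ⟨t, ht, rfl⟩, u, hu, hut⟩ := not_disjoint_iff.1 hmeet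
  obtain ⟨rfl, he | he⟩ := hk.isEdge.eqOn_or_eqOn_reverse h.hasArcAt (hk.start ▸ hXS x)
    (hk.finish ▸ hXS y) hk'.isEdge (hk'.start ▸ hXS x') (hk'.finish ▸ hXS y') ht hu hut.symm
  · left
    have h0 := he ⟨le_rfl, hk.isEdge.pos.le⟩
    rw [hk.start, hk'.start] at h0
    obtain rfl : x = x' := Subtype.ext h0
    congr 1
    by_contra hjj
    obtain ⟨t, ⟨⟨h1, h2⟩, h3⟩, h4⟩ := (((hk.germ.and hk'.germ).and
      (Ioo_mem_nhdsGT hk.isEdge.pos)).and (Ioo_mem_nhdsGT (st x).pos)).exists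
    refine disjoint_left.1 ((st x).disjoint j j' hjj) ⟨t, h4, rfl⟩ ⟨t, h4, ?_⟩
    rw [← h1, ← h2, he (Ioo_subset_Icc_self h3)]
  · right
    have h0 := he ⟨le_rfl, hk.isEdge.pos.le⟩
    have h1 := he ⟨hk.isEdge.pos.le, le_rfl⟩
    simp only [sub_zero, sub_self, hk.start, hk.finish, hk'.start, hk'.finish] at h0 h1
    exact ⟨Subtype.ext h0, Subtype.ext h1⟩

/-- Three pairwise adjacent domains in the plane are bounded by a theta graph. -/
theorem exists_theta (h : PlanarPartition S X D) (st : ∀ x : X, Star S x)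
    (hν : ∀ x, 3 ≤ (st x).ν) :
    ∃ x₁ x₂ : X, x₁ ≠ x₂ ∧ (∀ x, x = x₁ ∨ x = x₂) ∧ (st x₁).ν = 3 ∧ (st x₂).ν = 3 ∧
      ∃ (L : Fin 3 → ℝ) (k : Fin 3 → ℝ → ℂ),
        (∀ j, IsEdge S (L j) (k j) ∧ InjOn (k j) (Icc 0 (L j)) ∧ k j 0 = x₁ ∧ k j (L j) = x₂) ∧
        (∀ i j, i ≠ j → Disjoint (k i '' Ioo 0 (L i)) (k j '' Ioo 0 (L j))) ∧
        S ⊆ ⋃ j, k j '' Ioo 0 (L j) := by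
  classical
  have hXS : ∀ x : X, (x : ℂ) ∉ S := fun x => disjoint_right.1 h.disjoint_set x.2
  have : Fintype X := h.finite.fintype
  have hex : ∀ b : Σ x : X, Fin (st x).ν, ∃ (L : ℝ) (k : ℝ → ℂ) (y : X),
      IsBranchEdge st b.1 y b.2 L k := by
    rintro ⟨x, j⟩
    obtain ⟨L, k, hk, h1, h2, y, -, h3, -⟩ :=
      exists_edge h.isCompact h.disjoint_set h.hasArcAt st x j
    exact ⟨L, k, y, hk, h1, h3, h2⟩
  choose L k y hk using hex
  have hxy : ∀ b, b.1 ≠ y b := fun b hb => by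
    refine h.ne_of_isEdge (hk b).isEdge ((hk b).start ▸ hXS _) ?_
    rw [(hk b).start, (hk b).finish, hb]
  -- Pairs (vertex, branch) are half-edges. The range of `I` is the set of undirected edges, with a
  -- chosen direction given by `r` below.
  set I : (Σ x : X, Fin (st x).ν) → Set ℂ := fun b => k b '' Ioo 0 (L b)
  have hIne : ∀ b, (I b).Nonempty := fun b => (nonempty_Ioo.2 (hk b).isEdge.pos).image _
  have hmeet : ∀ b b', ¬ Disjoint (I b) (I b') → b = b' ∨ b.1 = y b' ∧ y b = b'.1 := fun b b' hd =>
    h.eq_or_eq_reverse st (hk b) (hk b') hd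
  have hIeq : ∀ b b', I b = I b' → b = b' ∨ b.1 = y b' ∧ y b = b'.1 := fun b b' hb =>
    hmeet b b' (by rw [hb, disjoint_self]; exact (hIne b').ne_empty)
  have : Fintype (range I) := Fintype.ofFinite _
  choose r hr using fun e : range I => e.2
  have hdisj : ∀ e e', e ≠ e' → Disjoint (I (r e)) (I (r e')) := by
    intro e e' hne
    by_contra hd
    refine hne (Subtype.ext ?_)
    rw [← hr e, ← hr e']
    rcases hmeet _ _ hd with h1 | ⟨h1, h2⟩
    · rw [h1]
    · obtain ⟨_, ⟨t, ht, rfl⟩, u, hu, hut⟩ := not_disjoint_iff.1 hd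
      obtain ⟨hL, he | he⟩ := (hk (r e)).isEdge.eqOn_or_eqOn_reverse h.hasArcAt
        ((hk (r e)).start ▸ hXS _) ((hk (r e)).finish ▸ hXS _) (hk (r e')).isEdge
        ((hk (r e')).start ▸ hXS _) ((hk (r e')).finish ▸ hXS _) ht hu hut.symm
      · exact (hxy _ (h1.trans (Subtype.ext (by
          have := he ⟨(hk (r e)).isEdge.pos.le, le_rfl⟩
          rw [(hk (r e)).finish] at this
          rw [this, hL, (hk (r e')).finish])).symm)).elim
      · simp only [I]
        rw [← hL]
        refine Subset.antisymm ?_ ?_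
        · rintro _ ⟨s, hs, rfl⟩
          exact ⟨L (r e) - s, ⟨by linarith [hs.2], by linarith [hs.1]⟩,
            (he (Ioo_subset_Icc_self hs)).symm⟩
        · rintro _ ⟨s, hs, rfl⟩
          refine ⟨L (r e) - s, ⟨by linarith [hs.2], by linarith [hs.1]⟩, ?_⟩
          rw [he ⟨by linarith [hs.2], by linarith [hs.1]⟩]
          simp
  -- An edge comes from at most two half-edges. They are told apart by whether they start at the
  -- start of the chosen one, since without loops the two ends differ.
  have hcardH : Fintype.card (Σ x : X, Fin (st x).ν) ≤ Fintype.card (range I) * 2 := by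
    have hinj : Function.Injective fun b : Σ x : X, Fin (st x).ν =>
        ((⟨I b, mem_range_self b⟩ : range I), decide (b.1 = (r ⟨I b, mem_range_self b⟩).1)) := by
      intro b b' hbb
      simp only [Prod.mk.injEq, Subtype.mk.injEq, decide_eq_decide] at hbb
      obtain ⟨hI, hd⟩ := hbb
      have hrr : r ⟨I b, mem_range_self b⟩ = r ⟨I b', mem_range_self b'⟩ := by
        congr 1; exact Subtype.ext hI
      rw [hrr] at hd
      refine (hIeq b b' hI).resolve_right fun ⟨h1, h2⟩ => ?_
      have hne : b.1 ≠ b'.1 := fun h3 => hxy b (h3.trans h2.symm)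
      set a := r ⟨I b', mem_range_self b'⟩
      have haI : I a = I b' := hr ⟨I b', mem_range_self b'⟩
      rcases hIeq b' a haI.symm with h3 | ⟨h3, h4⟩
      · have h5 : b'.1 = a.1 := by rw [← h3]
        exact hne ((hd.2 h5).trans h5.symm)
      · have h5 : b.1 = a.1 := h1.trans h4
        exact hne (h5.trans (hd.1 h5).symm)
    simpa [Fintype.card_prod] using Fintype.card_le_of_injective _ hinj
  have hcardH' : Fintype.card X * 3 ≤ Fintype.card (Σ x : X, Fin (st x).ν) := by
    rw [Fintype.card_sigma]
    simp only [Fintype.card_fin]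
    have := Finset.card_nsmul_le_sum Finset.univ (fun x => (st x).ν) 3 fun x _ => hν x
    simpa using this
  obtain ⟨p₀, hp₀, -⟩ := h.adj 0 1 (by decide)
  obtain ⟨b₀, -⟩ := h.exists_mem_edge st hk hp₀
  have hcardE : Fintype.card (range I) ≤ Fintype.card X + 1 :=
    h.card_edges_le (L := fun e => L (r e)) (k := fun e => k (r e)) (x := fun e => (r e).1)
      (y := fun e => y (r e)) (fun e => (hk (r e)).isEdge) (fun e => (hk (r e)).start)
      (fun e => (hk (r e)).finish) hdisj b₀.1
  have hX2 : 1 < Fintype.card X := Fintype.one_lt_card_iff.2 ⟨_, _, hxy b₀⟩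
  -- 3|X| ≤ 2(|X| + 1) and |X| > 1.
  have hXcard : Fintype.card X = 2 := by omega
  obtain ⟨x₁, x₂, hx12, huniv⟩ := Finset.card_eq_two.1 (Finset.card_univ.trans hXcard)
  have hall : ∀ x, x = x₁ ∨ x = x₂ := fun x => by
    have := Finset.mem_univ x
    rw [huniv] at this
    simpa using this
  have hsum : (st x₁).ν + (st x₂).ν ≤ 6 := by
    have h1 : Fintype.card (Σ x : X, Fin (st x).ν) = (st x₁).ν + (st x₂).ν := by
      rw [Fintype.card_sigma, huniv, Finset.sum_pair hx12, Fintype.card_fin, Fintype.card_fin]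
    omega
  have hν1 : (st x₁).ν = 3 := by have := hν x₁; have := hν x₂; omega
  have hν2 : (st x₂).ν = 3 := by have := hν x₁; have := hν x₂; omega
  -- The three half-edges at `x₁` all end at `x₂`, so none is the reversal of another; they give
  -- three distinct edges, which is all of them.
  set b : Fin 3 → Σ x : X, Fin (st x).ν := fun j => ⟨x₁, Fin.cast hν1.symm j⟩
  have hyb : ∀ j, y (b j) = x₂ := fun j => (hall _).resolve_left fun h' => hxy (b j) h'.symm
  have hbI : ∀ i j, i ≠ j → Disjoint (I (b i)) (I (b j)) := by
    intro i j hij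
    by_contra hd
    rcases hmeet _ _ hd with h1 | ⟨h1, -⟩
    · simp only [b, Sigma.mk.injEq, heq_eq_eq, true_and] at h1
      exact hij (Fin.cast_injective _ h1)
    · rw [hyb] at h1
      exact hx12 h1
  have hkb : ∀ j, IsEdge S (L (b j)) (k (b j)) ∧ InjOn (k (b j)) (Icc 0 (L (b j))) ∧
      k (b j) 0 = x₁ ∧ k (b j) (L (b j)) = x₂ := fun j =>
    ⟨(hk (b j)).isEdge, h.injOn_Icc (hk (b j)).isEdge ((hk (b j)).start ▸ hXS _)
      ((hk (b j)).finish ▸ hXS _), (hk (b j)).start, by rw [(hk (b j)).finish, hyb]⟩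
  refine ⟨x₁, x₂, hx12, hall, hν1, hν2, fun j => L (b j), fun j => k (b j), hkb, hbI, ?_⟩
  have hinj : Function.Injective fun j : Fin 3 => (⟨I (b j), mem_range_self _⟩ : range I) := by
    intro i j hij
    by_contra hne
    have := hbI i j hne
    rw [Subtype.mk.inj hij, disjoint_self] at this
    exact (hIne (b j)).ne_empty this
  have hcard : Fintype.card (Fin 3) = Fintype.card (range I) := by
    have h3 : Fintype.card (Fin 3) ≤ Fintype.card (range I) := Fintype.card_le_of_injective _ hinj
    rw [Fintype.card_fin] at h3 ⊢
    omega
  have hbij := (Fintype.bijective_iff_injective_and_card _).2 ⟨hinj, hcard⟩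
  intro p hp
  obtain ⟨b', hb'⟩ := h.exists_mem_edge st hk hp
  obtain ⟨j, hj⟩ := hbij.2 ⟨I b', mem_range_self _⟩
  have hj' : I (b j) = I b' := Subtype.mk.inj hj
  have hpj : p ∈ I (b j) := hj' ▸ (show p ∈ I b' from hb')
  exact mem_iUnion.2 ⟨j, hpj⟩

end PlanarPartition

/-! ### Topology of the sphere: charts, punctured domains, neighbouring domains. -/

/-- Stereographic projection from `q` to the complex plane. -/
theorem exists_stereographic (q : S2) : ∃ (σ : E3 → ℂ) (ρ : ℂ → S2), IsOpenEmbedding ρ ∧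
    range ρ = {q}ᶜ ∧ (∀ z, σ (ρ z) = z) ∧ ContDiff ℝ ∞ (fun z => (ρ z : E3)) ∧
    ∀ x : S2, x ≠ q → ContDiffAt ℝ ∞ σ x := by
  set v : E3 := q.1
  have hv : ‖v‖ = 1 := by simp [v]
  have hfin : Module.finrank ℝ (ℝ ∙ v)ᗮ = 2 := by
    have : Fact (Module.finrank ℝ E3 = 2 + 1) := ⟨by simp⟩
    exact Submodule.finrank_orthogonal_span_singleton (n := 2) (by
      rw [← norm_ne_zero_iff, hv]; exact one_ne_zero)
  have e : (ℝ ∙ v)ᗮ ≃L[ℝ] ℂ := ContinuousLinearEquiv.ofFinrankEq (by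
    rw [hfin, Complex.finrank_real_complex])
  refine ⟨fun x => e (stereoToFun v x), fun z => stereoInvFun hv (e.symm z), ?_, ?_, ?_, ?_, ?_⟩
  · exact (isOpenEmbedding_stereographic_symm hv).comp e.symm.toHomeomorph.isOpenEmbedding
  · have h1 := range_stereographic_symm hv q.2
    have h2 : range (fun z => stereoInvFun hv (e.symm z)) = range (stereographic hv).symm :=
      e.symm.surjective.range_comp (stereoInvFun hv)
    rw [h2, h1]
  · intro z
    change e (stereoToFun v (stereoInvFun hv (e.symm z))) = z
    rw [stereo_right_inv, e.apply_symm_apply]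
  · have h1 : ContDiff ℝ ∞ (fun z : ℂ => stereoInvFunAux v (e.symm z : E3)) :=
      contDiff_stereoInvFunAux.comp
        ((ℝ ∙ v)ᗮ.subtypeL.contDiff.comp e.symm.contDiff)
    exact h1
  · intro x hx
    have hopen : IsOpen {x : E3 | inner ℝ v x ≠ (1 : ℝ)} :=
      isOpen_ne_fun (by fun_prop) continuous_const
    have hmem : (x : E3) ∈ {x : E3 | inner ℝ v x ≠ (1 : ℝ)} := by
      intro h1
      apply hx
      rw [sphere_ext_iff]
      rw [real_inner_comm]
      exact h1
    exact e.contDiff.contDiffAt.comp _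
      ((contDiffOn_stereoToFun (v := v)).contDiffAt (hopen.mem_nhds hmem))

theorem exists_stereographic_ne (x : S2) : ∃ ρ : ℂ → S2, IsOpenEmbedding ρ ∧ x ∈ range ρ := by
  obtain ⟨-, ρ, h1, h2, -⟩ := exists_stereographic (-x)
  refine ⟨ρ, h1, ?_⟩
  rw [h2]
  exact ne_neg_of_mem_unit_sphere ℝ x

theorem diff_finite_nonempty {G F : Set S2} (hG : IsOpen G) (hne : G.Nonempty) (hF : F.Finite) :
    (G \ F).Nonempty := by
  obtain ⟨x, hx⟩ := hne
  obtain ⟨ρ, hρ, z, rfl⟩ := exists_stereographic_ne x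
  have hinf : (ρ ⁻¹' G).Infinite :=
    infinite_of_mem_nhds z ((hG.preimage hρ.continuous).mem_nhds hx)
  obtain ⟨y, hy, hyF⟩ := (hinf.sdiff (hF.preimage hρ.injective.injOn)).nonempty
  exact ⟨ρ y, hy, hyF⟩

theorem isPreconnected_ball_diff_singleton (z : ℂ) (r : ℝ) :
    IsPreconnected (Metric.ball z r \ {z}) := by
  have h : Metric.ball z r \ {z} =
      (fun x : ℝ × ℝ => z + x.1 * Complex.exp (x.2 * Complex.I)) '' (Ioo 0 r ×ˢ univ) := by
    ext y
    constructor
    · rintro ⟨hy, hyz⟩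
      refine ⟨(‖y - z‖, (y - z).arg), ⟨⟨norm_pos_iff.2 (sub_ne_zero.2 hyz), ?_⟩, mem_univ _⟩, ?_⟩
      · rwa [Metric.mem_ball, dist_eq_norm] at hy
      · simp only [Complex.norm_mul_exp_arg_mul_I]
        ring
    · rintro ⟨⟨s, θ⟩, ⟨hs, -⟩, rfl⟩
      have hs' : (0 : ℝ) < s := hs.1
      constructor
      · simp [Complex.norm_exp_ofReal_mul_I, abs_of_pos hs', hs.2]
      · simp [hs'.ne', Complex.exp_ne_zero]
  rw [h]
  exact (isPreconnected_Ioo.prod isPreconnected_univ).image _ (by fun_prop)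

/-- A small punctured disc around `x` is connected, so in a separation of `G \ {x}` it lies in one
piece; adding the disc to that piece would separate `G`. -/
theorem isPreconnected_diff_singleton {G : Set S2} (hG : IsOpen G) (hc : IsPreconnected G)
    (x : S2) : IsPreconnected (G \ {x}) := by
  by_cases hx : x ∈ G
  swap
  · rwa [sdiff_singleton_eq_self hx]
  obtain ⟨ρ, hρ, z, rfl⟩ := exists_stereographic_ne x
  obtain ⟨r, hr, hball⟩ := Metric.isOpen_iff.1 (hG.preimage hρ.continuous) z hx
  have hP : IsPreconnected (ρ '' (Metric.ball z r \ {z})) :=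
    (isPreconnected_ball_diff_singleton z r).image _ hρ.continuous.continuousOn
  have hPG : ρ '' (Metric.ball z r \ {z}) ⊆ G \ {ρ z} := by
    rintro _ ⟨y, ⟨hy, hyz⟩, rfl⟩
    exact ⟨hball hy, fun h => hyz (hρ.injective h)⟩
  have key : ∀ u v : Set S2, IsOpen u → IsOpen v → G \ {ρ z} ⊆ u ∪ v →
      ρ '' (Metric.ball z r \ {z}) ⊆ u → ((G \ {ρ z}) ∩ v).Nonempty →
      ((G \ {ρ z}) ∩ (u ∩ v)).Nonempty := by
    intro u v hu hv huv hPu hGv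
    have hB : IsOpen (ρ '' Metric.ball z r) := hρ.isOpenMap _ Metric.isOpen_ball
    have hzB : ρ z ∈ ρ '' Metric.ball z r := mem_image_of_mem _ (Metric.mem_ball_self hr)
    obtain ⟨y, hyG, hyu, hyv, hyz⟩ := hc (u ∪ ρ '' Metric.ball z r) (v ∩ {ρ z}ᶜ) (hu.union hB)
      (hv.inter isOpen_compl_singleton) (by
        intro y hy
        by_cases hyz : y = ρ z
        · exact Or.inl (Or.inr (hyz ▸ hzB))
        · rcases huv ⟨hy, hyz⟩ with h | h
          · exact Or.inl (Or.inl h)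
          · exact Or.inr ⟨h, hyz⟩) ⟨ρ z, hx, Or.inr hzB⟩ (by
        obtain ⟨y, hy, hyv⟩ := hGv
        exact ⟨y, hy.1, hyv, hy.2⟩)
    refine ⟨y, ⟨hyG, hyz⟩, ?_, hyv⟩
    rcases hyu with h | ⟨w, hw, rfl⟩
    · exact h
    · exact hPu ⟨w, ⟨hw, fun h => hyz (by rw [h]; rfl)⟩, rfl⟩
  intro u v hu hv huv hGu hGv
  by_contra hemp
  rw [not_nonempty_iff_eq_empty] at hemp
  rcases isPreconnected_iff_subset_of_disjoint.1 hP u v hu hv (hPG.trans huv)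
    (subset_empty_iff.1 (hemp ▸ inter_subset_inter_left _ hPG)) with h | h
  · exact (key u v hu hv huv h hGv).ne_empty hemp
  · exact (key v u hv hu (union_comm u v ▸ huv) h hGu).ne_empty (inter_comm u v ▸ hemp)

theorem isPreconnected_diff_finite {G F : Set S2} (hG : IsOpen G) (hc : IsPreconnected G)
    (hF : F.Finite) : IsPreconnected (G \ F) := by
  induction F, hF using Set.Finite.induction_on with
  | empty => simpa using hc
  | insert _ hF ih =>
    rw [← union_singleton, ← sdiff_sdiff]
    exact isPreconnected_diff_singleton (hG.sdiff hF.isClosed) ih _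

/-- Neighbours have common boundary points outside of any finite set. -/
theorem exists_mem_closure_inter {A B F : Set S2} (hA : IsOpen A) (hB : IsOpen B)
    (hAne : A.Nonempty) (hBne : B.Nonempty)
    (h : IsConnected (interior (closure (A ∪ B)))) (hF : F.Finite) :
    ∃ p, p ∉ F ∧ p ∈ closure A ∧ p ∈ closure B := by
  have hsub : A ∪ B ⊆ interior (closure (A ∪ B)) := interior_maximal subset_closure (hA.union hB)
  have hpre := isPreconnected_diff_finite isOpen_interior h.isPreconnected hF
  obtain ⟨a, ha, haF⟩ := diff_finite_nonempty hA hAne hF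
  obtain ⟨b, hb, hbF⟩ := diff_finite_nonempty hB hBne hF
  -- The two closures cover a set that stays connected after removal of `F`, so they meet in it.
  obtain ⟨p, hp, hpA, hpB⟩ := isPreconnected_closed_iff.1 hpre (closure A) (closure B)
    isClosed_closure isClosed_closure (by
      rw [← closure_union]
      exact sdiff_subset.trans interior_subset)
    ⟨a, ⟨hsub (Or.inl ha), haF⟩, subset_closure ha⟩ ⟨b, ⟨hsub (Or.inr hb), hbF⟩, subset_closure hb⟩
  exact ⟨p, hp.2, hpA, hpB⟩

/-- If `i` and `j` were not adjacent, giving them one colour and the third vertex the other would be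
a proper colouring. -/
theorem adj_of_not_isAdmissible {D : Fin 3 → Set S2} (h : ¬ IsAdmissible D) {i j : Fin 3}
    (hij : i ≠ j) : (neighborGraph D).Adj i j := by
  by_contra hadj
  refine h ⟨SimpleGraph.Coloring.mk (fun v => if v = i ∨ v = j then 0 else 1) ?_⟩
  intro u v huv
  have hne := huv.ne
  have h1 : ¬ (u = i ∧ v = j) := fun ⟨h1, h2⟩ => hadj (h1 ▸ h2 ▸ huv)
  have h2 : ¬ (u = j ∧ v = i) := fun ⟨h1, h2⟩ => hadj (h1 ▸ h2 ▸ huv.symm)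
  clear huv hadj h
  revert u v i j
  decide

/-! ### Passage of arcs between the sphere and the plane. -/

theorem IsSmoothArc.continuousOn {γ : ℝ → S2} {a b : ℝ} (h : IsSmoothArc γ a b) :
    ContinuousOn γ (Icc a b) :=
  IsInducing.subtypeVal.continuousOn_iff.2 h.contDiffOn.continuousOn

theorem IsSmoothArc.comp_mul {γ : ℝ → S2} {a b a' b' ε : ℝ} (h : IsSmoothArc γ a b) (hε : 0 < ε)
    (hab' : a' < b') (hm : MapsTo (fun t => ε * t) (Icc a' b') (Icc a b)) :
    IsSmoothArc (fun t => γ (ε * t)) a' b' := by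
  refine ⟨h.contDiffOn.comp (by fun_prop) hm, fun t ht => ?_, fun s hs t ht hst =>
    mul_left_cancel₀ hε.ne' (h.injOn (hm hs) (hm ht) hst)⟩
  have h1 : HasDerivWithinAt (fun s => (γ s : E3)) _ (Icc a b) (ε * t) :=
    (h.contDiffOn.differentiableOn (by simp) _ (hm ht)).hasDerivWithinAt
  have h2 : HasDerivWithinAt (fun t => ε * t) ε (Icc a' b') t := by
    simpa using (hasDerivWithinAt_id t (Icc a' b')).const_mul ε
  have h3 := h1.scomp t h2 hm
  have h4 := h3.derivWithin (uniqueDiffOn_Icc hab' t ht)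
  simp only [Function.comp_def] at h4
  rw [h4]
  exact smul_ne_zero hε.ne' (h.velocity_ne_zero _ (hm ht))

/-- The given arc may run through the pole of the projection. Only its part near `x` is kept; the
rest is compact and misses `x`, so it is avoided by shrinking the neighbourhood. -/
theorem IsArcNear.exists_small {N W : Set S2} {x : S2} (h : IsArcNear N x) (hW : W ∈ 𝓝 x) :
    ∃ γ : ℝ → S2, IsSmoothArc γ (-1) 1 ∧ γ 0 = x ∧ γ '' Icc (-1) 1 ⊆ W ∧
      ∃ U ∈ 𝓝 x, N ∩ U = γ '' Icc (-1) 1 ∩ U := by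
  obtain ⟨γ, hγ, hγ0, U, hU, hN⟩ := h
  have h0 : (0 : ℝ) ∈ Icc (-1) 1 := ⟨by norm_num, by norm_num⟩
  have hc : ContinuousAt γ 0 := hγ.continuousOn.continuousAt (Icc_mem_nhds (by norm_num) (by norm_num))
  obtain ⟨r, hr, hrW⟩ := Metric.nhds_basis_closedBall.mem_iff.1 (hc (hγ0.symm ▸ hW))
  rw [Real.closedBall_eq_Icc, zero_sub, zero_add] at hrW
  set ε := min r 1
  have hε : 0 < ε := lt_min hr one_pos
  have hε1 : ε ≤ 1 := min_le_right _ _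
  have hεr : ε ≤ r := min_le_left _ _
  have hb : ∀ t ∈ Icc (-1 : ℝ) 1, -ε ≤ ε * t ∧ ε * t ≤ ε := fun t ht =>
    ⟨by nlinarith [ht.1], by nlinarith [ht.2]⟩
  have hm : MapsTo (fun t => ε * t) (Icc (-1) 1) (Icc (-1) 1) := fun t ht =>
    ⟨by linarith [(hb t ht).1], by linarith [(hb t ht).2]⟩
  have hK : IsCompact (γ '' (Icc (-1) 1 \ Ioo (-ε) ε)) :=
    (isCompact_Icc.diff isOpen_Ioo).image_of_continuousOn (hγ.continuousOn.mono sdiff_subset)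
  have hxK : x ∉ γ '' (Icc (-1) 1 \ Ioo (-ε) ε) := by
    rintro ⟨t, ht, htx⟩
    have := hγ.injOn ht.1 h0 (htx.trans hγ0.symm)
    exact ht.2 (by rw [this]; exact ⟨by linarith, hε⟩)
  refine ⟨fun t => γ (ε * t), hγ.comp_mul hε (by norm_num) hm, by simp [hγ0], ?_, _,
    inter_mem hU (hK.isClosed.isOpen_compl.mem_nhds hxK), ?_⟩
  · rintro _ ⟨t, ht, rfl⟩
    exact hrW ⟨by linarith [(hb t ht).1], by linarith [(hb t ht).2]⟩
  · rw [← inter_assoc, ← inter_assoc, hN]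
    ext z
    constructor
    · rintro ⟨⟨⟨t, ht, rfl⟩, hz2⟩, hz3⟩
      have ht' : t ∈ Ioo (-ε) ε := by
        by_contra hcon
        exact hz3 ⟨t, ⟨ht, hcon⟩, rfl⟩
      refine ⟨⟨⟨t / ε, ⟨?_, ?_⟩, ?_⟩, hz2⟩, hz3⟩
      · rw [le_div_iff₀ hε]; linarith [ht'.1]
      · rw [div_le_one hε]; exact ht'.2.le
      · simp only [mul_div_cancel₀ t hε.ne']
    · rintro ⟨⟨⟨t, ht, rfl⟩, hz2⟩, hz3⟩
      exact ⟨⟨⟨ε * t, hm ht, rfl⟩, hz2⟩, hz3⟩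

theorem HasValence.exists_small {N W : Set S2} {x : S2} {ν : ℕ} (h : HasValence N x ν)
    (hW : W ∈ 𝓝 x) :
    ∃ γ : Fin ν → ℝ → S2, (∀ j, IsSmoothArc (γ j) 0 1 ∧ γ j 0 = x ∧ γ j '' Icc 0 1 ⊆ W) ∧
      (∀ i j, i ≠ j → γ i '' Icc 0 1 ∩ γ j '' Icc 0 1 ⊆ {x}) ∧
      ∃ U ∈ 𝓝 x, N ∩ U = (⋃ j, γ j '' Icc 0 1) ∩ U := by
  obtain ⟨γ, hγ, hdisj, -, U, hU, hN⟩ := h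
  have h0 : (0 : ℝ) ∈ Icc 0 1 := ⟨le_rfl, zero_le_one⟩
  have hr : ∀ j, ∃ r > 0, Icc 0 1 ∩ Icc 0 r ⊆ γ j ⁻¹' W := by
    intro j
    have hc := (hγ j).1.continuousOn 0 h0
    have hmem := hc ((hγ j).2.symm ▸ hW)
    obtain ⟨r, hr, hrW⟩ := (Metric.nhds_basis_closedBall.inf_principal (Icc 0 1)).mem_iff.1 hmem
    rw [Real.closedBall_eq_Icc, zero_sub, zero_add] at hrW
    exact ⟨r, hr, fun t ht => hrW ⟨⟨by linarith [ht.2.1], ht.2.2⟩, ht.1⟩⟩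
  choose r hr hrW using hr
  obtain ⟨ε, hε, hε1, hεr⟩ : ∃ ε > 0, ε ≤ 1 ∧ ∀ j, ε ≤ r j := by
    have : ∀ᶠ ε in 𝓝[>] (0 : ℝ), ε ≤ 1 ∧ ∀ j, ε ≤ r j := by
      refine Eventually.and ?_ (eventually_all.2 fun j => ?_)
      · filter_upwards [Ioo_mem_nhdsGT one_pos] with t ht using ht.2.le
      · filter_upwards [Ioo_mem_nhdsGT (hr j)] with t ht using ht.2.le
    obtain ⟨ε, h1, h2⟩ := (this.and self_mem_nhdsWithin).exists
    exact ⟨ε, h2, h1⟩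
  have hb : ∀ t ∈ Icc (0 : ℝ) 1, 0 ≤ ε * t ∧ ε * t ≤ ε := fun t ht =>
    ⟨mul_nonneg hε.le ht.1, by nlinarith [ht.2]⟩
  have hm : MapsTo (fun t => ε * t) (Icc 0 1) (Icc 0 1) := fun t ht =>
    ⟨(hb t ht).1, (hb t ht).2.trans hε1⟩
  have himg : ∀ j, (fun t => γ j (ε * t)) '' Icc 0 1 ⊆ γ j '' Icc 0 1 := by
    rintro j _ ⟨t, ht, rfl⟩
    exact ⟨_, hm ht, rfl⟩
  have hK : IsClosed (⋃ j, γ j '' Icc ε 1) := isClosed_iUnion_of_finite fun j =>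
    (isCompact_Icc.image_of_continuousOn
      ((hγ j).1.continuousOn.mono (Icc_subset_Icc hε.le le_rfl))).isClosed
  have hxK : x ∉ ⋃ j, γ j '' Icc ε 1 := by
    rw [mem_iUnion]
    rintro ⟨j, t, ht, htx⟩
    have := (hγ j).1.injOn ⟨hε.le.trans ht.1, ht.2⟩ h0 (htx.trans (hγ j).2.symm)
    linarith [ht.1]
  refine ⟨fun j t => γ j (ε * t), fun j => ⟨(hγ j).1.comp_mul hε one_pos hm, by simp [hγ], ?_⟩,
    fun i j hij => (inter_subset_inter (himg i) (himg j)).trans (hdisj i j hij).le, _,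
    inter_mem hU (hK.isOpen_compl.mem_nhds hxK), ?_⟩
  · rintro _ ⟨t, ht, rfl⟩
    exact hrW j ⟨hm ht, (hb t ht).1, (hb t ht).2.trans (hεr j)⟩
  · rw [← inter_assoc, ← inter_assoc, hN]
    ext z
    constructor
    · rintro ⟨⟨hz1, hz2⟩, hz3⟩
      obtain ⟨j, t, ht, rfl⟩ := mem_iUnion.1 hz1
      have ht' : t < ε := by
        by_contra hcon
        exact hz3 (mem_iUnion.2 ⟨j, t, ⟨not_lt.1 hcon, ht.2⟩, rfl⟩)
      refine ⟨⟨mem_iUnion.2 ⟨j, t / ε, ⟨by have := ht.1; positivity, ?_⟩, ?_⟩, hz2⟩, hz3⟩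
      · rw [div_le_one hε]; exact ht'.le
      · simp only [mul_div_cancel₀ t hε.ne']
    · rintro ⟨⟨hz1, hz2⟩, hz3⟩
      obtain ⟨j, hj⟩ := mem_iUnion.1 hz1
      exact ⟨⟨mem_iUnion.2 ⟨j, himg j hj⟩, hz2⟩, hz3⟩

/-- By the chain rule, a change of coordinates with differentiable inverse `g` cannot kill a
velocity. It is used for both directions of the projection. -/
theorem derivWithin_ne_zero_of_comp {E F : Type*} [NormedAddCommGroup E] [NormedSpace ℝ E]
    [NormedAddCommGroup F] [NormedSpace ℝ F] {f : ℝ → E} {g : E → F} {h : ℝ → F} {s : Set ℝ} {t : ℝ}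
    (hg : DifferentiableAt ℝ g (f t)) (hf : DifferentiableWithinAt ℝ f s t)
    (hs : UniqueDiffWithinAt ℝ s t) (ht : t ∈ s) (hgf : EqOn (fun u => g (f u)) h s)
    (hne : derivWithin h s t ≠ 0) : derivWithin f s t ≠ 0 := by
  intro h0
  apply hne
  have h1 := hg.hasFDerivAt.comp_hasDerivWithinAt t hf.hasDerivWithinAt
  rw [h0, map_zero] at h1
  exact (h1.congr (fun u hu => (hgf hu).symm) (hgf ht).symm).derivWithin hs

/-- The stereographic image of a smooth arc. -/
theorem IsSmoothArc.stereographic {γ : ℝ → S2} {a b : ℝ} (h : IsSmoothArc γ a b) (hab : a < b)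
    {q : S2} {σ : E3 → ℂ} {ρ : ℂ → S2} (hρσ : ∀ x, x ≠ q → ρ (σ x) = x)
    (hρ : ContDiff ℝ ∞ (fun z => (ρ z : E3))) (hσ : ∀ x : S2, x ≠ q → ContDiffAt ℝ ∞ σ x)
    (hq : γ '' Icc a b ⊆ {q}ᶜ) :
    ContDiffOn ℝ ∞ (fun t => σ (γ t)) (Icc a b) ∧
      (∀ t ∈ Icc a b, derivWithin (fun t => σ (γ t)) (Icc a b) t ≠ 0) ∧
      InjOn (fun t => σ (γ t)) (Icc a b) := by
  have hγq : ∀ t ∈ Icc a b, γ t ≠ q := fun t ht => hq ⟨t, ht, rfl⟩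
  have hcd : ContDiffOn ℝ ∞ (fun t => σ (γ t)) (Icc a b) := fun t ht =>
    (hσ _ (hγq t ht)).comp_contDiffWithinAt t (h.contDiffOn t ht)
  refine ⟨hcd, fun t ht => ?_, fun s hs t ht hst => ?_⟩
  · refine derivWithin_ne_zero_of_comp (g := fun z => (ρ z : E3)) (h := fun t => (γ t : E3))
      (hρ.differentiable (by simp) _) (hcd.differentiableOn (by simp) t ht)
      (uniqueDiffOn_Icc hab t ht) ht (fun u hu => ?_) (h.velocity_ne_zero t ht)
    simp only [hρσ _ (hγq u hu)]
  · refine h.injOn hs ht ?_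
    rw [← hρσ _ (hγq s hs), ← hρσ _ (hγq t ht)]
    exact congrArg ρ hst

/-- The arc on the sphere that corresponds to a planar edge. -/
theorem IsEdge.isSmoothArc {S : Set ℂ} {L : ℝ} {k : ℝ → ℂ} (hk : IsEdge S L k)
    (hinj : InjOn k (Icc 0 L)) {q : S2} {σ : E3 → ℂ} {ρ : ℂ → S2} (hρi : Function.Injective ρ)
    (hρq : ∀ z, ρ z ≠ q) (hσρ : ∀ z, σ (ρ z) = z)
    (hρ : ContDiff ℝ ∞ (fun z => (ρ z : E3))) (hσ : ∀ x : S2, x ≠ q → ContDiffAt ℝ ∞ σ x) :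
    IsSmoothArc (fun t => ρ (k (L * t))) 0 1 := by
  have hL := hk.pos
  have hm : MapsTo (fun t => L * t) (Icc 0 1) (Icc 0 L) := fun t ht =>
    ⟨mul_nonneg hL.le ht.1, by nlinarith [ht.2]⟩
  have hcd := hk.contDiffOn
  have hu := uniqueDiffOn_Icc hL
  have hnorm : ∀ t ∈ Icc 0 L, ‖derivWithin k (Icc 0 L) t‖ = 1 := by
    have h1 : ContinuousOn (fun t => ‖derivWithin k (Icc 0 L) t‖) (Icc 0 L) :=
      (hcd.continuousOn_derivWithin hu (by simp)).norm
    have h2 : EqOn (fun t => ‖derivWithin k (Icc 0 L) t‖) (fun _ => 1) (Ioo 0 L) := fun t ht => by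
      simp only [derivWithin_of_mem_nhds (Icc_mem_nhds ht.1 ht.2)]
      exact hk.curve.norm_deriv t ht
    exact h2.of_subset_closure h1 continuousOn_const Ioo_subset_Icc_self (closure_Ioo hL.ne).ge
  have hγcd : ContDiffOn ℝ ∞ (fun t => (ρ (k (L * t)) : E3)) (Icc 0 1) :=
    hρ.comp_contDiffOn (hcd.comp (by fun_prop) hm)
  refine ⟨hγcd, fun t ht => ?_, fun s hs t ht hst =>
    mul_left_cancel₀ hL.ne' (hinj (hm hs) (hm ht) (hρi hst))⟩
  refine derivWithin_ne_zero_of_comp (g := σ) (h := fun t => k (L * t))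
    ((hσ _ (hρq _)).differentiableAt (by simp)) (hγcd.differentiableOn (by simp) t ht)
    (uniqueDiffOn_Icc one_pos t ht) ht (fun u _ => hσρ _) ?_
  have h1 := (hcd.differentiableOn (by simp) _ (hm ht)).hasDerivWithinAt
  have h2 : HasDerivWithinAt (fun t => L * t) L (Icc 0 1) t := by
    simpa using (hasDerivWithinAt_id t (Icc 0 1)).const_mul L
  have h3 := (h1.scomp t h2 hm).derivWithin (uniqueDiffOn_Icc one_pos t ht)
  simp only [Function.comp_def] at h3
  rw [h3]
  refine smul_ne_zero hL.ne' ?_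
  rw [← norm_ne_zero_iff, hnorm _ (hm ht)]
  exact one_ne_zero

/-- The domains of a strong partition fill the complement of the boundary set. -/
theorem iUnion_eq_compl_boundarySet {k : ℕ} {D : Fin k → Set S2} (hD : IsPartition D)
    (hs : IsStrong D) : ⋃ i, D i = (boundarySet D)ᶜ := by
  have hcl : closure (⋃ i, D i) = univ :=
    univ_subset_iff.1 (hs ▸ interior_subset)
  rw [boundarySet, (isClosed_iUnion_of_finite fun i => isClosed_frontier).closure_eq]
  ext x
  simp only [mem_iUnion, mem_compl_iff, not_exists]
  refine ⟨fun ⟨i, hi⟩ j hj => ?_, fun h => ?_⟩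
  · rw [(hD.isOpen j).frontier_eq] at hj
    rcases eq_or_ne i j with rfl | hij
    · exact hj.2 hi
    · exact ((hD.disjoint hij).closure_right (hD.isOpen i)).notMem_of_mem_left hi hj.1
  · have hx : x ∈ closure (⋃ i, D i) := hcl ▸ mem_univ x
    rw [closure_iUnion_of_finite, mem_iUnion] at hx
    obtain ⟨i, hi⟩ := hx
    refine ⟨i, by_contra fun hn => h i ?_⟩
    rw [(hD.isOpen i).frontier_eq]
    exact ⟨hi, hn⟩

theorem criticalPoints_subset (N : Set S2) : criticalPoints N ⊆ N := by
  rintro x ⟨ν, hν, γ, hγ, -, -, U, hU, hN⟩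
  have : x ∈ (⋃ j, γ j '' Icc 0 1) ∩ U :=
    ⟨mem_iUnion.2 ⟨⟨0, by omega⟩, 0, by simp, (hγ _).2⟩, mem_of_mem_nhds hU⟩
  rw [← hN] at this
  exact this.1

section Stereographic

variable {q : S2} {σ : E3 → ℂ} {ρ : ℂ → S2}

theorem IsArcNear.hasArcAt {N X : Set S2} (hρe : IsOpenEmbedding ρ) (hρq : ∀ z, ρ z ≠ q)
    (hρσ : ∀ x, x ≠ q → ρ (σ x) = x) (hσρ : ∀ z, σ (ρ z) = z)
    (hρ : ContDiff ℝ ∞ (fun z => (ρ z : E3))) (hσ : ∀ x : S2, x ≠ q → ContDiffAt ℝ ∞ σ x)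
    (hX : IsClosed X) {p : ℂ} (hp : ρ p ∉ X) (h : IsArcNear N (ρ p)) :
    HasArcAt (ρ ⁻¹' N \ ρ ⁻¹' X) p := by
  obtain ⟨γ, hγ, h0, hq, U, hU, hN⟩ := h.exists_small (isOpen_ne.mem_nhds (hρq p))
  obtain ⟨h1, h2, h3⟩ := hγ.stereographic (by norm_num) hρσ hρ hσ hq
  refine hasArcAt_of_arc (hX.preimage hρe.continuous) hp h1 h2 h3 (by simp only [h0, hσρ])
    (hρe.continuous.continuousAt.preimage_mem_nhds hU) ?_
  rw [← preimage_inter, hN, preimage_inter]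
  congr 1
  ext z
  constructor
  · rintro ⟨t, ht, htz⟩
    exact ⟨t, ht, by simp only [htz, hσρ]⟩
  · rintro ⟨t, ht, rfl⟩
    exact ⟨t, ht, (hρσ _ (hq ⟨t, ht, rfl⟩)).symm⟩

theorem HasValence.exists_star {N X : Set S2} {ν : ℕ} (hρe : IsOpenEmbedding ρ)
    (hρq : ∀ z, ρ z ≠ q) (hρσ : ∀ x, x ≠ q → ρ (σ x) = x) (hσρ : ∀ z, σ (ρ z) = z)
    (hρ : ContDiff ℝ ∞ (fun z => (ρ z : E3))) (hσ : ∀ x : S2, x ≠ q → ContDiffAt ℝ ∞ σ x)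
    (hX : X.Finite) {x : ℂ} (hx : ρ x ∈ X) (h : HasValence N (ρ x) ν) :
    ∃ st : Star (ρ ⁻¹' N \ ρ ⁻¹' X) x, st.ν = ν := by
  obtain ⟨γ, hγ, hd, U, hU, hN⟩ := h.exists_small (isOpen_ne.mem_nhds (hρq x))
  have h' j := (hγ j).1.stereographic (by norm_num) hρσ hρ hσ (hγ j).2.2
  have himg : ∀ j t, t ∈ Icc (0 : ℝ) 1 → ρ (σ (γ j t)) = γ j t := fun j t ht =>
    hρσ _ ((hγ j).2.2 ⟨t, ht, rfl⟩)
  refine exists_star_of_arcs (hX.preimage hρe.injective.injOn) hx (fun j => (h' j).1)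
    (fun j => (h' j).2.1) (fun j => (h' j).2.2) (fun j => by simp only [(hγ j).2.1, hσρ]) ?_
    (hρe.continuous.continuousAt.preimage_mem_nhds hU) ?_
  · rintro i j hij z ⟨⟨s, hs, rfl⟩, t, ht, hst⟩
    have hst' : γ j t = γ i s := by
      rw [← himg j t ht, ← himg i s hs]
      exact congrArg ρ hst
    have := hd i j hij ⟨⟨s, hs, rfl⟩, t, ht, hst'⟩
    simp only [mem_singleton_iff] at this ⊢
    rw [this, hσρ]
  · rw [← preimage_inter, hN, preimage_inter, preimage_iUnion]
    congr 1
    refine iUnion_congr fun j => ?_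
    ext z
    constructor
    · rintro ⟨t, ht, htz⟩
      exact ⟨t, ht, by simp only [htz, hσρ]⟩
    · rintro ⟨t, ht, rfl⟩
      exact ⟨t, ht, (himg j t ht).symm⟩

theorem IsPartition.planarPartition {D : Fin 3 → Set S2} (hD : IsPartition D)
    (hreg : IsRegularPartition D) (hstrong : IsStrong D) (hadm : ¬ IsAdmissible D)
    (hρe : IsOpenEmbedding ρ) (hr : range ρ = {q}ᶜ) (hq : q ∉ boundarySet D)
    (hρσ : ∀ x, x ≠ q → ρ (σ x) = x) (hσρ : ∀ z, σ (ρ z) = z)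
    (hρ : ContDiff ℝ ∞ (fun z => (ρ z : E3))) (hσ : ∀ x : S2, x ≠ q → ContDiffAt ℝ ∞ σ x) :
    PlanarPartition (ρ ⁻¹' boundarySet D \ ρ ⁻¹' criticalPoints (boundarySet D))
      (ρ ⁻¹' criticalPoints (boundarySet D)) (fun i => ρ ⁻¹' D i) := by
  have hρq : ∀ z, ρ z ≠ q := fun z => by
    have : ρ z ∈ range ρ := mem_range_self z
    rwa [hr] at this
  have hNr : boundarySet D ⊆ range ρ := by
    rw [hr]
    exact fun x hx hxq => hq (hxq ▸ hx)
  have hU := iUnion_eq_compl_boundarySet hD hstrong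
  have hX := hreg.finite_criticalPoints
  have hSX : ρ ⁻¹' boundarySet D \ ρ ⁻¹' criticalPoints (boundarySet D) ∪
      ρ ⁻¹' criticalPoints (boundarySet D) = ρ ⁻¹' boundarySet D :=
    sdiff_union_of_subset (preimage_mono (criticalPoints_subset _))
  have hadj : ∀ i j, i ≠ j → ∃ p ∈ ρ ⁻¹' boundarySet D \ ρ ⁻¹' criticalPoints (boundarySet D),
      p ∈ closure (ρ ⁻¹' D i) ∧ p ∈ closure (ρ ⁻¹' D j) := fun i j hij => by
    -- Avoiding the critical points puts the common point in `S`; avoiding `q` puts it in the chart.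
    obtain ⟨p, hpF, hpi, hpj⟩ := exists_mem_closure_inter (hD.isOpen i) (hD.isOpen j)
      (hD.isConnected i).nonempty (hD.isConnected j).nonempty
      (adj_of_not_isAdmissible hadm hij).2 (hX.union (finite_singleton q))
    rw [mem_union, not_or] at hpF
    obtain ⟨z, rfl⟩ : p ∈ range ρ := hr ▸ hpF.2
    rw [← hρe.isOpenMap.preimage_closure_eq_closure_preimage hρe.continuous,
      ← hρe.isOpenMap.preimage_closure_eq_closure_preimage hρe.continuous]
    -- A point off the boundary set lies in one domain, which is open, so it is in the closure of no
    -- other.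
    refine ⟨z, ⟨by_contra fun hn => ?_, hpF.1⟩, hpi, hpj⟩
    have hz : ρ z ∈ ⋃ i, D i := hU ▸ hn
    obtain ⟨m, hm⟩ := mem_iUnion.1 hz
    have key : ∀ l, ρ z ∈ closure (D l) → m = l := fun l hl => by_contra fun hml =>
      ((hD.disjoint hml).closure_right (hD.isOpen m)).notMem_of_mem_left hm hl
    exact hij ((key i hpi).symm.trans (key j hpj))
  refine ⟨?_, hX.preimage hρe.injective.injOn, disjoint_sdiff_left, fun p hp => ?_,
    fun i => (hD.isOpen i).preimage hρe.continuous, fun i => ?_,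
    fun i j hij => (hD.disjoint hij).preimage ρ, fun i => ?_, ?_, hadj⟩
  · rw [hSX]
    exact (hρe.isInducing.isCompact_preimage_iff hNr).2 hreg.isClosed.isCompact
  · exact (hreg.isArcNear _ hp).hasArcAt hρe hρq hρσ hσρ hρ hσ hX.isClosed hp.2
  · rw [← hρe.isInducing.isPreconnected_image, image_preimage_eq_inter_range, hr,
      ← sdiff_eq]
    exact isPreconnected_diff_singleton (hD.isOpen i) (hD.isConnected i).isPreconnected q
  · obtain ⟨j, hj⟩ : ∃ j, i ≠ j := ⟨i + 1, by fin_cases i <;> decide⟩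
    obtain ⟨p, -, hp, -⟩ := hadj i j hj
    exact closure_nonempty_iff.1 ⟨p, hp⟩
  · rw [hSX, ← preimage_iUnion, hU, preimage_compl]

end Stereographic

end SpherePartition

/-! ### The theorem on the sphere. -/

theorem proposition4p3 (D : Fin 3 → Set S2) (hD : IsPartition D) (hreg : IsRegularPartition D)
    (hstrong : IsStrong D) (hadm : ¬ IsAdmissible D) :
    ∃ x₁ x₂ : S2, x₁ ≠ x₂ ∧
      criticalPoints (boundarySet D) = {x₁, x₂} ∧
      HasValence (boundarySet D) x₁ 3 ∧ HasValence (boundarySet D) x₂ 3 ∧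
      ∃ γ : Fin 3 → ℝ → S2,
        (∀ j, IsSmoothArc (γ j) 0 1 ∧ γ j 0 = x₁ ∧ γ j 1 = x₂) ∧
        (∀ i j, i ≠ j → γ i '' Icc 0 1 ∩ γ j '' Icc 0 1 = {x₁, x₂}) ∧
        boundarySet D = ⋃ j, γ j '' Icc 0 1 := by
  -- The pole lies inside a domain, so the whole boundary set is in the chart and its image is
  -- compact.
  obtain ⟨q, hq⟩ := (hD.isConnected 0).nonempty
  have hqN : q ∉ boundarySet D := by
    have : q ∈ ⋃ i, D i := mem_iUnion.2 ⟨0, hq⟩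
    rwa [iUnion_eq_compl_boundarySet hD hstrong] at this
  obtain ⟨σ, ρ, hρe, hr, hσρ, hρ, hσ⟩ := exists_stereographic q
  have hρσ : ∀ x : S2, x ≠ q → ρ (σ x) = x := fun x hx => by
    obtain ⟨z, rfl⟩ : x ∈ range ρ := hr ▸ hx
    rw [hσρ]
  have hρq : ∀ z, ρ z ≠ q := fun z => by
    have : ρ z ∈ range ρ := mem_range_self z
    rwa [hr] at this
  have hNr : boundarySet D ⊆ range ρ := by
    rw [hr]
    exact fun x hx hxq => hqN (hxq ▸ hx)
  have hP := hD.planarPartition hreg hstrong hadm hρe hr hqN hρσ hσρ hρ hσ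
  have hXN := criticalPoints_subset (boundarySet D)
  set N := boundarySet D with hNdef
  set X := criticalPoints N with hXdef
  have hX : X.Finite := hreg.finite_criticalPoints
  -- The valence on the sphere is kept with the star, so that the planar count `ν = 3` gives
  -- `HasValence` with 3.
  have hex : ∀ x : ρ ⁻¹' X, ∃ st : Star (ρ ⁻¹' N \ ρ ⁻¹' X) x, 3 ≤ st.ν ∧
      HasValence N (ρ x) st.ν := by
    rintro ⟨x, ν, hν, hv⟩
    obtain ⟨st, rfl⟩ := hv.exists_star hρe hρq hρσ hσρ hρ hσ hX ⟨ν, hν, hv⟩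
    exact ⟨st, hν, hv⟩
  choose st h3 hv using hex
  obtain ⟨x₁, x₂, hne, hall, hν₁, hν₂, L, k, hk, hdisj, hcov⟩ := hP.exists_theta st h3
  have hXeq : X = {ρ x₁, ρ x₂} := by
    ext x
    refine ⟨fun hx => ?_, ?_⟩
    · obtain ⟨z, rfl⟩ := hNr (hXN hx)
      rcases hall ⟨z, hx⟩ with h | h
      · exact Or.inl (congrArg (fun y : ρ ⁻¹' X => ρ y) h)
      · exact Or.inr (congrArg (fun y : ρ ⁻¹' X => ρ y) h)
    · rintro (rfl | rfl)
      exacts [x₁.2, x₂.2]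
  have hScl : IsClosed (ρ ⁻¹' N) := hreg.isClosed.preimage hρe.continuous
  have himg : ∀ j, (fun t => ρ (k j (L j * t))) '' Icc 0 1 = ρ '' (k j '' Icc 0 (L j)) :=
    fun j => by
    have hL := (hk j).1.pos
    have : (fun t => L j * t) '' Icc (0 : ℝ) 1 = Icc 0 (L j) := by
      rw [image_mul_left_Icc hL.le zero_le_one]; simp
    rw [← this, image_image, image_image]
  have hIcc : ∀ j, k j '' Icc 0 (L j) = k j '' Ioo 0 (L j) ∪ {(x₁ : ℂ), (x₂ : ℂ)} := fun j => by
    rw [← Ioo_union_both (hk j).1.pos.le, image_union, image_pair, (hk j).2.2.1, (hk j).2.2.2]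
  have hIoo : ∀ j, k j '' Ioo 0 (L j) ⊆ ρ ⁻¹' N \ ρ ⁻¹' X := fun j =>
    (hk j).1.curve.mapsTo.image_subset
  refine ⟨ρ x₁, ρ x₂, fun h => hne (Subtype.ext (hρe.injective h)), hXeq, hν₁ ▸ hv x₁,
    hν₂ ▸ hv x₂, fun j t => ρ (k j (L j * t)), fun j => ⟨(hk j).1.isSmoothArc (hk j).2.1
      hρe.injective hρq hσρ hρ hσ, by simp [(hk j).2.2.1], by simp [(hk j).2.2.2]⟩,
    fun i j hij => ?_, ?_⟩
  · rw [himg, himg, ← image_inter hρe.injective, hIcc, hIcc, ← inter_union_distrib_right,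
      (hdisj i j hij).inter_eq, empty_union, image_pair]
  · simp only [himg]
    rw [← image_iUnion]
    refine Subset.antisymm (fun x hx => ?_) ?_
    · obtain ⟨z, rfl⟩ := hNr hx
      refine mem_image_of_mem ρ ?_
      by_cases hz : ρ z ∈ X
      · refine mem_iUnion.2 ⟨0, ?_⟩
        rw [hIcc]
        rw [hXeq] at hz
        rcases hz with h | h
        · exact Or.inr (Or.inl (hρe.injective h))
        · exact Or.inr (Or.inr (hρe.injective h))
      · exact iUnion_mono (fun j => image_mono Ioo_subset_Icc_self) (hcov ⟨hx, hz⟩)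
    · rw [image_subset_iff]
      exact iUnion_subset fun j => ((hk j).1.mapsTo_Icc hScl sdiff_subset).image_subset
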